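/- All manifolds are smooth, finite-dimensional, of pure dimension, Hausdorff and second countable. On a symplectic manifold $(S,\omega)$ the Hamiltonian vector field $X_f$ is given by $\omega(Z,X_f)=df(Z)$ and the Poisson bracket by $\{f,g\}=X_fg$; $P^-$ is the Poisson manifold $P$ with minus its Poisson bracket. \textbf{Reduction.} Let $J:S\to P^-$ and $\rho:S_\rho\to P$ be Poisson maps, with $S,S_\rho$ symplectic and $P$ a Poisson manifold. Put $S*_PS_\rho=\{(x,y)\in S\times S_\rho: J(x)=\rho(y)\}$, and let $\mathcal F$ be the foliation of $S*_PS_\rho$ generated by the vector fields $X_{J^*f}-X_{\rho^*f}$, $f\in C^\infty(P)$: two points lie in the same leaf iff they are joined by finitely many integral curves of such fields within $S*_PS_\rho$. Let $S^\rho=(S*_PS_\rho)/\mathcal F$ be the leaf space, $[x,y]$ the class of $(x,y)$. We say that \emph{$S^\rho$ is a manifold} if $S*_PS_\rho$ is a submanifold of $S\times S_\rho$ with tangent spaces $\{(u,v): J_*u=\rho_*v\}$, and $S^\rho$ (with the quotient topology) is a manifold such that the projection $p:S*_PS_\rho\to S^\rho$ is a submersion whose vertical vectors are those tangent to $\mathcal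 F$. The reduced symplectic form $\omega^\rho$ is then the one for which $p^*\omega^\rho$ is the restriction of $\omega_S\oplus\omega_{S_\rho}$ to $S*_PS_\rho$. If $A\subset C^\infty(S)$ is a Poisson subalgebra that Poisson-commutes with $J^*C^\infty(P)$, the representation of $A$ induced by $\rho$ is $\pi^\rho:A\to C^\infty(S^\rho)$, $\pi^\rho(f)([x,y])=f(x)$. \textbf{Theorem (symplectic induction in stages).} Let $S,\tilde S,S_\sigma,S_\rho$ be symplectic manifolds, $P,\tilde P$ Poisson manifolds, and $J:S\to P^-$, $\rho:S_\rho\to P$, $\tilde J:\tilde S\to\tilde P^-$, $\hat J:\tilde S\to P$, $\sigma:S_\sigma\to\tilde P$ Poisson maps, such that $\hat J^*C^\infty(P)$ and $\tilde J^*C^\infty(\tilde P)$ Poisson-commute in $C^\infty(\tilde S)$. Let $A\subset C^\infty(S)$ be a Poisson subalgebra that Poisson-commutes with $J^*C^\infty(P)$. Assume that $\rho$ is itself induced from $\sigma$ through $\tilde S$: the leaf space $\tilde S^\sigma=(\tilde S*_{\tilde P}S_\sigma)/\mathcal F_1$ constructed with $\tilde J$ and $\sigma$ is a manifold, and there is a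 symplectomorphism $T:\tilde S^\sigma\to S_\rho$ with $\rho(T[y,z])=\hat J(y)$. Assume moreover that the leaf spaces $S^\rho=(S*_PS_\rho)/\mathcal F$ and $S'=(S*_P\tilde S)/\mathcal F$, constructed with $J,\rho$ and with $J,\hat J$, respectively, are manifolds. Then $S'$ and $S^\rho$ carry their reduced symplectic forms, and: i) There is a well-defined Poisson map $J':S'\to\tilde P^-$ with $J'([x,y])=\tilde J(y)$, and a Poisson morphism $\mu:A\to C^\infty(S')$ with $(\mu(f))([x,y])=f(x)$; moreover $\mu(A)$ Poisson-commutes with $(J')^*C^\infty(\tilde P)$. ii) The leaf space $(S')^\sigma=(S'*_{\tilde P}S_\sigma)/\tilde{\mathcal F}$ constructed with $J'$ and $\sigma$ is a manifold with a reduced symplectic form, and there is a symplectomorphism $\Phi:(S')^\sigma\to S^\rho$. The representations $\pi^\sigma:A\to C^\infty((S')^\sigma)$, $\pi^\sigma(f)([s,z])=(\mu(f))(s)$, and $\pi^\rho:A\to C^\infty(S^\rho)$, $\pi^\rho(f)([x,y])=f(x)$, are well-defined Poisson morphisms, and $\pi^\sigma(f)=\pi^\rho(f)\circ\Phi$ for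 all $f\in A$. iii) If $A=J_2^*C^\infty(P_2)$ for a Poisson manifold $P_2$ and a Poisson map $J_2:S\to P_2$, then $J_2'([x,y])=J_2(x)$ defines a Poisson map $J_2':S'\to P_2$, and the symplectic realizations $J^\sigma:(S')^\sigma\to P_2$, $J^\sigma([s,z])=J_2'(s)$, and $J^\rho:S^\rho\to P_2$, $J^\rho([x,y])=J_2(x)$, are well-defined Poisson maps and are equivalent: $J^\sigma=J^\rho\circ\Phi$. -/

import Mathlib

open scoped Manifold ContDiff
open Function

noncomputable section

/-- Smooth real-valued functions on an `n`-dimensional manifold. -/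
abbrev SmoothFn (n : ℕ) (M : Type*) [TopologicalSpace M]
    [ChartedSpace (EuclideanSpace ℝ (Fin n)) M] :=
  C^∞⟮𝓡 n, M; 𝓘(ℝ, ℝ), ℝ⟯

/-- A smooth, Hausdorff, second countable manifold of dimension `n`, without boundary; for a type
that already has a topology, this topology is kept. -/
class SmoothManifold (n : ℕ) (M : Type*) [TopologicalSpace M] extends
    ChartedSpace (EuclideanSpace ℝ (Fin n)) M, IsManifold (𝓡 n) ∞ M,
    T2Space M, SecondCountableTopology M

/-! ### Symplectic manifolds -/

/-- A field of alternating bilinear forms on the tangent spaces. -/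
abbrev TwoForm (n : ℕ) (S : Type*) [TopologicalSpace S]
    [ChartedSpace (EuclideanSpace ℝ (Fin n)) S] :=
  (x : S) → TangentSpace (𝓡 n) x [⋀^Fin 2]→L[ℝ] ℝ

/-- The expression of a two-form in the chart `e`, that is, its pull-back along `e.symm`. -/
def TwoForm.inChart {n : ℕ} {S : Type*} [TopologicalSpace S]
    [ChartedSpace (EuclideanSpace ℝ (Fin n)) S] (Ω : TwoForm n S)
    (e : OpenPartialHomeomorph S (EuclideanSpace ℝ (Fin n))) :
    EuclideanSpace ℝ (Fin n) → EuclideanSpace ℝ (Fin n) [⋀^Fin 2]→L[ℝ] ℝ :=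
  fun y => (Ω (e.symm y)).compContinuousLinearMap (mfderiv (𝓡 n) (𝓡 n) e.symm y)

/-- A symplectic form: a smooth, closed, non-degenerate two-form. -/
structure SymplecticForm (n : ℕ) (S : Type*) [TopologicalSpace S]
    [ChartedSpace (EuclideanSpace ℝ (Fin n)) S] where
  form : TwoForm n S
  smooth' : ∀ e ∈ atlas (EuclideanSpace ℝ (Fin n)) S, ContDiffOn ℝ ∞ (TwoForm.inChart form e) e.target
  closed' : ∀ e ∈ atlas (EuclideanSpace ℝ (Fin n)) S, ∀ y ∈ e.target,
    extDeriv (TwoForm.inChart form e) y = 0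
  nondegenerate' : ∀ (x : S) (u : TangentSpace (𝓡 n) x), (∀ v, form x ![u, v] = 0) → u = 0

theorem exists_of_nondegenerate {E : Type*} [NormedAddCommGroup E] [NormedSpace ℝ E]
    [FiniteDimensional ℝ E] (α : E [⋀^Fin 2]→L[ℝ] ℝ)
    (hα : ∀ u : E, (∀ v, α ![u, v] = 0) → u = 0) (l : E →L[ℝ] ℝ) :
    ∃ v : E, ∀ w : E, α ![w, v] = l w := by
  have u0 : ∀ a b c : E, Function.update ![a, b] 0 c = ![c, b] := fun a b c => by
    ext i; fin_cases i <;> rfl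
  have u1 : ∀ a b c : E, Function.update ![a, b] 1 c = ![a, c] := fun a b c => by
    ext i; fin_cases i <;> rfl
  let B : E →ₗ[ℝ] E →ₗ[ℝ] ℝ := LinearMap.mk₂ ℝ (fun v w => α ![w, v])
    (fun v v' w => by simpa only [u1] using α.map_update_add ![w, v] 1 v v')
    (fun c v w => by simpa only [u1] using α.map_update_smul ![w, v] 1 c v)
    (fun v w w' => by simpa only [u0] using α.map_update_add ![w, v] 0 w w')
    (fun c v w => by simpa only [u0] using α.map_update_smul ![w, v] 0 c w)
  have hB : Function.Injective B := by
    rw [injective_iff_map_eq_zero]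
    intro v hv
    refine hα v fun w => ?_
    have h1 : α ![w, v] = 0 := congrArg (fun l : E →ₗ[ℝ] ℝ => l w) hv
    have h2 : α (![w, v] ∘ Equiv.swap 0 1) = -α ![w, v] :=
      α.toAlternatingMap.map_swap ![w, v] (i := 0) (j := 1) (by decide)
    have h3 : ![w, v] ∘ Equiv.swap (0 : Fin 2) 1 = ![v, w] := by
      ext i; fin_cases i <;> rfl
    rw [h3, h1, neg_zero] at h2
    exact h2
  have hs : Function.Surjective B :=
    (LinearMap.injective_iff_surjective_of_finrank_eq_finrank
      (Subspace.dual_finrank_eq (K := ℝ) (V := E)).symm).1 hB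
  obtain ⟨v, hv⟩ := hs (l : E →ₗ[ℝ] ℝ)
  exact ⟨v, fun w => congrArg (fun l : E →ₗ[ℝ] ℝ => l w) hv⟩

namespace SymplecticForm

variable {n : ℕ} {S : Type*} [TopologicalSpace S] [ChartedSpace (EuclideanSpace ℝ (Fin n)) S]

theorem exists_hamVec (Ω : SymplecticForm n S) (F : S → ℝ) (x : S) :
    ∃ v : TangentSpace (𝓡 n) x, ∀ w : TangentSpace (𝓡 n) x,
      Ω.form x ![w, v] = mfderiv (𝓡 n) 𝓘(ℝ, ℝ) F x w :=
  exists_of_nondegenerate (E := EuclideanSpace ℝ (Fin n)) (Ω.form x) (Ω.nondegenerate' x)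
    (mfderiv (𝓡 n) 𝓘(ℝ, ℝ) F x)

/-- The Hamiltonian vector field `X_F` of `F`, given by `Ω (w, X_F) = dF w`. -/
def hamVec (Ω : SymplecticForm n S) (F : S → ℝ) (x : S) : TangentSpace (𝓡 n) x :=
  Classical.choose (Ω.exists_hamVec F x)

theorem hamVec_spec (Ω : SymplecticForm n S) (F : S → ℝ) (x : S) (w : TangentSpace (𝓡 n) x) :
    Ω.form x ![w, Ω.hamVec F x] = mfderiv (𝓡 n) 𝓘(ℝ, ℝ) F x w :=
  Classical.choose_spec (Ω.exists_hamVec F x) w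

/-- The Poisson bracket `{F, G} = X_F G` of a symplectic manifold. -/
def bracket (Ω : SymplecticForm n S) (F G : S → ℝ) (x : S) : ℝ :=
  mfderiv (𝓡 n) 𝓘(ℝ, ℝ) G x (Ω.hamVec F x)

end SymplecticForm

/-! ### Poisson manifolds and Poisson maps -/

/-- A Poisson structure: a Lie bracket on the smooth functions which is a derivation in each
argument. -/
structure PoissonStructure (n : ℕ) (P : Type*) [TopologicalSpace P]
    [ChartedSpace (EuclideanSpace ℝ (Fin n)) P] where
  bracket : SmoothFn n P →ₗ[ℝ] SmoothFn n P →ₗ[ℝ] SmoothFn n P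
  bracket_self : ∀ f, bracket f f = 0
  leibniz : ∀ f g h, bracket f (g * h) = bracket f g * h + g * bracket f h
  jacobi : ∀ f g h, bracket f (bracket g h) + bracket g (bracket h f) + bracket h (bracket f g) = 0

/-- The opposite Poisson structure, that of `P⁻`. -/
def PoissonStructure.neg {n : ℕ} {P : Type*} [TopologicalSpace P]
    [ChartedSpace (EuclideanSpace ℝ (Fin n)) P] (π : PoissonStructure n P) :
    PoissonStructure n P where
  bracket := -π.bracket
  bracket_self f := by simp [π.bracket_self]
  leibniz f g h := by
    simp only [LinearMap.neg_apply, π.leibniz]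
    ring
  jacobi f g h := by
    simpa only [LinearMap.neg_apply, map_neg, neg_neg] using π.jacobi f g h

/-- A (smooth) Poisson map from a symplectic manifold to a Poisson manifold. -/
def IsPoissonMap {n k : ℕ} {S P : Type*} [TopologicalSpace S]
    [ChartedSpace (EuclideanSpace ℝ (Fin n)) S] [TopologicalSpace P]
    [ChartedSpace (EuclideanSpace ℝ (Fin k)) P]
    (Ω : SymplecticForm n S) (π : PoissonStructure k P) (J : S → P) : Prop :=
  ContMDiff (𝓡 n) (𝓡 k) ∞ J ∧
    ∀ (f g : SmoothFn k P) (x : S), Ω.bracket (f ∘ J) (g ∘ J) x = π.bracket f g (J x)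

/-- The algebra `A` of smooth functions is closed under the Poisson bracket. -/
def IsPoissonSubalgebra {n : ℕ} {S : Type*} [TopologicalSpace S]
    [ChartedSpace (EuclideanSpace ℝ (Fin n)) S] (Ω : SymplecticForm n S)
    (A : NonUnitalSubalgebra ℝ (SmoothFn n S)) : Prop :=
  ∀ f ∈ A, ∀ g ∈ A, ∃ h ∈ A, ∀ x, h x = Ω.bracket f g x

/-- The algebra homomorphism `φ` preserves Poisson brackets. -/
def IsPoissonMorphism {n m : ℕ} {S R : Type*} [TopologicalSpace S]
    [ChartedSpace (EuclideanSpace ℝ (Fin n)) S] [TopologicalSpace R]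
    [ChartedSpace (EuclideanSpace ℝ (Fin m)) R]
    (Ω : SymplecticForm n S) (ΩR : SymplecticForm m R)
    {A : NonUnitalSubalgebra ℝ (SmoothFn n S)} (φ : A →ₙₐ[ℝ] SmoothFn m R) : Prop :=
  ∀ f g h : A, (∀ x, h.1 x = Ω.bracket f.1 g.1 x) → ∀ y, φ h y = ΩR.bracket (φ f) (φ g) y

/-! ### Symplectic induction

For `J : S → P` and `ρ : Sρ → P` the space `J.Pullback ρ` is the set of pairs `(x, y)` with
`J x = ρ y`, with the topology of a subspace of `S × Sρ`. -/

section Induction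

variable {n nρ k : ℕ} {S Sρ P : Type*}
  [TopologicalSpace S] [ChartedSpace (EuclideanSpace ℝ (Fin n)) S]
  [TopologicalSpace Sρ] [ChartedSpace (EuclideanSpace ℝ (Fin nρ)) Sρ]
  [TopologicalSpace P] [ChartedSpace (EuclideanSpace ℝ (Fin k)) P]

/-- The point `b` of the fibre product is reached from `a` in time one along the vector field
`X_{f ∘ J} - X_{f ∘ ρ}`, the Hamiltonian vector field of `f ∘ J - f ∘ ρ` on `S × Sρ`, for some
smooth `f` on `P`, by a curve within the fibre product. -/
def LeafStep (Ω : SymplecticForm n S) (Ωρ : SymplecticForm nρ Sρ) (J : S → P) (ρ : Sρ → P)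
    (a b : J.Pullback ρ) : Prop :=
  ∃ (f : SmoothFn k P) (γ : ℝ → S) (δ : ℝ → Sρ),
    IsMIntegralCurveOn (I := 𝓡 n) γ (fun x => Ω.hamVec (f ∘ J) x) (Set.Icc 0 1) ∧
    IsMIntegralCurveOn (I := 𝓡 nρ) δ (fun y => -Ωρ.hamVec (f ∘ ρ) y) (Set.Icc 0 1) ∧
    (∀ t ∈ Set.Icc (0 : ℝ) 1, J (γ t) = ρ (δ t)) ∧
    γ 0 = a.fst ∧ δ 0 = a.snd ∧ γ 1 = b.fst ∧ δ 1 = b.snd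

/-- Two points are in the same leaf of the foliation generated by the vector fields
`X_{f ∘ J} - X_{f ∘ ρ}` iff finitely many of their integral curves, traversed in either direction,
lead from one to the other. -/
def leafSetoid (Ω : SymplecticForm n S) (Ωρ : SymplecticForm nρ Sρ) (J : S → P) (ρ : Sρ → P) :
    Setoid (J.Pullback ρ) :=
  Relation.EqvGen.setoid (LeafStep (k := k) Ω Ωρ J ρ)

/-- The leaf space, with the quotient topology. -/
abbrev LeafSpace (Ω : SymplecticForm n S) (Ωρ : SymplecticForm nρ Sρ) (J : S → P) (ρ : Sρ → P) :
    Type _ :=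
  Quotient (leafSetoid (k := k) Ω Ωρ J ρ)

/-- The projection of the fibre product onto the leaf space. -/
def toLeaf (Ω : SymplecticForm n S) (Ωρ : SymplecticForm nρ Sρ) (J : S → P) (ρ : Sρ → P) :
    J.Pullback ρ → LeafSpace (k := k) Ω Ωρ J ρ :=
  Quotient.mk _

/-- The given smooth structures on the fibre product and on the leaf space are the right ones: the
fibre product is a submanifold of `S × Sρ` whose tangent vectors are the pairs `(u, v)` with
`dJ u = dρ v`, and the leaf space is the quotient manifold by the foliation: the projection is
a submersion whose vertical vectors are the vectors tangent to the foliation. (The vectors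
`X_{f ∘ J} - X_{f ∘ ρ}` at a point already form a linear subspace, as `f` varies.) -/
structure IsManifoldReduction (Ω : SymplecticForm n S) (Ωρ : SymplecticForm nρ Sρ)
    (J : S → P) (ρ : Sρ → P) (m r : ℕ)
    [ChartedSpace (EuclideanSpace ℝ (Fin m)) (J.Pullback ρ)]
    [ChartedSpace (EuclideanSpace ℝ (Fin r)) (LeafSpace (k := k) Ω Ωρ J ρ)] : Prop where
  smooth_fst : ContMDiff (𝓡 m) (𝓡 n) ∞ (Pullback.fst : J.Pullback ρ → S)
  smooth_snd : ContMDiff (𝓡 m) (𝓡 nρ) ∞ (Pullback.snd : J.Pullback ρ → Sρ)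
  immersion : ∀ (q : J.Pullback ρ) (a : TangentSpace (𝓡 m) q),
    mfderiv (𝓡 m) (𝓡 n) (Pullback.fst : J.Pullback ρ → S) q a = 0 →
    mfderiv (𝓡 m) (𝓡 nρ) (Pullback.snd : J.Pullback ρ → Sρ) q a = 0 → a = 0
  tangent_iff : ∀ (q : J.Pullback ρ) (u : TangentSpace (𝓡 n) q.fst)
    (v : TangentSpace (𝓡 nρ) q.snd),
    (∃ a : TangentSpace (𝓡 m) q,
      mfderiv (𝓡 m) (𝓡 n) (Pullback.fst : J.Pullback ρ → S) q a = u ∧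
      mfderiv (𝓡 m) (𝓡 nρ) (Pullback.snd : J.Pullback ρ → Sρ) q a = v) ↔
    (mfderiv (𝓡 n) (𝓡 k) J q.fst u : EuclideanSpace ℝ (Fin k)) =
      mfderiv (𝓡 nρ) (𝓡 k) ρ q.snd v
  smooth_proj : ContMDiff (𝓡 m) (𝓡 r) ∞ (toLeaf (k := k) Ω Ωρ J ρ)
  submersion : ∀ q : J.Pullback ρ,
    Surjective (mfderiv (𝓡 m) (𝓡 r) (toLeaf (k := k) Ω Ωρ J ρ) q)
  vertical_iff : ∀ (q : J.Pullback ρ) (a : TangentSpace (𝓡 m) q),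
    mfderiv (𝓡 m) (𝓡 r) (toLeaf (k := k) Ω Ωρ J ρ) q a = 0 ↔
    ∃ f : SmoothFn k P,
      mfderiv (𝓡 m) (𝓡 n) (Pullback.fst : J.Pullback ρ → S) q a = Ω.hamVec (f ∘ J) q.fst ∧
      mfderiv (𝓡 m) (𝓡 nρ) (Pullback.snd : J.Pullback ρ → Sρ) q a = -Ωρ.hamVec (f ∘ ρ) q.snd

/-- The pull-back of `ΩR` along `p : J.Pullback ρ → R` is the restriction to the fibre product of
the product symplectic form. For `p` the projection onto the leaf space, this is the defining
property of the reduced symplectic form. -/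
def PullsBackToProduct (Ω : SymplecticForm n S) (Ωρ : SymplecticForm nρ Sρ)
    (J : S → P) (ρ : Sρ → P) (m : ℕ) [ChartedSpace (EuclideanSpace ℝ (Fin m)) (J.Pullback ρ)]
    {r : ℕ} {R : Type*} [TopologicalSpace R] [ChartedSpace (EuclideanSpace ℝ (Fin r)) R]
    (ΩR : SymplecticForm r R) (p : J.Pullback ρ → R) : Prop :=
  ∀ (q : J.Pullback ρ) (a b : TangentSpace (𝓡 m) q),
    ΩR.form (p q) ![mfderiv (𝓡 m) (𝓡 r) p q a, mfderiv (𝓡 m) (𝓡 r) p q b] =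
      Ω.form q.fst
        ![mfderiv (𝓡 m) (𝓡 n) (Pullback.fst : J.Pullback ρ → S) q a,
          mfderiv (𝓡 m) (𝓡 n) (Pullback.fst : J.Pullback ρ → S) q b] +
      Ωρ.form q.snd
        ![mfderiv (𝓡 m) (𝓡 nρ) (Pullback.snd : J.Pullback ρ → Sρ) q a,
          mfderiv (𝓡 m) (𝓡 nρ) (Pullback.snd : J.Pullback ρ → Sρ) q b]

end Induction

/-- The diffeomorphism `Φ` is a symplectomorphism. -/
def IsSymplectomorphism {n m : ℕ} {S R : Type*} [TopologicalSpace S]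
    [ChartedSpace (EuclideanSpace ℝ (Fin n)) S] [TopologicalSpace R]
    [ChartedSpace (EuclideanSpace ℝ (Fin m)) R]
    (ΩS : SymplecticForm n S) (ΩR : SymplecticForm m R) (Φ : S ≃ₘ⟮𝓡 n, 𝓡 m⟯ R) : Prop :=
  ∀ (x : S) (u v : TangentSpace (𝓡 n) x),
    ΩR.form (Φ x) ![mfderiv (𝓡 n) (𝓡 m) Φ x u, mfderiv (𝓡 n) (𝓡 m) Φ x v] = ΩS.form x ![u, v]

end

/-! Write τ for `T` composed with the projection of the fibre product of `Jt` and `σ`, so that τ(y,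
z) lies in `Sρ` and ρ(τ(y, z)) = Jh y. Let W be the set of triples (x, y, z) with J x = Jh y and Jt
y = σ z. It maps onto the fibre product of `J'` and `σ` by ([x, y], z), and onto the fibre product
of `J` and `ρ` by (x, τ(y, z)). The map sought is Φ[[x, y], z] = [x, τ(y, z)]. The reduced forms of
both sides pull back to Ω + Ωt + Ωσ on W, so Φ is symplectic as soon as it is a diffeomorphism. W
itself is never made a manifold: its points appear as `AreRelated`, its tangent vectors as
`AreLifts`.

Two facts about Hamiltonian vectors carry the argument. Since the pull-backs along `Jh` and `Jt`
commute, X_{f∘Jh} is killed by the differential of `Jt`, and X_{g∘Jt} by that of `Jh`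
(`mfderiv_hamVec_eq_zero`). If p presents a reduced space, F∘p = f + g and (X_f, X_g) is tangent to
the fibre product, then p sends (X_f, X_g) to X_F (`hamVec_of_comp_eq_add`). Hence τ sends
(X_{f∘Jh}, 0) to X_{f∘ρ}, and the projection to S' sends (0, X_{g∘Jt}) to X_{g∘J'}.

Existence of the reduced forms: the restricted product form has exactly the vertical vectors as its
kernel (`productForm_ker_iff`), and a closed form that annihilates the vertical vectors is constant
along the leaves (`productForm_invariant`), so it descends.

The fibre product of `J'` and `σ` is a manifold because it is locally a smooth retract of constant
rank (`exists_localRetraction`, `exists_manifold_of_localRetraction`). The rank is found by counting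
dimensions in the tangent spaces of W (`finrank_tangent`).

The map Ψ([x, y], z) = [x, τ(y, z)] is well defined: along a leaf curve (x(t), y(t)) the value Jt
y(t) is constant, so (y(t), z) stays in the fibre product of `Jt` and `σ`, and τ turns it into the
curve required in `Sρ` (`exists_comparison`). Lifting tangent vectors to W shows that Ψ is a
submersion whose vertical vectors are the X_{g∘J'} - X_{g∘σ}; so it is constant on leaves.
Conversely Ψ separates leaves: points with the same image under τ are joined by leaf curves in the
fibre product of `Jt` and `σ` (`exists_inverse`), and leaf curves in the fibre product of `J` and
`ρ` lift locally to W by existence and uniqueness of integral curves (`leaf_eq_of_comparison_eq`).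
Thus Ψ induces a continuous open bijection of the leaf spaces, and the smooth structure is
transported along it. The Poisson statements follow from the behaviour of Hamiltonian vectors under
reduction. -/

open scoped Manifold ContDiff
open Function

noncomputable section

open Set Filter Topology

set_option linter.unusedSectionVars false

/-! ### Inverse function theorem, immersions and submersions on manifolds -/

section LocalInverse

variable {E H M E' H' N : Type*}
  [NormedAddCommGroup E] [NormedSpace ℝ E] [FiniteDimensional ℝ E]
  [TopologicalSpace H] {I : ModelWithCorners ℝ E H} [I.Boundaryless]
  [TopologicalSpace M] [ChartedSpace H M] [IsManifold I ∞ M]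
  [NormedAddCommGroup E'] [NormedSpace ℝ E'] [FiniteDimensional ℝ E']
  [TopologicalSpace H'] {I' : ModelWithCorners ℝ E' H'} [I'.Boundaryless]
  [TopologicalSpace N] [ChartedSpace H' N] [IsManifold I' ∞ N]

theorem hasMFDerivAt_extChartAt_self (x : M) :
    HasMFDerivAt I 𝓘(ℝ, E) (extChartAt I x) x (ContinuousLinearMap.id ℝ E) := by
  have h : HasMFDerivAt I 𝓘(ℝ, E) (extChartAt I x) x (mfderiv I 𝓘(ℝ, E) (extChartAt I x) x) :=
    (mdifferentiableAt_extChartAt (mem_chart_source _ _)).hasMFDerivAt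
  rw [mfderiv_extChartAt_self] at h
  exact h

/-- The inverse function theorem, with a totally defined inverse whose properties hold near the
point. `ContDiffAt ℝ ∞` at one point provides no common neighbourhood for all orders, hence
smoothness is assumed, and obtained, at all nearby points. -/
theorem exists_local_inverse_of_contDiff {f : E → E'} {a : E}
    (hf : ∀ᶠ x in 𝓝 a, ContDiffAt ℝ ∞ f x) (hb : Bijective (fderiv ℝ f a)) :
    ∃ g : E' → E, g (f a) = a ∧ (∀ᶠ y in 𝓝 (f a), ContDiffAt ℝ ∞ g y ∧ f (g y) = y) ∧
      ∀ᶠ x in 𝓝 a, g (f x) = x := by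
  have hfa : ContDiffAt ℝ ∞ f a := hf.self_of_nhds
  let A : E ≃L[ℝ] E' := ContinuousLinearEquiv.ofBijective (fderiv ℝ f a)
    (LinearMap.ker_eq_bot.2 hb.1) (LinearMap.range_eq_top.2 hb.2)
  have hA : HasFDerivAt f (A : E →L[ℝ] E') a :=
    (hfa.differentiableAt (by simp)).hasFDerivAt
  let e := hfa.toOpenPartialHomeomorph f hA (by simp)
  have hae : a ∈ e.source := hfa.mem_toOpenPartialHomeomorph_source hA (by simp)
  have hle : e.symm (f a) = a := e.left_inv hae
  have hfe : f a ∈ e.target := e.map_source hae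
  have hcont : ContinuousAt e.symm (f a) := e.continuousAt_symm hfe
  -- Invertibility of the derivative is an open condition; it is needed at nearby points for the
  -- smoothness of the inverse there.
  have hopen : ∀ᶠ x in 𝓝 a, ∃ B : E ≃L[ℝ] E', (B : E →L[ℝ] E') = fderiv ℝ f x := by
    have h1 : ContinuousAt (fderiv ℝ f) a :=
      (hfa.fderiv_right (m := 0) (by simp)).continuousAt
    exact h1.eventually (ContinuousLinearEquiv.nhds A)
  refine ⟨e.symm, hle, ?_, e.eventually_left_inverse hae⟩
  have h2 : ∀ᶠ y in 𝓝 (f a), ContDiffAt ℝ ∞ f (e.symm y) ∧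
      ∃ B : E ≃L[ℝ] E', (B : E →L[ℝ] E') = fderiv ℝ f (e.symm y) := by
    refine hcont.eventually (p := fun x => ContDiffAt ℝ ∞ f x ∧
      ∃ B : E ≃L[ℝ] E', (B : E →L[ℝ] E') = fderiv ℝ f x) ?_
    rw [hle]
    exact hf.and hopen
  filter_upwards [h2, e.open_target.mem_nhds hfe] with y hy hyt
  obtain ⟨hy1, B, hB⟩ := hy
  refine ⟨e.contDiffAt_symm hyt (f₀' := B) ?_ hy1, e.right_inv hyt⟩
  rw [hB]
  exact (hy1.differentiableAt (by simp)).hasFDerivAt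

theorem exists_local_inverse {f : M → N} {q : M}
    (hf : ∀ᶠ x in 𝓝 q, ContMDiffAt I I' ∞ f x) (hb : Bijective (mfderiv I I' f q)) :
    ∃ g : N → M, g (f q) = q ∧ (∀ᶠ y in 𝓝 (f q), ContMDiffAt I' I ∞ g y ∧ f (g y) = y) ∧
      ∀ᶠ x in 𝓝 q, g (f x) = x := by
  have hfq := hf.self_of_nhds
  set φ := extChartAt I q with hφ
  set ψ := extChartAt I' (f q) with hψ
  let F : E → E' := ψ ∘ f ∘ φ.symm
  have hsymm : φ.symm (φ q) = q := extChartAt_to_inv q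
  have hφc : ContinuousAt φ.symm (φ q) := continuousAt_extChartAt_symm q
  have hφt : ∀ᶠ x in 𝓝 (φ q), x ∈ φ.target := extChartAt_target_mem_nhds q
  have hψs : ∀ᶠ y in 𝓝 (f q), y ∈ ψ.source := extChartAt_source_mem_nhds (f q)
  have hφs : ∀ᶠ y in 𝓝 q, y ∈ φ.source := extChartAt_source_mem_nhds q
  have hfφ : ∀ᶠ x in 𝓝 (φ q), ContMDiffAt I I' ∞ f (φ.symm x) ∧ f (φ.symm x) ∈ ψ.source := by
    refine hφc.eventually (p := fun x => ContMDiffAt I I' ∞ f x ∧ f x ∈ ψ.source) ?_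
    rw [hsymm]
    exact hf.and (hfq.continuousAt.eventually hψs)
  have hF : ∀ᶠ x in 𝓝 (φ q), ContDiffAt ℝ ∞ F x := by
    filter_upwards [hfφ, hφt] with x hx hxt
    rw [← contMDiffAt_iff_contDiffAt]
    have h1 : ContMDiffAt 𝓘(ℝ, E) I ∞ φ.symm x :=
      (contMDiffOn_extChartAt_symm q).contMDiffAt (extChartAt_target_mem_nhds' hxt)
    have h2 : ContMDiffAt I' 𝓘(ℝ, E') ∞ ψ (f (φ.symm x)) :=
      contMDiffAt_extChartAt' (by simpa [hψ] using hx.2)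
    exact h2.comp x (hx.1.comp x h1)
  have hmf : mfderiv I I' f q = fderiv ℝ F (φ q) := by
    rw [(hfq.mdifferentiableAt (by simp)).mfderiv, I.range_eq_univ, fderivWithin_univ]
    rfl
  have hFq : F (φ q) = ψ (f q) := by simp [F, hsymm]
  obtain ⟨g, hg1, hg2, hg3⟩ := exists_local_inverse_of_contDiff hF (by
    have := hb
    rw [hmf] at this
    exact this)
  rw [hFq] at hg1 hg2
  have hψc : ContinuousAt ψ (f q) := continuousAt_extChartAt (f q)
  have hgc : ContinuousAt g (ψ (f q)) := hg2.self_of_nhds.1.continuousAt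
  refine ⟨φ.symm ∘ g ∘ ψ, by simp [hg1, hsymm], ?_, ?_⟩
  · have h1 : ∀ᶠ y in 𝓝 (f q), ContDiffAt ℝ ∞ g (ψ y) ∧ F (g (ψ y)) = ψ y := hψc.eventually hg2
    have h2 : ∀ᶠ y in 𝓝 (f q), g (ψ y) ∈ φ.target ∧
        f (φ.symm (g (ψ y))) ∈ ψ.source := by
      have : ContinuousAt (g ∘ ψ) (f q) := hgc.comp hψc
      refine this.eventually (p := fun x => x ∈ φ.target ∧ f (φ.symm x) ∈ ψ.source) ?_
      simp only [comp_apply, hg1]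
      exact hφt.and (hfφ.mono fun x hx => hx.2)
    filter_upwards [h1, h2, hψs] with y hy1 hy2 hy3
    constructor
    · have k1 : ContMDiffAt 𝓘(ℝ, E) I ∞ φ.symm (g (ψ y)) :=
        (contMDiffOn_extChartAt_symm q).contMDiffAt (extChartAt_target_mem_nhds' hy2.1)
      have k2 : ContMDiffAt I' 𝓘(ℝ, E') ∞ ψ y :=
        contMDiffAt_extChartAt' (by simpa [hψ] using hy3)
      exact k1.comp y (hy1.1.contMDiffAt.comp y k2)
    · exact ψ.injOn hy2.2 hy3 hy1.2
  · have h1 : ∀ᶠ x in 𝓝 q, g (F (φ x)) = φ x := (continuousAt_extChartAt q).eventually hg3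
    filter_upwards [h1, hφs] with x hx hxs
    have : φ.symm (φ x) = x := φ.left_inv hxs
    simp only [F, comp_apply, this] at hx
    simp only [comp_apply, hx, this]

/-- With ℓ a left inverse of the differential and ψ a chart, ℓ∘ψ∘f has identity differential at `q`,
hence a local inverse g; then g∘ℓ∘ψ is the retraction. -/
theorem exists_immersion_retraction {f : M → N} {q : M}
    (hf : ∀ᶠ x in 𝓝 q, ContMDiffAt I I' ∞ f x) (hb : Injective (mfderiv I I' f q)) :
    ∃ R : N → M, (∀ᶠ y in 𝓝 (f q), ContMDiffAt I' I ∞ R y) ∧ ∀ᶠ x in 𝓝 q, R (f x) = x := by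
  have hfq := hf.self_of_nhds
  set ψ := extChartAt I' (f q) with hψ
  have hψs : ∀ᶠ y in 𝓝 (f q), y ∈ ψ.source := extChartAt_source_mem_nhds (f q)
  have hψm : ∀ᶠ y in 𝓝 (f q), ContMDiffAt I' 𝓘(ℝ, E') ∞ ψ y :=
    hψs.mono fun y hy => contMDiffAt_extChartAt' (by simpa [hψ] using hy)
  let D : E →L[ℝ] E' := mfderiv I I' f q
  obtain ⟨l, hl⟩ := D.toLinearMap.exists_leftInverse_of_injective (LinearMap.ker_eq_bot.2 hb)
  let ℓ : E' →L[ℝ] E := LinearMap.toContinuousLinearMap l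
  let h : M → E := ℓ ∘ ψ ∘ f
  have hh : ∀ᶠ x in 𝓝 q, ContMDiffAt I 𝓘(ℝ, E) ∞ h x := by
    filter_upwards [hf, hfq.continuousAt.eventually hψm] with x hx hx2
    exact ℓ.contDiff.contMDiff.contMDiffAt.comp x (hx2.comp x hx)
  have hd : mfderiv I 𝓘(ℝ, E) h q = ContinuousLinearMap.id ℝ E := by
    have h1 : HasMFDerivAt I I' f q D := (hfq.mdifferentiableAt (by simp)).hasMFDerivAt
    have h2 : HasMFDerivAt I' 𝓘(ℝ, E') ψ (f q) (ContinuousLinearMap.id ℝ E') :=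
      hasMFDerivAt_extChartAt_self _
    have h3 : HasMFDerivAt 𝓘(ℝ, E') 𝓘(ℝ, E) ℓ (ψ (f q)) ℓ := ℓ.hasFDerivAt.hasMFDerivAt
    refine (h3.comp q (h2.comp q h1)).mfderiv.trans ?_
    ext x
    exact LinearMap.congr_fun hl x
  obtain ⟨g, hg1, hg2, hg3⟩ := exists_local_inverse hh (by rw [hd]; exact bijective_id)
  refine ⟨fun y => g (ℓ (ψ y)), ?_, hg3⟩
  have hc : ContinuousAt (fun y => ℓ (ψ y)) (f q) :=
    ℓ.continuous.continuousAt.comp (continuousAt_extChartAt (f q))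
  filter_upwards [hc.eventually hg2, hψm] with y hy1 hy2
  exact hy1.1.comp y (ℓ.contDiff.contMDiff.contMDiffAt.comp y hy2)

/-- Completing f by a projection π onto the kernel of its differential gives a local diffeomorphism
(f, π∘φ). `L (y, d)` is the point over y with the same π-coordinate as d. The dependence on d gives
`L (f d, d) = d` for all nearby d, which a single local section would not provide. -/
theorem exists_submersion_lift {f : M → N} {q : M}
    (hf : ∀ᶠ x in 𝓝 q, ContMDiffAt I I' ∞ f x) (hb : Surjective (mfderiv I I' f q)) :
    ∃ L : N × M → M, (∀ᶠ z in 𝓝 (f q, q), ContMDiffAt (I'.prod I) I ∞ L z ∧ f (L z) = z.1) ∧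
      ∀ᶠ d in 𝓝 q, L (f d, d) = d := by
  have hfq := hf.self_of_nhds
  set φ := extChartAt I q with hφ
  have hφs : ∀ᶠ y in 𝓝 q, y ∈ φ.source := extChartAt_source_mem_nhds q
  have hφm : ∀ᶠ y in 𝓝 q, ContMDiffAt I 𝓘(ℝ, E) ∞ φ y :=
    hφs.mono fun y hy => contMDiffAt_extChartAt' (by simpa [hφ] using hy)
  let D : E →L[ℝ] E' := mfderiv I I' f q
  obtain ⟨C, hC⟩ := Submodule.exists_isCompl (LinearMap.ker D.toLinearMap)
  let K := LinearMap.ker D.toLinearMap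
  let π : E →L[ℝ] K := LinearMap.toContinuousLinearMap (Submodule.projectionOnto K C hC)
  let G : M → N × K := fun x => (f x, π (φ x))
  have hG : ∀ᶠ x in 𝓝 q, ContMDiffAt I (I'.prod 𝓘(ℝ, K)) ∞ G x := by
    filter_upwards [hf, hφm] with x hx hx2
    exact hx.prodMk (π.contDiff.contMDiff.contMDiffAt.comp x hx2)
  have hd : mfderiv I (I'.prod 𝓘(ℝ, K)) G q = D.prod π := by
    have h1 : HasMFDerivAt I I' f q D := (hfq.mdifferentiableAt (by simp)).hasMFDerivAt
    have h2 : HasMFDerivAt I 𝓘(ℝ, E) φ q (ContinuousLinearMap.id ℝ E) :=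
      hasMFDerivAt_extChartAt_self _
    have h3 : HasMFDerivAt 𝓘(ℝ, E) 𝓘(ℝ, K) π (φ q) π := π.hasFDerivAt.hasMFDerivAt
    refine (h1.prodMk (h3.comp q h2)).mfderiv.trans ?_
    rfl
  have hbij : Bijective (mfderiv I (I'.prod 𝓘(ℝ, K)) G q) := by
    rw [hd]
    have hDπ : ∀ k : K, D k = 0 := fun k => k.2
    have hπk : ∀ k : K, π k = k := fun k => Submodule.projectionOnto_apply_left hC k
    constructor
    · refine (injective_iff_map_eq_zero (D.prod π)).2 fun x hx => ?_
      have hx1 : D x = 0 := congrArg Prod.fst hx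
      have hx2 : π x = 0 := congrArg Prod.snd hx
      have := hπk ⟨x, hx1⟩
      rw [hx2] at this
      exact congrArg Subtype.val this.symm
    · rintro ⟨w, k⟩
      obtain ⟨(x : E), hx⟩ := hb w
      -- Adding a vector of the kernel changes the second component at will and leaves the first one
      -- alone.
      refine ⟨x + ((k - π x : K) : E), Prod.ext ?_ ?_⟩
      · change D _ = w
        rw [map_add, hDπ, add_zero]
        exact hx
      · change π _ = k
        rw [map_add, hπk]
        abel
  obtain ⟨g, hg1, hg2, hg3⟩ := exists_local_inverse hG hbij
  refine ⟨fun z => g (z.1, π (φ z.2)), ?_, hg3⟩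
  have hφc : ContinuousAt φ q := continuousAt_extChartAt q
  have hc : ContinuousAt (fun z : N × M => (z.1, π (φ z.2))) (f q, q) :=
    continuousAt_fst.prodMk (π.continuous.continuousAt.comp
      (ContinuousAt.comp (f := Prod.snd) (x := (f q, q)) hφc continuousAt_snd))
  have hs : ContinuousAt (Prod.snd : N × M → M) (f q, q) := continuousAt_snd
  filter_upwards [hc.eventually hg2, hs.eventually hφm] with z hz1 hz2
  refine ⟨?_, congrArg Prod.fst hz1.2⟩
  have h1 : ContMDiffAt (I'.prod I) (I'.prod 𝓘(ℝ, K)) ∞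
      (fun z : N × M => (z.1, π (φ z.2))) z :=
    contMDiffAt_fst.prodMk (π.contDiff.contMDiff.contMDiffAt.comp z
      (hz2.comp z contMDiffAt_snd))
  exact hz1.1.comp z h1

/-- A local section of a submersion through a given point. -/
theorem exists_local_section {f : M → N} {q : M}
    (hf : ∀ᶠ x in 𝓝 q, ContMDiffAt I I' ∞ f x) (hb : Surjective (mfderiv I I' f q)) :
    ∃ κ : N → M, κ (f q) = q ∧ ∀ᶠ y in 𝓝 (f q), ContMDiffAt I' I ∞ κ y ∧ f (κ y) = y := by
  obtain ⟨L, hL1, hL2⟩ := exists_submersion_lift hf hb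
  refine ⟨fun y => L (y, q), hL2.self_of_nhds, ?_⟩
  have hc : ContinuousAt (fun y : N => (y, q)) (f q) := by fun_prop
  filter_upwards [hc.eventually hL1] with y hy
  exact ⟨hy.1.comp y (contMDiffAt_id.prodMk contMDiffAt_const), hy.2⟩

end LocalInverse

/-! ### Smooth functions separate points and tangent vectors -/

section SmoothFunctions

variable {E H M E' H' N : Type*}
  [NormedAddCommGroup E] [NormedSpace ℝ E] [FiniteDimensional ℝ E]
  [TopologicalSpace H] {I : ModelWithCorners ℝ E H} [I.Boundaryless]
  [TopologicalSpace M] [ChartedSpace H M] [IsManifold I ∞ M] [T2Space M]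

theorem exists_smooth_separating {x y : M} (h : x ≠ y) :
    ∃ g : C^∞⟮I, M; 𝓘(ℝ, ℝ), ℝ⟯, g x ≠ g y := by
  have hs : ({y}ᶜ : Set M) ∈ 𝓝 x := isOpen_compl_singleton.mem_nhds h
  obtain ⟨f, hf, -⟩ := (SmoothBumpFunction.nhds_basis_support (I := I) hs).mem_iff.1 univ_mem
  refine ⟨⟨f, f.contMDiff⟩, ?_⟩
  have h0 : f y = 0 := by
    by_contra hy
    exact hf (subset_tsupport _ hy) rfl
  change f x ≠ f y
  rw [h0, f.eq_one]
  exact one_ne_zero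

theorem eq_of_forall_smooth_eq {x y : M} (h : ∀ g : C^∞⟮I, M; 𝓘(ℝ, ℝ), ℝ⟯, g x = g y) :
    x = y := by
  by_contra hxy
  obtain ⟨g, hg⟩ := exists_smooth_separating (I := I) hxy
  exact hg (h g)

/-- A linear functional in a chart, cut off by a bump function. Since every covector is thus the
differential of a global function, the Hamiltonian vectors X_{f∘J} with global f suffice in the
description of vertical vectors. -/
theorem exists_smooth_mfderiv_eq (x : M) (l : E →L[ℝ] ℝ) :
    ∃ g : C^∞⟮I, M; 𝓘(ℝ, ℝ), ℝ⟯, HasMFDerivAt I 𝓘(ℝ, ℝ) g x l := by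
  let f : SmoothBumpFunction I x := Classical.choice inferInstance
  have hs : ContMDiffOn I 𝓘(ℝ, ℝ) ∞ (fun y => l (extChartAt I x y)) (chartAt H x).source :=
    l.contDiff.contMDiff.comp_contMDiffOn contMDiffOn_extChartAt
  refine ⟨⟨fun y => f y • l (extChartAt I x y), f.contMDiff_smul hs⟩, ?_⟩
  have h1 : HasMFDerivAt I 𝓘(ℝ, ℝ) (fun y => l (extChartAt I x y)) x l := by
    have h2 : HasMFDerivAt 𝓘(ℝ, E) 𝓘(ℝ, ℝ) l (extChartAt I x x) l := l.hasFDerivAt.hasMFDerivAt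
    exact h2.comp x (hasMFDerivAt_extChartAt_self x)
  refine h1.congr_of_eventuallyEq ?_
  filter_upwards [f.eventuallyEq_one] with y hy
  change f y • l (extChartAt I x y) = _
  rw [hy]
  simp

theorem tangent_eq_of_forall_smooth {x : M} {v w : TangentSpace I x}
    (h : ∀ g : C^∞⟮I, M; 𝓘(ℝ, ℝ), ℝ⟯,
      mfderiv I 𝓘(ℝ, ℝ) g x v = mfderiv I 𝓘(ℝ, ℝ) g x w) : v = w := by
  let v' : E := v
  let w' : E := w
  have key : v' = w' := by
    refine (SeparatingDual.eq_iff_forall_dual_eq (R := ℝ)).2 fun l => ?_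
    obtain ⟨g, hg⟩ := exists_smooth_mfderiv_eq (I := I) x l
    have := h g
    rw [hg.mfderiv] at this
    exact this
  exact key

/-- Composition with global smooth functions reduces this to real functions on a convex set, where
the mean value inequality also covers one-sided derivatives at end points. Smooth functions separate
points. -/
theorem constant_of_hasMFDerivWithinAt_zero {c : ℝ → M} {s : Set ℝ} (hs : Convex ℝ s)
    (hc : ∀ t ∈ s, ∃ c' : TangentSpace 𝓘(ℝ, ℝ) t →L[ℝ] TangentSpace I (c t),
      HasMFDerivWithinAt 𝓘(ℝ, ℝ) I c s t c' ∧ c' (1 : ℝ) = 0) {a b : ℝ}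
    (ha : a ∈ s) (hb : b ∈ s) : c a = c b := by
  refine eq_of_forall_smooth_eq (I := I) fun g => ?_
  have h1 : ∀ t ∈ s, HasFDerivWithinAt (g ∘ c) (0 : ℝ →L[ℝ] ℝ) s t := by
    intro t ht
    obtain ⟨c', hc', h0⟩ := hc t ht
    have h2 : HasMFDerivAt I 𝓘(ℝ, ℝ) g (c t) (mfderiv I 𝓘(ℝ, ℝ) g (c t)) :=
      (g.contMDiff.mdifferentiable (by simp) (c t)).hasMFDerivAt
    have h3 := hasMFDerivWithinAt_iff_hasFDerivWithinAt.1 (h2.comp_hasMFDerivWithinAt t hc')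
    let l : ℝ →L[ℝ] ℝ := (mfderiv I 𝓘(ℝ, ℝ) g (c t)).comp c'
    have h4 : l = 0 := by
      ext
      exact (congrArg (mfderiv I 𝓘(ℝ, ℝ) g (c t)) h0).trans (map_zero _)
    have h5 : HasFDerivWithinAt (g ∘ c) l s t := h3
    rwa [h4] at h5
  have h5 := hs.norm_image_sub_le_of_norm_hasFDerivWithin_le (C := 0) h1 (by simp) hb ha
  rw [zero_mul] at h5
  exact sub_eq_zero.1 (norm_le_zero_iff.1 h5)

end SmoothFunctions

/-! ### Smooth maps into submanifolds and out of quotients -/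

section Embedding

variable {E H M E' H' N : Type*}
  [NormedAddCommGroup E] [NormedSpace ℝ E] [FiniteDimensional ℝ E]
  [TopologicalSpace H] {I : ModelWithCorners ℝ E H} [I.Boundaryless]
  [TopologicalSpace M] [ChartedSpace H M] [IsManifold I ∞ M]
  [NormedAddCommGroup E'] [NormedSpace ℝ E'] [FiniteDimensional ℝ E']
  [TopologicalSpace H'] {I' : ModelWithCorners ℝ E' H'} [I'.Boundaryless]
  [TopologicalSpace N] [ChartedSpace H' N] [IsManifold I' ∞ N]
  {E'' H'' X : Type*}
  [NormedAddCommGroup E''] [NormedSpace ℝ E'']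
  [TopologicalSpace H''] {I'' : ModelWithCorners ℝ E'' H''}
  [TopologicalSpace X] [ChartedSpace H'' X]

/-- Smoothness of a map into an embedded submanifold can be tested in the ambient manifold. -/
theorem contMDiffWithinAt_of_comp_immersion {f : M → N} (hf : ContMDiff I I' ∞ f)
    (hi : ∀ q, Injective (mfderiv I I' f q)) (hind : IsInducing f) {g : X → M} {s : Set X} {x : X}
    (hg : ContMDiffWithinAt I'' I' ∞ (f ∘ g) s x) : ContMDiffWithinAt I'' I ∞ g s x := by
  -- Locally g = R∘(f∘g). The induced topology is what makes g continuous, so that it stays where R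
  -- is a left inverse of f.
  obtain ⟨R, hR1, hR2⟩ := exists_immersion_retraction (q := g x)
    (Eventually.of_forall fun x => hf x) (hi _)
  have hc : ContinuousWithinAt g s x := hind.continuousWithinAt_iff.2 hg.continuousWithinAt
  refine ((hR1.self_of_nhds).comp_contMDiffWithinAt x hg).congr_of_eventuallyEq ?_ ?_
  · filter_upwards [hc.eventually hR2] with y hy using hy.symm
  · exact hR2.self_of_nhds.symm

theorem contMDiffAt_of_comp_immersion {f : M → N} (hf : ContMDiff I I' ∞ f)
    (hi : ∀ q, Injective (mfderiv I I' f q)) (hind : IsInducing f) {g : X → M} {x : X}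
    (hg : ContMDiffAt I'' I' ∞ (f ∘ g) x) : ContMDiffAt I'' I ∞ g x :=
  contMDiffWithinAt_of_comp_immersion hf hi hind hg

theorem mdifferentiableWithinAt_of_comp_immersion {f : M → N} (hf : ContMDiff I I' ∞ f)
    (hi : ∀ q, Injective (mfderiv I I' f q)) (hind : IsInducing f) {g : X → M} {s : Set X} {x : X}
    (hg : MDifferentiableWithinAt I'' I' (f ∘ g) s x) :
    MDifferentiableWithinAt I'' I g s x := by
  obtain ⟨R, hR1, hR2⟩ := exists_immersion_retraction (q := g x)
    (Eventually.of_forall fun x => hf x) (hi _)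
  have hc : ContinuousWithinAt g s x := hind.continuousWithinAt_iff.2 hg.continuousWithinAt
  have h1 : MDifferentiableAt I' I R (f (g x)) := hR1.self_of_nhds.mdifferentiableAt (by simp)
  refine (h1.comp_mdifferentiableWithinAt x hg).congr_of_eventuallyEq ?_ ?_
  · filter_upwards [hc.eventually hR2] with y hy using hy.symm
  · exact hR2.self_of_nhds.symm

/-- A map is smooth if its composition with a surjective submersion is. -/
theorem contMDiff_of_comp_submersion {f : M → N} (hf : ContMDiff I I' ∞ f)
    (hs : ∀ q, Surjective (mfderiv I I' f q)) (hsurj : Surjective f) {g : N → X}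
    (hg : ContMDiff I I'' ∞ (g ∘ f)) : ContMDiff I' I'' ∞ g := by
  intro y
  obtain ⟨q, rfl⟩ := hsurj y
  obtain ⟨κ, hκ1, hκ2⟩ := exists_local_section (Eventually.of_forall fun x => hf x) (hs q)
  refine ((hg (κ (f q))).comp (f q) hκ2.self_of_nhds.1).congr_of_eventuallyEq ?_
  filter_upwards [hκ2] with z hz
  simp [hz.2]

end Embedding

/-! ### Local smooth retracts are submanifolds -/

section Retract

variable {E H M : Type*}
  [NormedAddCommGroup E] [NormedSpace ℝ E] [FiniteDimensional ℝ E]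
  [TopologicalSpace H] {I : ModelWithCorners ℝ E H} [I.Boundaryless]
  [TopologicalSpace M] [ChartedSpace H M] [IsManifold I ∞ M]

/-- A local smooth retraction of a neighbourhood of `q` onto the set of points satisfying `D`. -/
structure IsLocalRetraction (I : ModelWithCorners ℝ E H) (D : M → Prop) (r : M → M) (q : M) :
    Prop where
  smooth : ∀ᶠ x in 𝓝 q, ContMDiffAt I I ∞ r x
  mem : ∀ᶠ x in 𝓝 q, D (r x)
  fixed : ∀ᶠ x in 𝓝 q, D x → r x = x

/-- A chart of the image of a local retraction, which has a smooth extension to the ambient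
manifold and a smooth inverse. -/
structure SmoothSubtypeChart (I : ModelWithCorners ℝ E H) (D : M → Prop) (d : ℕ) where
  chart : OpenPartialHomeomorph {x // D x} (EuclideanSpace ℝ (Fin d))
  ext : M → EuclideanSpace ℝ (Fin d)
  param : EuclideanSpace ℝ (Fin d) → M
  ext_smooth : ∀ x ∈ chart.source, ContMDiffAt I (𝓡 d) ∞ ext x.1
  ext_eq : ∀ x ∈ chart.source, chart x = ext x.1
  param_smooth : ∀ w ∈ chart.target, ContMDiffAt (𝓡 d) I ∞ param w
  param_eq : ∀ w ∈ chart.target, (chart.symm w).1 = param w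

/-- The differential A of r at q is idempotent, and r can be linearised: there are coordinates G
near q with G∘r = A∘G. In them the retract becomes the range of A, whose dimension is the rank d. -/
theorem IsLocalRetraction.exists_chart {D : M → Prop} {r : M → M} {q : M} {d : ℕ}
    (hr : IsLocalRetraction I D r q) (hq : D q)
    (hd : Module.finrank ℝ (LinearMap.range (mfderiv I I r q).toLinearMap) = d) :
    ∃ c : SmoothSubtypeChart I D d, ⟨q, hq⟩ ∈ c.chart.source := by
  classical
  have hrq : r q = q := hr.fixed.self_of_nhds hq
  have hrs := hr.smooth.self_of_nhds
  set φ := extChartAt I q with hφ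
  have hφm : ∀ᶠ y in 𝓝 q, ContMDiffAt I 𝓘(ℝ, E) ∞ φ y := by
    filter_upwards [extChartAt_source_mem_nhds (I := I) q] with y hy
    exact contMDiffAt_extChartAt' (by simpa using hy)
  have hrc : Tendsto r (𝓝 q) (𝓝 q) := by
    have := hrs.continuousAt
    rwa [ContinuousAt, hrq] at this
  let A : E →L[ℝ] E := mfderiv I I r q
  have hrd : HasMFDerivAt I I r q A := (hrs.mdifferentiableAt (by simp)).hasMFDerivAt
  have hrr : ∀ᶠ x in 𝓝 q, r (r x) = r x := by
    filter_upwards [hr.mem, hrc.eventually hr.fixed] with x hx1 hx2 using hx2 hx1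
  have hrd' : HasMFDerivAt I I r (r q) A := by rwa [hrq]
  have hAA : ∀ v, A (A v) = A v := by
    have h2 : HasMFDerivAt I I r q (A.comp A) :=
      (hrd'.comp q hrd).congr_of_eventuallyEq (hrr.mono fun x hx => hx.symm)
    exact fun v => congrArg (fun B : E →L[ℝ] E => B v) (hasMFDerivAt_unique h2 hrd)
  -- A on the part φ(r x) and 1 - A on the remainder φ x - φ(r x): the differential at q is A² + (1
  -- - A)² = 1, and the remainder vanishes at fixed points of r.
  let G : M → E := fun x => A (φ (r x)) + ((φ x - φ (r x)) - A (φ x - φ (r x)))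
  have hGs : ∀ᶠ x in 𝓝 q, ContMDiffAt I 𝓘(ℝ, E) ∞ G x := by
    filter_upwards [hφm, hrc.eventually hφm, hr.smooth] with x h1 h2 h3
    have h4 := h2.comp x h3
    have h5 : ContMDiffAt I 𝓘(ℝ, E) ∞ (fun x => φ x - φ (r x)) x := h1.sub h4
    exact (A.contDiff.contMDiff.contMDiffAt.comp x h4).add
      (h5.sub (A.contDiff.contMDiff.contMDiffAt.comp x h5))
  have hGd : mfderiv I 𝓘(ℝ, E) G q = ContinuousLinearMap.id ℝ E := by
    have h1 : HasMFDerivAt I 𝓘(ℝ, E) φ q (ContinuousLinearMap.id ℝ E) :=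
      hasMFDerivAt_extChartAt_self q
    have h1' : HasMFDerivAt I 𝓘(ℝ, E) φ (r q) (ContinuousLinearMap.id ℝ E) := by rwa [hrq]
    have h2 : HasMFDerivAt I 𝓘(ℝ, E) (fun x => φ (r x)) q A := h1'.comp q hrd
    have h3 : HasMFDerivAt I 𝓘(ℝ, E) (fun x => φ x - φ (r x)) q (ContinuousLinearMap.id ℝ E - A) :=
      h1.sub h2
    have hA : ∀ y, HasMFDerivAt 𝓘(ℝ, E) 𝓘(ℝ, E) A y A := fun y => A.hasFDerivAt.hasMFDerivAt
    have h4 : HasMFDerivAt I 𝓘(ℝ, E) G q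
        (A.comp A + ((ContinuousLinearMap.id ℝ E - A) - A.comp (ContinuousLinearMap.id ℝ E - A))) :=
      ((hA _).comp q h2).add (h3.sub ((hA _).comp q h3))
    refine h4.mfderiv.trans ?_
    ext v
    simp [hAA]
  obtain ⟨g, hg1, hg2, hg3⟩ := exists_local_inverse hGs (by rw [hGd]; exact bijective_id)
  have hGr : ∀ x, r (r x) = r x → G (r x) = A (G x) := by
    intro x hx
    simp only [G, hx, sub_self, map_add, map_sub, hAA, add_zero]
  obtain ⟨U, hU, hUo, hqU⟩ := eventually_nhds_iff.1
    (hGs.and (hr.smooth.and (hr.mem.and (hr.fixed.and (hg3.and hrr)))))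
  obtain ⟨W, hW, hWo, hqW⟩ := eventually_nhds_iff.1 hg2
  have hGU : ContinuousOn G U := fun x hx => (hU x hx).1.continuousAt.continuousWithinAt
  have hrU : ContinuousOn r U := fun x hx => (hU x hx).2.1.continuousAt.continuousWithinAt
  have hgW : ContinuousOn g W := fun x hx => (hW x hx).1.continuousAt.continuousWithinAt
  let K := LinearMap.range A.toLinearMap
  have hK : Module.finrank ℝ (EuclideanSpace ℝ (Fin d)) = Module.finrank ℝ K := by
    rw [finrank_euclideanSpace_fin]
    exact hd.symm
  let ι : EuclideanSpace ℝ (Fin d) ≃L[ℝ] K := ContinuousLinearEquiv.ofFinrankEq hK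
  let A' : E →L[ℝ] K := A.codRestrict K fun v => ⟨v, rfl⟩
  have hAK : ∀ y : K, A y = y := by
    rintro ⟨_, y, rfl⟩
    exact hAA y
  have hA'K : ∀ y : K, A' y = y := fun y => Subtype.ext (hAK y)
  let ψ : M → EuclideanSpace ℝ (Fin d) := fun x => ι.symm (A' (G x))
  let γ : EuclideanSpace ℝ (Fin d) → M := fun w => g (ι w : K)
  let s : Set {x // D x} := {x | x.1 ∈ U ∩ G ⁻¹' W}
  -- The condition that r (γ w) also lies in U allows the local inverse to be applied to G (r (γ
  -- w)).
  let t : Set (EuclideanSpace ℝ (Fin d)) := {w | ((ι w : K) : E) ∈ W ∩ g ⁻¹' (U ∩ r ⁻¹' U)}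
  have hso : IsOpen s := (hGU.isOpen_inter_preimage hUo hWo).preimage continuous_subtype_val
  have hιc : Continuous fun w => ((ι w : K) : E) := continuous_subtype_val.comp ι.continuous
  have hto : IsOpen t :=
    (hgW.isOpen_inter_preimage hWo (hrU.isOpen_inter_preimage hUo hUo)).preimage hιc
  have hιψ : ∀ x ∈ s, ((ι (ψ x.1) : K) : E) = G x.1 := by
    intro x hx
    have h1 := hGr x.1 (hU _ hx.1).2.2.2.2.2
    rw [(hU _ hx.1).2.2.2.1 x.2] at h1
    simp only [ψ, ContinuousLinearEquiv.apply_symm_apply]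
    exact h1.symm
  have hψγ : ∀ w ∈ t, ψ (γ w) = w := by
    intro w hw
    have h1 : G (γ w) = (ι w : K) := (hW _ hw.1).2
    simp only [ψ, h1, hA'K, ContinuousLinearEquiv.symm_apply_apply]
  -- As G (γ w) lies in the range of A, G (r (γ w)) = A (G (γ w)) = G (γ w). Injectivity of G on U
  -- gives r (γ w) = γ w, and values of r satisfy D.
  have hDγ : ∀ w ∈ t, D (γ w) := by
    intro w hw
    have h1 : G (γ w) = (ι w : K) := (hW _ hw.1).2
    have h2 := hGr (γ w) (hU _ hw.2.1).2.2.2.2.2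
    rw [h1, hAK, ← h1] at h2
    have h3 := congrArg g h2
    rw [(hU _ hw.2.1).2.2.2.2.1, (hU _ hw.2.2).2.2.2.2.1] at h3
    have h4 : r (γ w) = γ w := h3
    rw [← h4]
    exact (hU _ hw.2.1).2.2.1
  have hγψ : ∀ x ∈ s, γ (ψ x.1) = x.1 := by
    intro x hx
    simp only [γ, hιψ x hx]
    exact (hU _ hx.1).2.2.2.2.1
  have hψs : ∀ x ∈ U, ContMDiffAt I (𝓡 d) ∞ ψ x := fun x hx =>
    ι.symm.contDiff.contMDiff.contMDiffAt.comp x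
      (A'.contDiff.contMDiff.contMDiffAt.comp x (hU x hx).1)
  have hγs : ∀ w ∈ t, ContMDiffAt (𝓡 d) I ∞ γ w := by
    intro w hw
    have h1 : ContMDiffAt (𝓡 d) 𝓘(ℝ, E) ∞ (fun w => ((ι w : K) : E)) w :=
      (K.subtypeL.contDiff.comp ι.contDiff).contMDiff.contMDiffAt
    exact (hW _ hw.1).1.comp w h1
  let e : OpenPartialHomeomorph {x // D x} (EuclideanSpace ℝ (Fin d)) :=
    { toFun := fun x => ψ x.1
      -- The value q off the target is a dummy.
      invFun := fun w => if h : D (γ w) then ⟨γ w, h⟩ else ⟨q, hq⟩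
      source := s
      target := t
      map_source' := by
        intro x hx
        refine ⟨?_, ?_⟩
        · rw [hιψ x hx]
          exact hx.2
        · have h1 : g (ι (ψ x.1) : K) = x.1 := hγψ x hx
          rw [mem_preimage, h1]
          refine ⟨hx.1, ?_⟩
          rw [mem_preimage, (hU _ hx.1).2.2.2.1 x.2]
          exact hx.1
      map_target' := by
        intro w hw
        rw [dif_pos (hDγ w hw)]
        refine ⟨hw.2.1, ?_⟩
        rw [mem_preimage]
        have h1 : G (γ w) = (ι w : K) := (hW _ hw.1).2
        rw [h1]
        exact hw.1
      left_inv' := by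
        intro x hx
        have h1 : D (γ (ψ x.1)) := by
          rw [hγψ x hx]
          exact x.2
        rw [dif_pos h1]
        exact Subtype.ext (hγψ x hx)
      right_inv' := by
        intro w hw
        rw [dif_pos (hDγ w hw)]
        exact hψγ w hw
      open_source := hso
      open_target := hto
      continuousOn_toFun := fun x hx =>
        ((hψs x.1 hx.1).continuousAt.comp continuous_subtype_val.continuousAt).continuousWithinAt
      continuousOn_invFun := by
        rw [(IsInducing.mk rfl : IsInducing (Subtype.val : {x // D x} → M)).continuousOn_iff]
        refine ContinuousOn.congr (f := γ)
          (fun w hw => (hγs w hw).continuousAt.continuousWithinAt) ?_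
        intro w hw
        simp only [comp_apply, dif_pos (hDγ w hw)] }
  refine ⟨⟨e, ψ, γ, fun x hx => hψs _ hx.1, fun _ _ => rfl, hγs, fun w hw => ?_⟩, ?_⟩
  · change ((if h : D (γ w) then (⟨γ w, h⟩ : {x // D x}) else ⟨q, hq⟩).1) = γ w
    rw [dif_pos (hDγ w hw)]
  · exact ⟨hqU, hqW⟩

/-- A subset which is locally a smooth retract of constant rank is an embedded submanifold. -/
theorem exists_manifold_of_localRetraction {D : M → Prop} {d : ℕ}
    (hD : ∀ q, D q → ∃ r, IsLocalRetraction I D r q ∧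
      Module.finrank ℝ (LinearMap.range (mfderiv I I r q).toLinearMap) = d) :
    ∃ _ : ChartedSpace (EuclideanSpace ℝ (Fin d)) {x // D x},
      IsManifold (𝓡 d) ∞ {x // D x} ∧
      ContMDiff (𝓡 d) I ∞ (Subtype.val : {x // D x} → M) ∧
      (∀ q, Injective (mfderiv (𝓡 d) I (Subtype.val : {x // D x} → M) q)) := by
  have h1 : ∀ q : {x // D x}, ∃ c : SmoothSubtypeChart I D d, q ∈ c.chart.source := by
    intro q
    obtain ⟨r, hr, hrd⟩ := hD q.1 q.2
    exact hr.exists_chart q.2 hrd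
  choose c hc using h1
  let cs : ChartedSpace (EuclideanSpace ℝ (Fin d)) {x // D x} :=
    { atlas := range fun q => (c q).chart
      chartAt := fun q => (c q).chart
      mem_chart_source := hc
      chart_mem_atlas := fun q => ⟨q, rfl⟩ }
  have hm : IsManifold (𝓡 d) ∞ {x // D x} := by
    -- Transition maps factor as `ext ∘ param` through the ambient manifold, where both maps are
    -- smooth.
    refine isManifold_of_contDiffOn (𝓡 d) ∞ _ ?_
    rintro _ _ ⟨a, rfl⟩ ⟨b, rfl⟩ w hw
    obtain ⟨⟨hw1, hw2⟩, -⟩ := hw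
    refine ContDiffWithinAt.congr_of_mem (f := (c b).ext ∘ (c a).param) ?_ ?_ ⟨⟨hw1, hw2⟩, mem_range_self _⟩
    · refine (contMDiffAt_iff_contDiffAt.1 ?_).contDiffWithinAt
      refine ContMDiffAt.comp w ?_ ((c a).param_smooth w hw1)
      rw [← (c a).param_eq w hw1]
      exact (c b).ext_smooth _ hw2
    · rintro y ⟨⟨hy1, hy2⟩, -⟩
      simp only [comp_apply, ← (c a).param_eq y hy1]
      exact (c b).ext_eq _ hy2
  have hch : ∀ q : {x // D x}, ContMDiffAt (𝓡 d) (𝓡 d) ∞ (c q).chart q := fun q =>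
    contMDiffAt_of_mem_maximalAtlas (IsManifold.subset_maximalAtlas ⟨q, rfl⟩) (hc q)
  have hsm : ContMDiff (𝓡 d) I ∞ (Subtype.val : {x // D x} → M) := by
    intro q
    have h2 : ContMDiffAt (𝓡 d) I ∞ ((c q).param ∘ (c q).chart) q :=
      ((c q).param_smooth _ ((c q).chart.map_source (hc q))).comp q (hch q)
    refine h2.congr_of_eventuallyEq ?_
    filter_upwards [(c q).chart.open_source.mem_nhds (hc q)] with x hx
    rw [comp_apply, ← (c q).param_eq _ ((c q).chart.map_source hx), (c q).chart.left_inv hx]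
  refine ⟨cs, hm, hsm, fun q => ?_⟩
  -- The chart is the inclusion followed by `ext`, and its differential is injective; so is that of
  -- the inclusion.
  have h3 : HasMFDerivAt (𝓡 d) (𝓡 d) ((c q).ext ∘ Subtype.val) q
      ((mfderiv I (𝓡 d) (c q).ext q.1).comp (mfderiv (𝓡 d) I Subtype.val q)) :=
    (((c q).ext_smooth q (hc q)).mdifferentiableAt (by simp)).hasMFDerivAt.comp q
      ((hsm q).mdifferentiableAt (by simp)).hasMFDerivAt
  have h4 : HasMFDerivAt (𝓡 d) (𝓡 d) (c q).chart q
      ((mfderiv I (𝓡 d) (c q).ext q.1).comp (mfderiv (𝓡 d) I Subtype.val q)) := by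
    refine h3.congr_of_eventuallyEq ?_
    filter_upwards [(c q).chart.open_source.mem_nhds (hc q)] with x hx using (c q).ext_eq x hx
  have h5 : Injective (mfderiv (𝓡 d) (𝓡 d) (c q).chart q) :=
    (mdifferentiable_of_mem_atlas (I := 𝓡 d) (M := {x // D x})
      (show (c q).chart ∈ atlas _ _ from ⟨q, rfl⟩)).mfderiv_injective (hc q)
  rw [h4.mfderiv] at h5
  exact fun a b hab => h5 (congrArg (mfderiv I (𝓡 d) (c q).ext q.1) hab)

end Retract

/-! ### Alternating forms of degree two -/

section AlternatingForms

variable {E F : Type*} [NormedAddCommGroup E] [NormedSpace ℝ E]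
  [NormedAddCommGroup F] [NormedSpace ℝ F]

/-- The bilinear form of an alternating form of degree two. -/
def altToBilin (E : Type*) [NormedAddCommGroup E] [NormedSpace ℝ E] :
    (E [⋀^Fin 2]→L[ℝ] ℝ) →L[ℝ] E →L[ℝ] E →L[ℝ] ℝ :=
  ((ContinuousLinearMap.compL ℝ E (E [⋀^Fin 1]→L[ℝ] ℝ) (E →L[ℝ] ℝ))
    ((ContinuousLinearMap.compL ℝ E (E [⋀^Fin 0]→L[ℝ] ℝ) ℝ
      (ContinuousAlternatingMap.apply ℝ E ℝ ![])).comp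
      ContinuousAlternatingMap.curryLeftLI.toContinuousLinearMap)).comp
    ContinuousAlternatingMap.curryLeftLI.toContinuousLinearMap

@[simp]
theorem altToBilin_apply (α : E [⋀^Fin 2]→L[ℝ] ℝ) (u v : E) : altToBilin E α u v = α ![u, v] :=
  rfl

theorem contDiff_altToBilin {k : WithTop ℕ∞} : ContDiff ℝ k (altToBilin E) := by
  fun_prop

theorem alt_swap (α : E [⋀^Fin 2]→L[ℝ] ℝ) (u v : E) : α ![u, v] = -α ![v, u] := by
  have h2 : α (![v, u] ∘ Equiv.swap 0 1) = -α ![v, u] :=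
    α.toAlternatingMap.map_swap ![v, u] (i := 0) (j := 1) (by decide)
  have h3 : ![v, u] ∘ Equiv.swap (0 : Fin 2) 1 = ![u, v] := by
    ext i; fin_cases i <;> rfl
  rwa [h3] at h2

theorem alt_comp_apply (α : F [⋀^Fin 2]→L[ℝ] ℝ) (l : E →L[ℝ] F) (u v : E) :
    α.compContinuousLinearMap l ![u, v] = α ![l u, l v] := by
  rw [ContinuousAlternatingMap.compContinuousLinearMap_apply]
  congr 1
  ext i; fin_cases i <;> rfl

theorem alt_ext {α β : E [⋀^Fin 2]→L[ℝ] ℝ} (h : ∀ u v, α ![u, v] = β ![u, v]) : α = β := by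
  ext w
  have : w = ![w 0, w 1] := by ext i; fin_cases i <;> rfl
  rw [this]
  exact h _ _

variable {X : Type*} [NormedAddCommGroup X] [NormedSpace ℝ X]

/-- A form depends linearly on its finitely many values on pairs of basis vectors, so smoothness of
these values is enough. -/
theorem contDiffAt_alt_of_apply [FiniteDimensional ℝ E] {f : X → E [⋀^Fin 2]→L[ℝ] ℝ} {a : X}
    {k : WithTop ℕ∞} (h : ∀ u v, ContDiffAt ℝ k (fun x => f x ![u, v]) a) : ContDiffAt ℝ k f a := by
  let b := Module.finBasis ℝ E
  let W := Fin (Module.finrank ℝ E) → Fin (Module.finrank ℝ E) → ℝ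
  let j : (E [⋀^Fin 2]→L[ℝ] ℝ) →ₗ[ℝ] W :=
    { toFun := fun α i k => α ![b i, b k]
      map_add' := fun _ _ => rfl
      map_smul' := fun _ _ => rfl }
  have hj : LinearMap.ker j = ⊥ := by
    refine LinearMap.ker_eq_bot'.2 fun α hα => ?_
    refine ContinuousAlternatingMap.toAlternatingMap_injective
      (Module.Basis.ext_alternating b fun v _ => ?_)
    have h1 : (fun i => b (v i)) = ![b (v 0), b (v 1)] := by ext i; fin_cases i <;> rfl
    rw [h1]
    exact congrFun (congrFun hα (v 0)) (v 1)
  obtain ⟨l, hl⟩ := j.exists_leftInverse_of_injective hj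
  have h1 : ContDiffAt ℝ k (fun x => j (f x)) a :=
    contDiffAt_pi.2 fun i => contDiffAt_pi.2 fun k => h _ _
  have h2 := (LinearMap.toContinuousLinearMap l).contDiff.contDiffAt.comp a h1
  exact h2.congr_of_eventuallyEq (Eventually.of_forall fun x => (LinearMap.congr_fun hl (f x)).symm)

theorem ContDiffAt.alt_apply {f : X → E [⋀^Fin 2]→L[ℝ] ℝ} {u v : X → E} {a : X}
    {k : WithTop ℕ∞} (hf : ContDiffAt ℝ k f a) (hu : ContDiffAt ℝ k u a)
    (hv : ContDiffAt ℝ k v a) : ContDiffAt ℝ k (fun x => f x ![u x, v x]) a :=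
  ((contDiff_altToBilin.contDiffAt.comp a hf).clm_apply hu).clm_apply hv

/-- A closed two-form is constant along directions which it annihilates near a point. -/
theorem closed_form_fderiv_eq_zero {β : X → X [⋀^Fin 2]→L[ℝ] ℝ} {a : X}
    (hβ : DifferentiableAt ℝ β a) (hc : extDeriv β a = 0) {w : X}
    (hw : ∀ᶠ x in 𝓝 a, ∀ v, β x ![w, v] = 0) (u v : X) :
    fderiv ℝ (fun x => β x ![u, v]) a w = 0 := by
  -- For constant vectors dβ(w, u, v) consists of three derivatives. The two which differentiate a
  -- value β(w, ·) vanish, so dβ = 0 leaves the derivative of β(u, v) along w.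
  have h1 := extDeriv_apply hβ ![w, u, v]
  rw [hc, Fin.sum_univ_three] at h1
  have r0 : (0 : Fin 3).removeNth ![w, u, v] = ![u, v] := by ext i; fin_cases i <;> rfl
  have r1 : (1 : Fin 3).removeNth ![w, u, v] = ![w, v] := by ext i; fin_cases i <;> rfl
  have r2 : (2 : Fin 3).removeNth ![w, u, v] = ![w, u] := by ext i; fin_cases i <;> rfl
  have z : ∀ v', fderiv ℝ (fun x => β x ![w, v']) a = 0 := by
    intro v'
    have : (fun x => β x ![w, v']) =ᶠ[𝓝 a] fun _ => 0 := hw.mono fun x hx => hx v'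
    rw [this.fderiv_eq, fderiv_fun_const]
    rfl
  have hr : ∀ i : Fin 3, ∀ y : Fin 2 → X, i.removeNth ![w, u, v] = y →
      fderiv ℝ (fun x => β x (i.removeNth ![w, u, v])) a = fderiv ℝ (fun x => β x y) a := by
    rintro i _ rfl
    rfl
  rw [hr 0 _ r0, hr 1 _ r1, hr 2 _ r2, z, z] at h1
  simpa using h1.symm

end AlternatingForms

/-! ### Pull-backs of two-forms along maps from a vector space -/

section Pullback

variable {n : ℕ} {S : Type*} [TopologicalSpace S] [ChartedSpace (EuclideanSpace ℝ (Fin n)) S]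
  {E : Type*} [NormedAddCommGroup E] [NormedSpace ℝ E]

/-- The pull-back of a two-form along a map from a vector space. -/
def TwoForm.pullback (Ω : TwoForm n S) (F : E → S) : E → E [⋀^Fin 2]→L[ℝ] ℝ :=
  fun y => (Ω (F y)).compContinuousLinearMap (mfderiv 𝓘(ℝ, E) (𝓡 n) F y)

theorem TwoForm.pullback_apply (Ω : TwoForm n S) (F : E → S) (y u v : E) :
    Ω.pullback F y ![u, v] =
      Ω (F y) ![mfderiv 𝓘(ℝ, E) (𝓡 n) F y u, mfderiv 𝓘(ℝ, E) (𝓡 n) F y v] :=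
  alt_comp_apply (E := E) (F := EuclideanSpace ℝ (Fin n)) (Ω (F y))
    (mfderiv 𝓘(ℝ, E) (𝓡 n) F y) u v

theorem TwoForm.inChart_apply (Ω : TwoForm n S)
    (e : OpenPartialHomeomorph S (EuclideanSpace ℝ (Fin n))) (y u v : EuclideanSpace ℝ (Fin n)) :
    Ω.inChart e y ![u, v] =
      Ω (e.symm y) ![mfderiv (𝓡 n) (𝓡 n) e.symm y u, mfderiv (𝓡 n) (𝓡 n) e.symm y v] :=
  TwoForm.pullback_apply Ω e.symm y u v

variable [IsManifold (𝓡 n) ∞ S]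

/-- Rewrites the pull-back as one between vector spaces, in a single chart fixed near the point, so
that the commutation of exterior derivative and pull-back on vector spaces applies. -/
theorem TwoForm.pullback_eventuallyEq (Ω : TwoForm n S) {F : E → S} {y : E}
    (hF : ∀ᶠ x in 𝓝 y, ContMDiffAt 𝓘(ℝ, E) (𝓡 n) ∞ F x) :
    let e := chartAt (EuclideanSpace ℝ (Fin n)) (F y)
    Ω.pullback F =ᶠ[𝓝 y]
      fun x => (Ω.inChart e (e (F x))).compContinuousLinearMap (fderiv ℝ (e ∘ F) x) := by
  intro e
  have hs : ∀ᶠ x in 𝓝 y, F x ∈ e.source :=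
    hF.self_of_nhds.continuousAt.eventually (e.open_source.mem_nhds (mem_chart_source _ _))
  filter_upwards [hF, hs.eventually_nhds] with x hx hxs
  have hxs' := hxs.self_of_nhds
  refine alt_ext fun u v => ?_
  rw [TwoForm.pullback_apply]
  refine Eq.trans ?_ (alt_comp_apply _ _ u v).symm
  rw [TwoForm.inChart_apply]
  have h1 : MDifferentiableAt (𝓡 n) (𝓡 n) e (F x) :=
    mdifferentiableAt_atlas (chart_mem_atlas _ _) hxs'
  have h2 : MDifferentiableAt (𝓡 n) (𝓡 n) e.symm (e (F x)) :=
    mdifferentiableAt_atlas_symm (chart_mem_atlas _ _) (e.map_source hxs')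
  have h3 : MDifferentiableAt 𝓘(ℝ, E) (𝓡 n) F x := hx.mdifferentiableAt (by simp)
  have h4 : HasMFDerivAt 𝓘(ℝ, E) (𝓡 n) (e ∘ F) x (fderiv ℝ (e ∘ F) x) := by
    have := (h1.comp x h3).hasMFDerivAt
    rw [mfderiv_eq_fderiv] at this
    exact this
  have h5 : HasMFDerivAt 𝓘(ℝ, E) (𝓡 n) F x
      ((mfderiv (𝓡 n) (𝓡 n) e.symm (e (F x))).comp (fderiv ℝ (e ∘ F) x)) := by
    refine (h2.hasMFDerivAt.comp x h4).congr_of_eventuallyEq ?_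
    filter_upwards [hxs] with z hz using (e.left_inv hz).symm
  have h6 := h5.mfderiv
  let α : S → EuclideanSpace ℝ (Fin n) [⋀^Fin 2]→L[ℝ] ℝ := Ω
  let D : E →L[ℝ] EuclideanSpace ℝ (Fin n) := mfderiv 𝓘(ℝ, E) (𝓡 n) F x
  let D1 : EuclideanSpace ℝ (Fin n) →L[ℝ] EuclideanSpace ℝ (Fin n) :=
    mfderiv (𝓡 n) (𝓡 n) e.symm (e (F x))
  change α (F x) ![D u, D v] = α (e.symm (e (F x))) ![D1 (fderiv ℝ (e ∘ F) x u),
    D1 (fderiv ℝ (e ∘ F) x v)]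
  have h7 : D = D1.comp (fderiv ℝ (e ∘ F) x) := h6
  rw [e.left_inv hxs', h7]
  rfl

theorem SymplecticForm.pullback_contDiffAt_and_closed (Ω : SymplecticForm n S) {F : E → S} {y : E}
    (hF : ∀ᶠ x in 𝓝 y, ContMDiffAt 𝓘(ℝ, E) (𝓡 n) ∞ F x) [FiniteDimensional ℝ E] :
    ContDiffAt ℝ ∞ (TwoForm.pullback Ω.form F) y ∧ extDeriv (TwoForm.pullback Ω.form F) y = 0 := by
  set e := chartAt (EuclideanSpace ℝ (Fin n)) (F y) with he
  have h0 : TwoForm.pullback Ω.form F =ᶠ[𝓝 y]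
      fun x => (TwoForm.inChart Ω.form e (e (F x))).compContinuousLinearMap (fderiv ℝ (e ∘ F) x) :=
    TwoForm.pullback_eventuallyEq Ω.form hF
  have hys : F y ∈ e.source := mem_chart_source _ _
  have h1 : ContMDiffAt (𝓡 n) (𝓡 n) ∞ e (F y) :=
    contMDiffAt_of_mem_maximalAtlas (IsManifold.chart_mem_maximalAtlas _) hys
  have h2 : ContDiffAt ℝ ∞ (e ∘ F) y :=
    contMDiffAt_iff_contDiffAt.1 (h1.comp y hF.self_of_nhds)
  have h3 : ContDiffAt ℝ ∞ (TwoForm.inChart Ω.form e) ((e ∘ F) y) :=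
    (Ω.smooth' e (chart_mem_atlas _ _)).contDiffAt (e.open_target.mem_nhds (e.map_source hys))
  have h4 : extDeriv (TwoForm.inChart Ω.form e) ((e ∘ F) y) = 0 :=
    Ω.closed' e (chart_mem_atlas _ _) _ (e.map_source hys)
  constructor
  · refine ContDiffAt.congr_of_eventuallyEq ?_ h0
    refine contDiffAt_alt_of_apply fun u v => ?_
    have h5 : ContDiffAt ℝ ∞ (fderiv ℝ (e ∘ F)) y := h2.fderiv_right (by simp)
    exact ((h3.comp y h2).alt_apply (h5.clm_apply contDiffAt_const)
      (h5.clm_apply contDiffAt_const)).congr_of_eventuallyEq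
      (Eventually.of_forall fun x => alt_comp_apply _ _ u v)
  · rw [h0.extDeriv_eq]
    refine (extDeriv_pullback (r := ∞) (h3.differentiableAt (by simp)) h2 ?_).trans ?_
    · rw [minSmoothness_of_isRCLikeNormedField]
      exact ENat.LEInfty.out
    · rw [h4]
      rfl

end Pullback

/-! ### Hamiltonian vector fields and their smoothness -/

section HamiltonianVectorFields

variable {n : ℕ} {S : Type*} [TopologicalSpace S] [ChartedSpace (EuclideanSpace ℝ (Fin n)) S]

namespace SymplecticForm

theorem form_swap (Ω : SymplecticForm n S) (x : S) (u v : TangentSpace (𝓡 n) x) :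
    Ω.form x ![u, v] = -Ω.form x ![v, u] :=
  alt_swap (E := EuclideanSpace ℝ (Fin n)) (Ω.form x) u v

/-- The symplectic form at a point as a bilinear form. -/
def bilin (Ω : SymplecticForm n S) (x : S) :
    TangentSpace (𝓡 n) x →L[ℝ] TangentSpace (𝓡 n) x →L[ℝ] ℝ :=
  altToBilin (EuclideanSpace ℝ (Fin n)) (Ω.form x)

theorem bilin_apply (Ω : SymplecticForm n S) (x : S) (u v : TangentSpace (𝓡 n) x) :
    Ω.bilin x u v = Ω.form x ![u, v] := rfl

theorem eq_of_form_eq (Ω : SymplecticForm n S) {x : S} {u v : TangentSpace (𝓡 n) x}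
    (h : ∀ w, Ω.form x ![w, u] = Ω.form x ![w, v]) : u = v := by
  refine sub_eq_zero.1 (Ω.nondegenerate' x _ fun w => ?_)
  rw [← bilin_apply, map_sub, sub_apply, bilin_apply, bilin_apply,
    Ω.form_swap x u, Ω.form_swap x v, h, sub_self]

theorem eq_hamVec (Ω : SymplecticForm n S) {F : S → ℝ} {x : S} {v : TangentSpace (𝓡 n) x}
    (h : ∀ w, Ω.form x ![w, v] = mfderiv (𝓡 n) 𝓘(ℝ, ℝ) F x w) : v = Ω.hamVec F x :=
  Ω.eq_of_form_eq fun w => (h w).trans (Ω.hamVec_spec F x w).symm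

theorem bracket_eq_form (Ω : SymplecticForm n S) (F G : S → ℝ) (x : S) :
    Ω.bracket F G x = Ω.form x ![Ω.hamVec F x, Ω.hamVec G x] :=
  (Ω.hamVec_spec G x _).symm

theorem bracket_swap (Ω : SymplecticForm n S) (F G : S → ℝ) (x : S) :
    Ω.bracket F G x = -Ω.bracket G F x := by
  rw [bracket_eq_form, bracket_eq_form, form_swap]

theorem hamVec_neg (Ω : SymplecticForm n S) (F : S → ℝ) (x : S) :
    Ω.hamVec (-F) x = -Ω.hamVec F x := by
  symm
  refine Ω.eq_hamVec fun w => ?_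
  rw [← bilin_apply, map_neg, bilin_apply, hamVec_spec, mfderiv_neg]
  rfl

variable [IsManifold (𝓡 n) ∞ S]

/-- In a chart X_F is the inverse of the isomorphism given by the form, applied to dF, and inversion
of operators is smooth. This is needed for existence and uniqueness of integral curves. -/
theorem contMDiff_hamVec (Ω : SymplecticForm n S) {F : S → ℝ}
    (hF : ContMDiff (𝓡 n) 𝓘(ℝ, ℝ) ∞ F) :
    ContMDiff (𝓡 n) (𝓡 n).tangent ∞
      (fun x => (⟨x, Ω.hamVec F x⟩ : TangentBundle (𝓡 n) S)) := by
  intro x₀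
  rw [Bundle.contMDiffAt_section]
  set e := chartAt (EuclideanSpace ℝ (Fin n)) x₀ with he
  -- The field stands in the second slot of the form, whereas `altToBilin` takes its argument in the
  -- first; hence the sign.
  let B : EuclideanSpace ℝ (Fin n) → EuclideanSpace ℝ (Fin n) →L[ℝ] EuclideanSpace ℝ (Fin n) →L[ℝ] ℝ := fun z =>
    -altToBilin (EuclideanSpace ℝ (Fin n)) (TwoForm.inChart Ω.form e z)
  let f : EuclideanSpace ℝ (Fin n) → ℝ := F ∘ e.symm
  have hx₀ : x₀ ∈ e.source := mem_chart_source _ _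
  have hes : ∀ z ∈ e.target, ContMDiffAt (𝓡 n) (𝓡 n) ∞ e.symm z := fun z hz =>
    contMDiffAt_symm_of_mem_maximalAtlas (IsManifold.chart_mem_maximalAtlas _) hz
  have he1 : ∀ x ∈ e.source, ContMDiffAt (𝓡 n) (𝓡 n) ∞ e x := fun z hz =>
    contMDiffAt_of_mem_maximalAtlas (IsManifold.chart_mem_maximalAtlas _) hz
  have hed : e.MDifferentiable (𝓡 n) (𝓡 n) := mdifferentiable_of_mem_atlas (chart_mem_atlas _ _)
  have hf : ∀ z ∈ e.target, ContDiffAt ℝ ∞ f z := fun z hz =>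
    contMDiffAt_iff_contDiffAt.1 ((hF _).comp z (hes z hz))
  have hB : ∀ z ∈ e.target, ContDiffAt ℝ ∞ B z := by
    intro z hz
    have h3 : ContDiffAt ℝ ∞ (TwoForm.inChart Ω.form e) z :=
      (Ω.smooth' e (chart_mem_atlas _ _)).contDiffAt (e.open_target.mem_nhds hz)
    exact (contDiff_altToBilin.contDiffAt.comp z h3).neg
  have hBi : ∀ z ∈ e.target, ∃ C : EuclideanSpace ℝ (Fin n) ≃L[ℝ] (EuclideanSpace ℝ (Fin n) →L[ℝ] ℝ), (C : EuclideanSpace ℝ (Fin n) →L[ℝ] EuclideanSpace ℝ (Fin n) →L[ℝ] ℝ) = B z := by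
    intro z hz
    have hinj : LinearMap.ker (B z).toLinearMap = ⊥ := by
      refine LinearMap.ker_eq_bot'.2 fun u hu => ?_
      have h1 : ∀ v, TwoForm.inChart Ω.form e z ![v, u] = 0 := fun v =>
        (alt_swap _ _ _).trans (congrArg (fun l : EuclideanSpace ℝ (Fin n) →L[ℝ] ℝ => l v) hu)
      have h2 : (mfderiv (𝓡 n) (𝓡 n) e.symm z u) = 0 := by
        refine Ω.nondegenerate' _ _ fun w => ?_
        obtain ⟨v, rfl⟩ := hed.symm.mfderiv_surjective hz w
        have h3 := h1 v
        rw [form_swap]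
        exact neg_eq_zero.2 ((TwoForm.inChart_apply Ω.form e z v u).symm.trans h3)
      exact hed.symm.mfderiv_injective hz (h2.trans (map_zero _).symm)
    have hdim : Module.finrank ℝ (EuclideanSpace ℝ (Fin n)) = Module.finrank ℝ (EuclideanSpace ℝ (Fin n) →L[ℝ] ℝ) := by
      rw [← Subspace.dual_finrank_eq (K := ℝ) (V := EuclideanSpace ℝ (Fin n))]
      exact LinearEquiv.finrank_eq LinearMap.toContinuousLinearMap
    have hsur := (LinearMap.injective_iff_surjective_of_finrank_eq_finrank hdim).1
      (LinearMap.ker_eq_bot.1 hinj)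
    exact ⟨ContinuousLinearEquiv.ofBijective (B z) hinj (LinearMap.range_eq_top.2 hsur), rfl⟩
  have key : ∀ x ∈ e.source, (mfderiv (𝓡 n) (𝓡 n) e x (Ω.hamVec F x) : EuclideanSpace ℝ (Fin n)) =
      (B (e x)).inverse (fderiv ℝ f (e x)) := by
    intro x hx
    obtain ⟨C, hC⟩ := hBi _ (e.map_source hx)
    rw [← hC, ContinuousLinearMap.inverse_equiv]
    refine (C.eq_symm_apply).2 ?_
    have hCB : ∀ u, C u = B (e x) u := fun u => congrArg (fun l : EuclideanSpace ℝ (Fin n) →L[ℝ] EuclideanSpace ℝ (Fin n) →L[ℝ] ℝ => l u) hC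
    refine (hCB _).trans ?_
    ext w
    refine (alt_swap (TwoForm.inChart Ω.form e (e x)) w
      (mfderiv (𝓡 n) (𝓡 n) e x (Ω.hamVec F x))).symm.trans ?_
    refine (TwoForm.inChart_apply Ω.form e (e x) w _).trans ?_
    have h1 : mfderiv (𝓡 n) (𝓡 n) e.symm (e x) (mfderiv (𝓡 n) (𝓡 n) e x (Ω.hamVec F x)) =
        Ω.hamVec F x :=
      congrArg (fun l : TangentSpace (𝓡 n) x →L[ℝ] TangentSpace (𝓡 n) x => l (Ω.hamVec F x))
        (hed.symm_comp_deriv hx)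
    have h2 : HasMFDerivAt (𝓡 n) 𝓘(ℝ, ℝ) f (e x)
        ((mfderiv (𝓡 n) 𝓘(ℝ, ℝ) F (e.symm (e x))).comp (mfderiv (𝓡 n) (𝓡 n) e.symm (e x))) :=
      ((hF _).mdifferentiableAt (by simp)).hasMFDerivAt.comp _
        (hed.mdifferentiableAt_symm (e.map_source hx)).hasMFDerivAt
    have h3 : fderiv ℝ f (e x) =
        (mfderiv (𝓡 n) 𝓘(ℝ, ℝ) F (e.symm (e x))).comp (mfderiv (𝓡 n) (𝓡 n) e.symm (e x)) := by
      rw [← mfderiv_eq_fderiv]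
      exact h2.mfderiv
    refine Eq.trans ?_ (congrArg (fun l : EuclideanSpace ℝ (Fin n) →L[ℝ] ℝ => l w) h3).symm
    let α : S → EuclideanSpace ℝ (Fin n) [⋀^Fin 2]→L[ℝ] ℝ := Ω.form
    let X : EuclideanSpace ℝ (Fin n) := Ω.hamVec F x
    let D1 : EuclideanSpace ℝ (Fin n) →L[ℝ] EuclideanSpace ℝ (Fin n) := mfderiv (𝓡 n) (𝓡 n) e.symm (e x)
    let D2 : EuclideanSpace ℝ (Fin n) →L[ℝ] EuclideanSpace ℝ (Fin n) := mfderiv (𝓡 n) (𝓡 n) e x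
    let dF : S → EuclideanSpace ℝ (Fin n) →L[ℝ] ℝ := fun y => mfderiv (𝓡 n) 𝓘(ℝ, ℝ) F y
    change α (e.symm (e x)) ![D1 w, D1 (D2 X)] = dF (e.symm (e x)) (D1 w)
    have h4 : D1 (D2 X) = X := h1
    rw [h4, e.left_inv hx]
    exact Ω.hamVec_spec F x (D1 w)
  have hsm : ContMDiffAt (𝓡 n) (𝓡 n) ∞
      (fun x => (B (e x)).inverse (fderiv ℝ f (e x))) x₀ := by
    have hz := e.map_source hx₀
    have h1 : ContDiffAt ℝ ∞ (fun z => (B z).inverse (fderiv ℝ f z)) (e x₀) := by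
      obtain ⟨C, hC⟩ := hBi _ hz
      have h2 : ContDiffAt ℝ ∞ ContinuousLinearMap.inverse (B (e x₀)) := by
        rw [← hC]
        exact contDiffAt_map_inverse C
      exact (h2.comp _ (hB _ hz)).clm_apply ((hf _ hz).fderiv_right (by simp))
    exact h1.contMDiffAt.comp x₀ (he1 x₀ hx₀)
  refine hsm.congr_of_eventuallyEq ?_
  filter_upwards [e.open_source.mem_nhds hx₀] with x hx
  rw [← key x hx]
  -- Smoothness of a section is read in the trivialisation at x₀, which is the differential of the
  -- chart.
  have h1 := TangentBundle.continuousLinearMapAt_trivializationAt (I := 𝓡 n) (x₀ := x₀) (x := x) hx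
  have h2 : mfderiv (𝓡 n) (𝓡 n) (extChartAt (𝓡 n) x₀) x = mfderiv (𝓡 n) (𝓡 n) e x :=
    (hasMFDerivAt_extChartAt (I := 𝓡 n) hx).mfderiv
  rw [h2] at h1
  refine Eq.trans ?_ (congrArg (fun l : EuclideanSpace ℝ (Fin n) →L[ℝ] EuclideanSpace ℝ (Fin n) => l (Ω.hamVec F x)) h1)
  exact (Bundle.Trivialization.continuousLinearMapAt_apply_of_mem ℝ _ hx _).symm

end SymplecticForm

end HamiltonianVectorFields

/-- Connectedness of the unit interval; the target needs no topology. It propagates along leaf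
curves what is known only near each parameter. -/
theorem eq_of_locally_constant_Icc {Y : Type*} {f : ℝ → Y}
    (hf : ∀ t ∈ Icc (0 : ℝ) 1, ∀ᶠ t' in 𝓝[Icc 0 1] t, f t' = f t) : f 0 = f 1 := by
  let g : Icc (0 : ℝ) 1 → Y := fun t => f t
  have hg : IsLocallyConstant g := by
    rw [IsLocallyConstant.iff_eventually_eq]
    rintro ⟨t, ht⟩
    exact (eventually_nhds_subtype_iff _ _ (fun x => f x = f t)).2 (hf t ht)
  exact hg.apply_eq_of_isPreconnected isPreconnected_univ
    (mem_univ ⟨0, by simp⟩) (mem_univ ⟨1, by simp⟩)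

/-! ### Fibre products as immersed submanifolds -/

section FiberProduct

variable {n nρ k m : ℕ} {S Sρ P : Type*}
  [TopologicalSpace S] [SmoothManifold n S]
  [TopologicalSpace Sρ] [SmoothManifold nρ Sρ]

/-- The fibre product is an immersed submanifold of the product. -/
structure IsImmersedPullback (n nρ : ℕ) {S Sρ P : Type*} [TopologicalSpace S]
    [ChartedSpace (EuclideanSpace ℝ (Fin n)) S] [TopologicalSpace Sρ]
    [ChartedSpace (EuclideanSpace ℝ (Fin nρ)) Sρ] (J : S → P) (ρ : Sρ → P) (m : ℕ)
    [ChartedSpace (EuclideanSpace ℝ (Fin m)) (J.Pullback ρ)] : Prop where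
  smooth_fst : ContMDiff (𝓡 m) (𝓡 n) ∞ (Pullback.fst : J.Pullback ρ → S)
  smooth_snd : ContMDiff (𝓡 m) (𝓡 nρ) ∞ (Pullback.snd : J.Pullback ρ → Sρ)
  immersion : ∀ (q : J.Pullback ρ) (a : TangentSpace (𝓡 m) q),
    mfderiv (𝓡 m) (𝓡 n) (Pullback.fst : J.Pullback ρ → S) q a = 0 →
    mfderiv (𝓡 m) (𝓡 nρ) (Pullback.snd : J.Pullback ρ → Sρ) q a = 0 → a = 0

namespace IsImmersedPullback

variable {J : S → P} {ρ : Sρ → P} [SmoothManifold m (J.Pullback ρ)]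

theorem hasMFDerivAt_fst (hi : IsImmersedPullback n nρ J ρ m) (q : J.Pullback ρ) :
    HasMFDerivAt (𝓡 m) (𝓡 n) (Pullback.fst : J.Pullback ρ → S) q
      (mfderiv (𝓡 m) (𝓡 n) (Pullback.fst : J.Pullback ρ → S) q) :=
  ((hi.smooth_fst q).mdifferentiableAt (by simp)).hasMFDerivAt

theorem hasMFDerivAt_snd (hi : IsImmersedPullback n nρ J ρ m) (q : J.Pullback ρ) :
    HasMFDerivAt (𝓡 m) (𝓡 nρ) (Pullback.snd : J.Pullback ρ → Sρ) q
      (mfderiv (𝓡 m) (𝓡 nρ) (Pullback.snd : J.Pullback ρ → Sρ) q) :=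
  ((hi.smooth_snd q).mdifferentiableAt (by simp)).hasMFDerivAt

theorem ext (hi : IsImmersedPullback n nρ J ρ m) {q : J.Pullback ρ} {a b : TangentSpace (𝓡 m) q}
    (h1 : mfderiv (𝓡 m) (𝓡 n) (Pullback.fst : J.Pullback ρ → S) q a =
      mfderiv (𝓡 m) (𝓡 n) (Pullback.fst : J.Pullback ρ → S) q b)
    (h2 : mfderiv (𝓡 m) (𝓡 nρ) (Pullback.snd : J.Pullback ρ → Sρ) q a =
      mfderiv (𝓡 m) (𝓡 nρ) (Pullback.snd : J.Pullback ρ → Sρ) q b) : a = b := by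
  refine sub_eq_zero.1 (hi.immersion q _ ?_ ?_)
  · rw [map_sub, h1, sub_self]
  · rw [map_sub, h2, sub_self]

theorem smooth_val (hi : IsImmersedPullback n nρ J ρ m) :
    ContMDiff (𝓡 m) ((𝓡 n).prod (𝓡 nρ)) ∞ (Subtype.val : J.Pullback ρ → S × Sρ) :=
  hi.smooth_fst.prodMk hi.smooth_snd

theorem injective_mfderiv_val (hi : IsImmersedPullback n nρ J ρ m) (q : J.Pullback ρ) :
    Injective (mfderiv (𝓡 m) ((𝓡 n).prod (𝓡 nρ)) (Subtype.val : J.Pullback ρ → S × Sρ) q) := by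
  have h1 : HasMFDerivAt (𝓡 m) ((𝓡 n).prod (𝓡 nρ)) (Subtype.val : J.Pullback ρ → S × Sρ) q
    ((mfderiv (𝓡 m) (𝓡 n) (Pullback.fst : J.Pullback ρ → S) q).prod
      (mfderiv (𝓡 m) (𝓡 nρ) (Pullback.snd : J.Pullback ρ → Sρ) q)) :=
    (hi.hasMFDerivAt_fst q).prodMk (hi.hasMFDerivAt_snd q)
  rw [h1.mfderiv]
  intro a b hab
  exact hi.ext (congrArg Prod.fst hab) (congrArg Prod.snd hab)

theorem exists_retraction (hi : IsImmersedPullback n nρ J ρ m) (q : J.Pullback ρ) :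
    ∃ R : S × Sρ → J.Pullback ρ,
      (∀ᶠ y in 𝓝 q.1, ContMDiffAt ((𝓡 n).prod (𝓡 nρ)) (𝓡 m) ∞ R y) ∧
      ∀ᶠ x in 𝓝 q, R x.1 = x :=
  exists_immersion_retraction (Eventually.of_forall fun x => hi.smooth_val x)
    (hi.injective_mfderiv_val q)

theorem isInducing_val : IsInducing (Subtype.val : J.Pullback ρ → S × Sρ) := ⟨rfl⟩

/-- A curve in the fibre product with differentiable components is differentiable. -/
theorem exists_velocity (hi : IsImmersedPullback n nρ J ρ m) {s : Set ℝ} {t : ℝ}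
    (hs : UniqueDiffWithinAt ℝ s t) {γ : ℝ → S} {δ : ℝ → Sρ} {c : ℝ → J.Pullback ρ}
    (hc : ∀ t ∈ s, (c t).1 = (γ t, δ t)) {u : EuclideanSpace ℝ (Fin n)}
    {v : EuclideanSpace ℝ (Fin nρ)}
    (hγ : HasMFDerivWithinAt 𝓘(ℝ, ℝ) (𝓡 n) γ s t ((1 : ℝ →L[ℝ] ℝ).smulRight u))
    (hδ : HasMFDerivWithinAt 𝓘(ℝ, ℝ) (𝓡 nρ) δ s t ((1 : ℝ →L[ℝ] ℝ).smulRight v)) (ht : t ∈ s) :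
    ∃ a : EuclideanSpace ℝ (Fin m),
      HasMFDerivWithinAt 𝓘(ℝ, ℝ) (𝓡 m) c s t ((1 : ℝ →L[ℝ] ℝ).smulRight a) ∧
      mfderiv (𝓡 m) (𝓡 n) (Pullback.fst : J.Pullback ρ → S) (c t) a = u ∧
      mfderiv (𝓡 m) (𝓡 nρ) (Pullback.snd : J.Pullback ρ → Sρ) (c t) a = v := by
  -- Differentiability is tested in the product; the components of the velocity then follow from the
  -- uniqueness of derivatives within s.
  have d1 : MDifferentiableWithinAt 𝓘(ℝ, ℝ) (𝓡 m) c s t := by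
    refine mdifferentiableWithinAt_of_comp_immersion hi.smooth_val hi.injective_mfderiv_val
      isInducing_val ?_
    exact (hγ.prodMk hδ).mdifferentiableWithinAt.congr (fun t ht => hc t ht) (hc t ht)
  have d2 := d1.hasMFDerivWithinAt
  set c' := mfderivWithin 𝓘(ℝ, ℝ) (𝓡 m) c s t with hc'
  have hut : UniqueMDiffWithinAt 𝓘(ℝ, ℝ) s t := hs.uniqueMDiffWithinAt
  have f1 : HasMFDerivWithinAt 𝓘(ℝ, ℝ) (𝓡 n) (fun t => (c t).fst) s t
      ((mfderiv (𝓡 m) (𝓡 n) (Pullback.fst : J.Pullback ρ → S) (c t)).comp c') :=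
    (hi.hasMFDerivAt_fst (c t)).comp_hasMFDerivWithinAt t d2
  have f2 : HasMFDerivWithinAt 𝓘(ℝ, ℝ) (𝓡 nρ) (fun t => (c t).snd) s t
      ((mfderiv (𝓡 m) (𝓡 nρ) (Pullback.snd : J.Pullback ρ → Sρ) (c t)).comp c') :=
    (hi.hasMFDerivAt_snd (c t)).comp_hasMFDerivWithinAt t d2
  have c1 : ∀ t ∈ s, (c t).fst = γ t := fun t ht => congrArg Prod.fst (hc t ht)
  have c2 : ∀ t ∈ s, (c t).snd = δ t := fun t ht => congrArg Prod.snd (hc t ht)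
  have g1 : HasMFDerivWithinAt 𝓘(ℝ, ℝ) (𝓡 n) (fun t => (c t).fst) s t
      ((1 : ℝ →L[ℝ] ℝ).smulRight u) :=
    hγ.congr_of_eventuallyEq (eventually_of_mem self_mem_nhdsWithin c1) (c1 t ht)
  have g2 : HasMFDerivWithinAt 𝓘(ℝ, ℝ) (𝓡 nρ) (fun t => (c t).snd) s t
      ((1 : ℝ →L[ℝ] ℝ).smulRight v) :=
    hδ.congr_of_eventuallyEq (eventually_of_mem self_mem_nhdsWithin c2) (c2 t ht)
  refine ⟨c' (1 : ℝ), ?_, ?_, ?_⟩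
  · have e : (1 : ℝ →L[ℝ] ℝ).smulRight (c' (1 : ℝ) : EuclideanSpace ℝ (Fin m)) =
        (c' : ℝ →L[ℝ] EuclideanSpace ℝ (Fin m)) :=
      ContinuousLinearMap.ext_ring (one_smul ℝ (c' (1 : ℝ) : EuclideanSpace ℝ (Fin m)))
    rw [e]
    exact d2
  · exact (congrArg (fun l : ℝ →L[ℝ] EuclideanSpace ℝ (Fin n) => l 1) (hut.eq f1 g1)).trans
      (one_smul ℝ u)
  · exact (congrArg (fun l : ℝ →L[ℝ] EuclideanSpace ℝ (Fin nρ) => l 1) (hut.eq f2 g2)).trans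
      (one_smul ℝ v)

/-- A smooth map on a fibre product is constant along the curves in the fibre product which are
integral curves of a pair of vector fields tangent to its fibres. -/
theorem constant_along_curve (hi : IsImmersedPullback n nρ J ρ m)
    {E H N : Type*} [NormedAddCommGroup E] [NormedSpace ℝ E] [FiniteDimensional ℝ E]
    [TopologicalSpace H] {I : ModelWithCorners ℝ E H} [I.Boundaryless] [TopologicalSpace N]
    [ChartedSpace H N] [IsManifold I ∞ N] [T2Space N]
    {F : J.Pullback ρ → N} (hF : ContMDiff (𝓡 m) I ∞ F)
    {X : (x : S) → TangentSpace (𝓡 n) x} {Y : (y : Sρ) → TangentSpace (𝓡 nρ) y}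
    (hker : ∀ (q : J.Pullback ρ) (a : TangentSpace (𝓡 m) q),
      mfderiv (𝓡 m) (𝓡 n) (Pullback.fst : J.Pullback ρ → S) q a = X q.fst →
      mfderiv (𝓡 m) (𝓡 nρ) (Pullback.snd : J.Pullback ρ → Sρ) q a = Y q.snd →
      mfderiv (𝓡 m) I F q a = 0)
    {s : Set ℝ} (hs : Convex ℝ s) {γ : ℝ → S} {δ : ℝ → Sρ}
    (hγ : IsMIntegralCurveOn (I := 𝓡 n) γ X s) (hδ : IsMIntegralCurveOn (I := 𝓡 nρ) δ Y s)
    (hJ : ∀ t ∈ s, J (γ t) = ρ (δ t)) {t₁ t₂ : ℝ} (h₁ : t₁ ∈ s) (h₂ : t₂ ∈ s)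
    {q₁ q₂ : J.Pullback ρ} (hq₁ : q₁.1 = (γ t₁, δ t₁)) (hq₂ : q₂.1 = (γ t₂, δ t₂)) :
    F q₁ = F q₂ := by
  classical
  -- Two distinct parameters give s an interior, hence unique derivatives within s; equal parameters
  -- are trivial.
  by_cases h12 : t₁ = t₂
  · subst h12
    rw [Subtype.ext (hq₁.trans hq₂.symm)]
  have hint : (interior s).Nonempty := by
    have h3 : uIcc t₁ t₂ ⊆ s := hs.ordConnected.uIcc_subset h₁ h₂
    refine Nonempty.mono (interior_mono h3) ?_
    rw [uIcc, interior_Icc, nonempty_Ioo]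
    exact inf_lt_sup.2 h12
  have hu : UniqueDiffOn ℝ s := uniqueDiffOn_convex hs hint
  -- Outside s the value q₁ is a dummy.
  let c : ℝ → J.Pullback ρ := fun t => if h : J (γ t) = ρ (δ t) then ⟨(γ t, δ t), h⟩ else q₁
  have hc : ∀ t ∈ s, (c t).1 = (γ t, δ t) := fun t ht => by simp only [c, dif_pos (hJ t ht)]
  have e1 : c t₁ = q₁ := Subtype.ext ((hc t₁ h₁).trans hq₁.symm)
  have e2 : c t₂ = q₂ := Subtype.ext ((hc t₂ h₂).trans hq₂.symm)
  rw [← e1, ← e2]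
  refine constant_of_hasMFDerivWithinAt_zero (I := I) (c := F ∘ c) hs (fun t ht => ?_) h₁ h₂
  obtain ⟨a, ha, h3, h4⟩ := hi.exists_velocity (hu t ht) hc (hγ t ht) (hδ t ht) ht
  have c1 : (c t).fst = γ t := congrArg Prod.fst (hc t ht)
  have c2 : (c t).snd = δ t := congrArg Prod.snd (hc t ht)
  have h5 : mfderiv (𝓡 m) I F (c t) a = 0 :=
    hker (c t) a (h3.trans (by rw [c1])) (h4.trans (by rw [c2]))
  refine ⟨_, ((hF (c t)).mdifferentiableAt (by simp)).hasMFDerivAt.comp_hasMFDerivWithinAt t ha, ?_⟩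
  refine Eq.trans ?_ h5
  exact congrArg (mfderiv (𝓡 m) I F (c t)) (one_smul ℝ (a : EuclideanSpace ℝ (Fin m)))

end IsImmersedPullback

end FiberProduct

/-! ### Leaves, and maps which are constant on them -/

section Leaves

variable {n nρ k m r : ℕ} {S Sρ P : Type*}
  [TopologicalSpace S] [SmoothManifold n S]
  [TopologicalSpace Sρ] [SmoothManifold nρ Sρ]
  [TopologicalSpace P] [SmoothManifold k P]
  {Ω : SymplecticForm n S} {Ωρ : SymplecticForm nρ Sρ} {J : S → P} {ρ : Sρ → P}

/-- Constancy along single steps extends to the generated equivalence relation. `Y` carries no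
structure, since the lemma is also used for values in a leaf space and in an `Option` type. -/
theorem leaf_induction {Y : Type*} {g : J.Pullback ρ → Y}
    (hg : ∀ a b, LeafStep (k := k) Ω Ωρ J ρ a b → g a = g b) {q q' : J.Pullback ρ}
    (h : toLeaf (k := k) Ω Ωρ J ρ q = toLeaf (k := k) Ω Ωρ J ρ q') : g q = g q' := by
  have h1 : Relation.EqvGen (LeafStep (k := k) Ω Ωρ J ρ) q q' := Quotient.exact h
  induction h1 with
  | rel a b hab => exact hg a b hab
  | refl => rfl
  | symm a b _ ih => exact (ih (Quotient.sound (by assumption))).symm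
  | trans a b c hab hbc ih1 ih2 =>
    exact (ih1 (Quotient.sound hab)).trans (ih2 (Quotient.sound hbc))

theorem toLeaf_surjective : Surjective (toLeaf (k := k) Ω Ωρ J ρ) := Quotient.mk_surjective

variable [SmoothManifold m (J.Pullback ρ)]

theorem IsImmersedPullback.leaf_constant (hi : IsImmersedPullback n nρ J ρ m)
    {E H N : Type*} [NormedAddCommGroup E] [NormedSpace ℝ E] [FiniteDimensional ℝ E]
    [TopologicalSpace H] {I : ModelWithCorners ℝ E H} [I.Boundaryless] [TopologicalSpace N]
    [ChartedSpace H N] [IsManifold I ∞ N] [T2Space N]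
    {F : J.Pullback ρ → N} (hF : ContMDiff (𝓡 m) I ∞ F)
    (hker : ∀ (f : SmoothFn k P) (q : J.Pullback ρ) (a : TangentSpace (𝓡 m) q),
      mfderiv (𝓡 m) (𝓡 n) (Pullback.fst : J.Pullback ρ → S) q a = Ω.hamVec (f ∘ J) q.fst →
      mfderiv (𝓡 m) (𝓡 nρ) (Pullback.snd : J.Pullback ρ → Sρ) q a = -Ωρ.hamVec (f ∘ ρ) q.snd →
      mfderiv (𝓡 m) I F q a = 0) {q q' : J.Pullback ρ}
    (h : toLeaf (k := k) Ω Ωρ J ρ q = toLeaf (k := k) Ω Ωρ J ρ q') : F q = F q' := by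
  refine leaf_induction ?_ h
  rintro a b ⟨f, γ, δ, hγ, hδ, hJ, h1, h2, h3, h4⟩
  exact hi.constant_along_curve hF (hker f) (convex_Icc 0 1) hγ hδ hJ (t₁ := 0) (t₂ := 1)
    (by simp) (by simp) (Prod.ext h1.symm h2.symm) (Prod.ext h3.symm h4.symm)

variable [SmoothManifold r (LeafSpace (k := k) Ω Ωρ J ρ)]

namespace IsManifoldReduction

theorem immersed (h : IsManifoldReduction (k := k) Ω Ωρ J ρ m r) :
    IsImmersedPullback n nρ J ρ m := ⟨h.smooth_fst, h.smooth_snd, h.immersion⟩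

theorem hasMFDerivAt_proj (h : IsManifoldReduction (k := k) Ω Ωρ J ρ m r) (q : J.Pullback ρ) :
    HasMFDerivAt (𝓡 m) (𝓡 r) (toLeaf (k := k) Ω Ωρ J ρ) q
      (mfderiv (𝓡 m) (𝓡 r) (toLeaf (k := k) Ω Ωρ J ρ) q) :=
  ((h.smooth_proj q).mdifferentiableAt (by simp)).hasMFDerivAt

/-- A map whose differential kills the generators of the foliation is constant along leaf curves,
and the factor on the leaf space is smooth because the projection is a surjective submersion. -/
theorem exists_descent (h : IsManifoldReduction (k := k) Ω Ωρ J ρ m r)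
    {E H N : Type*} [NormedAddCommGroup E] [NormedSpace ℝ E] [FiniteDimensional ℝ E]
    [TopologicalSpace H] {I : ModelWithCorners ℝ E H} [I.Boundaryless] [TopologicalSpace N]
    [ChartedSpace H N] [IsManifold I ∞ N] [T2Space N]
    {F : J.Pullback ρ → N} (hF : ContMDiff (𝓡 m) I ∞ F)
    (hker : ∀ (f : SmoothFn k P) (q : J.Pullback ρ) (a : TangentSpace (𝓡 m) q),
      mfderiv (𝓡 m) (𝓡 n) (Pullback.fst : J.Pullback ρ → S) q a = Ω.hamVec (f ∘ J) q.fst →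
      mfderiv (𝓡 m) (𝓡 nρ) (Pullback.snd : J.Pullback ρ → Sρ) q a = -Ωρ.hamVec (f ∘ ρ) q.snd →
      mfderiv (𝓡 m) I F q a = 0) :
    ∃ G : LeafSpace (k := k) Ω Ωρ J ρ → N, ContMDiff (𝓡 r) I ∞ G ∧
      ∀ q, G (toLeaf (k := k) Ω Ωρ J ρ q) = F q := by
  let G : LeafSpace (k := k) Ω Ωρ J ρ → N := fun y => F (surjInv toLeaf_surjective y)
  have hG : ∀ q, G (toLeaf (k := k) Ω Ωρ J ρ q) = F q := fun q =>
    h.immersed.leaf_constant hF hker (surjInv_eq toLeaf_surjective _)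
  refine ⟨G, contMDiff_of_comp_submersion h.smooth_proj h.submersion toLeaf_surjective ?_, hG⟩
  have : G ∘ toLeaf (k := k) Ω Ωρ J ρ = F := funext hG
  rwa [this]

end IsManifoldReduction

/-- The restriction to the fibre product of the product symplectic form. -/
def productForm (Ω : SymplecticForm n S) (Ωρ : SymplecticForm nρ Sρ) (J : S → P) (ρ : Sρ → P)
    (m : ℕ) [SmoothManifold m (J.Pullback ρ)] : TwoForm m (J.Pullback ρ) := fun q =>
  (Ω.form q.fst).compContinuousLinearMap
      (mfderiv (𝓡 m) (𝓡 n) (Pullback.fst : J.Pullback ρ → S) q) +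
    (Ωρ.form q.snd).compContinuousLinearMap
      (mfderiv (𝓡 m) (𝓡 nρ) (Pullback.snd : J.Pullback ρ → Sρ) q)

theorem productForm_apply (q : J.Pullback ρ) (a b : TangentSpace (𝓡 m) q) :
    productForm Ω Ωρ J ρ m q ![a, b] =
      Ω.form q.fst
        ![mfderiv (𝓡 m) (𝓡 n) (Pullback.fst : J.Pullback ρ → S) q a,
          mfderiv (𝓡 m) (𝓡 n) (Pullback.fst : J.Pullback ρ → S) q b] +
      Ωρ.form q.snd
        ![mfderiv (𝓡 m) (𝓡 nρ) (Pullback.snd : J.Pullback ρ → Sρ) q a,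
          mfderiv (𝓡 m) (𝓡 nρ) (Pullback.snd : J.Pullback ρ → Sρ) q b] :=
  congrArg₂ (· + ·)
    (alt_comp_apply (E := EuclideanSpace ℝ (Fin m)) (F := EuclideanSpace ℝ (Fin n))
      (Ω.form q.fst) (mfderiv (𝓡 m) (𝓡 n) (Pullback.fst : J.Pullback ρ → S) q) a b)
    (alt_comp_apply (E := EuclideanSpace ℝ (Fin m)) (F := EuclideanSpace ℝ (Fin nρ))
      (Ωρ.form q.snd) (mfderiv (𝓡 m) (𝓡 nρ) (Pullback.snd : J.Pullback ρ → Sρ) q) a b)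

theorem productForm_swap (q : J.Pullback ρ) (a b : TangentSpace (𝓡 m) q) :
    productForm Ω Ωρ J ρ m q ![a, b] = -productForm Ω Ωρ J ρ m q ![b, a] :=
  alt_swap (E := EuclideanSpace ℝ (Fin m)) (productForm Ω Ωρ J ρ m q) a b

theorem IsImmersedPullback.productForm_pullback_contDiffAt_and_closed
    (hi : IsImmersedPullback n nρ J ρ m)
    {E : Type*} [NormedAddCommGroup E] [NormedSpace ℝ E] [FiniteDimensional ℝ E]
    {F : E → J.Pullback ρ} {y : E} (hF : ∀ᶠ x in 𝓝 y, ContMDiffAt 𝓘(ℝ, E) (𝓡 m) ∞ F x) :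
    ContDiffAt ℝ ∞ ((productForm Ω Ωρ J ρ m).pullback F) y ∧
      extDeriv ((productForm Ω Ωρ J ρ m).pullback F) y = 0 := by
  have h0 : (productForm Ω Ωρ J ρ m).pullback F =ᶠ[𝓝 y]
      TwoForm.pullback Ω.form (fun x => (F x).fst) +
        TwoForm.pullback Ωρ.form (fun x => (F x).snd) := by
    filter_upwards [hF] with x hx
    have hd := (hx.mdifferentiableAt (by simp)).hasMFDerivAt
    have h1 : mfderiv 𝓘(ℝ, E) (𝓡 n) (fun x => (F x).fst) x = _ :=
      ((hi.hasMFDerivAt_fst (F x)).comp x hd).mfderiv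
    have h2 : mfderiv 𝓘(ℝ, E) (𝓡 nρ) (fun x => (F x).snd) x = _ :=
      ((hi.hasMFDerivAt_snd (F x)).comp x hd).mfderiv
    refine alt_ext fun u v => ?_
    refine (TwoForm.pullback_apply _ F x u v).trans ((productForm_apply _ _ _).trans ?_)
    rw [Pi.add_apply, ContinuousAlternatingMap.add_apply, TwoForm.pullback_apply,
      TwoForm.pullback_apply, h1, h2]
    rfl
  have hf1 : ∀ᶠ x in 𝓝 y, ContMDiffAt 𝓘(ℝ, E) (𝓡 n) ∞ (fun x => (F x).fst) x :=
    hF.mono fun x hx => (hi.smooth_fst _).comp x hx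
  have hf2 : ∀ᶠ x in 𝓝 y, ContMDiffAt 𝓘(ℝ, E) (𝓡 nρ) ∞ (fun x => (F x).snd) x :=
    hF.mono fun x hx => (hi.smooth_snd _).comp x hx
  obtain ⟨a1, a2⟩ := Ω.pullback_contDiffAt_and_closed hf1
  obtain ⟨b1, b2⟩ := Ωρ.pullback_contDiffAt_and_closed hf2
  refine ⟨(a1.add b1).congr_of_eventuallyEq h0, ?_⟩
  rw [h0.extDeriv_eq, extDeriv_add (a1.differentiableAt (by simp)) (b1.differentiableAt (by simp)),
    a2, b2, add_zero]

end Leaves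

/-! ### The kernel of the restricted product form -/

section ReducedForm

variable {n nρ k m r : ℕ} {S Sρ P : Type*}
  [TopologicalSpace S] [SmoothManifold n S]
  [TopologicalSpace Sρ] [SmoothManifold nρ Sρ]
  [TopologicalSpace P] [SmoothManifold k P]
  {Ω : SymplecticForm n S} {Ωρ : SymplecticForm nρ Sρ} {J : S → P} {ρ : Sρ → P}
  [SmoothManifold m (J.Pullback ρ)] [SmoothManifold r (LeafSpace (k := k) Ω Ωρ J ρ)]

/-- A functional which vanishes on the kernel of a linear map factors through it. -/
theorem exists_factor_of_ker_le {V W : Type*} [AddCommGroup V] [Module ℝ V] [AddCommGroup W]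
    [Module ℝ W] (f : V →ₗ[ℝ] W) (l : V →ₗ[ℝ] ℝ) (h : ∀ v, f v = 0 → l v = 0) :
    ∃ α : W →ₗ[ℝ] ℝ, ∀ v, l v = α (f v) := by
  have h1 : l ∈ (LinearMap.ker f).dualAnnihilator :=
    (Submodule.mem_dualAnnihilator l).2 fun v hv => h v hv
  rw [← LinearMap.range_dualMap_eq_dualAnnihilator_ker] at h1
  obtain ⟨α, rfl⟩ := h1
  exact ⟨α, fun v => rfl⟩

namespace IsManifoldReduction

/-- The tangent space of the fibre product is the kernel of L = dJ - dρ. A vector a lies in the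
kernel of the restricted form iff pairing with a, as a functional on the full product, vanishes on
ker L, that is, factors as φ∘L. A global f with differential φ then exhibits a as (X_{f∘J},
-X_{f∘ρ}). -/
theorem productForm_ker_iff (h : IsManifoldReduction (k := k) Ω Ωρ J ρ m r)
    (hJ : ContMDiff (𝓡 n) (𝓡 k) ∞ J) (hρ : ContMDiff (𝓡 nρ) (𝓡 k) ∞ ρ)
    (q : J.Pullback ρ) (a : TangentSpace (𝓡 m) q) :
    (∀ b, productForm Ω Ωρ J ρ m q ![b, a] = 0) ↔
      mfderiv (𝓡 m) (𝓡 r) (toLeaf (k := k) Ω Ωρ J ρ) q a = 0 := by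
  rw [h.vertical_iff]
  have hJd : HasMFDerivAt (𝓡 n) (𝓡 k) J q.fst (mfderiv (𝓡 n) (𝓡 k) J q.fst) :=
    ((hJ _).mdifferentiableAt (by simp)).hasMFDerivAt
  have hρd : HasMFDerivAt (𝓡 nρ) (𝓡 k) ρ q.snd (mfderiv (𝓡 nρ) (𝓡 k) ρ q.snd) :=
    ((hρ _).mdifferentiableAt (by simp)).hasMFDerivAt
  let Jd : EuclideanSpace ℝ (Fin n) →L[ℝ] EuclideanSpace ℝ (Fin k) := mfderiv (𝓡 n) (𝓡 k) J q.fst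
  let ρd : EuclideanSpace ℝ (Fin nρ) →L[ℝ] EuclideanSpace ℝ (Fin k) :=
    mfderiv (𝓡 nρ) (𝓡 k) ρ q.snd
  let α : EuclideanSpace ℝ (Fin n) [⋀^Fin 2]→L[ℝ] ℝ := Ω.form q.fst
  let β : EuclideanSpace ℝ (Fin nρ) [⋀^Fin 2]→L[ℝ] ℝ := Ωρ.form q.snd
  let a1 : EuclideanSpace ℝ (Fin n) :=
    mfderiv (𝓡 m) (𝓡 n) (Pullback.fst : J.Pullback ρ → S) q a
  let a2 : EuclideanSpace ℝ (Fin nρ) :=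
    mfderiv (𝓡 m) (𝓡 nρ) (Pullback.snd : J.Pullback ρ → Sρ) q a
  have hcompJ : ∀ (f : SmoothFn k P) (w : EuclideanSpace ℝ (Fin n)),
      mfderiv (𝓡 n) 𝓘(ℝ, ℝ) (f ∘ J) q.fst w = mfderiv (𝓡 k) 𝓘(ℝ, ℝ) f (J q.fst) (Jd w) := by
    intro f w
    have := (((f.contMDiff (J q.fst)).mdifferentiableAt (by simp)).hasMFDerivAt.comp q.fst hJd).mfderiv
    rw [this]
    rfl
  have hcompρ : ∀ (f : SmoothFn k P) (w : EuclideanSpace ℝ (Fin nρ)),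
      mfderiv (𝓡 nρ) 𝓘(ℝ, ℝ) (f ∘ ρ) q.snd w = mfderiv (𝓡 k) 𝓘(ℝ, ℝ) f (J q.fst) (ρd w) := by
    intro f w
    have h1 := (((f.contMDiff (ρ q.snd)).mdifferentiableAt (by simp)).hasMFDerivAt.comp q.snd hρd).mfderiv
    rw [h1]
    have h2 : J q.fst = ρ q.snd := q.2
    rw [h2]
    rfl
  constructor
  · intro ha
    let l : (EuclideanSpace ℝ (Fin n) × EuclideanSpace ℝ (Fin nρ)) →ₗ[ℝ] ℝ :=
      LinearMap.coprod ((altToBilin _ α).flip a1 : EuclideanSpace ℝ (Fin n) →L[ℝ] ℝ).toLinearMap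
        ((altToBilin _ β).flip a2 : EuclideanSpace ℝ (Fin nρ) →L[ℝ] ℝ).toLinearMap
    let L : (EuclideanSpace ℝ (Fin n) × EuclideanSpace ℝ (Fin nρ)) →ₗ[ℝ] EuclideanSpace ℝ (Fin k) :=
      LinearMap.coprod Jd.toLinearMap (-ρd.toLinearMap)
    have hl : ∀ u v, l (u, v) = α ![u, a1] + β ![v, a2] := fun u v => rfl
    have hL : ∀ u v, L (u, v) = Jd u - ρd v := fun u v => (sub_eq_add_neg _ _).symm
    obtain ⟨φ, hφ⟩ := exists_factor_of_ker_le L l (by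
      rintro ⟨u, v⟩ huv
      rw [hL, sub_eq_zero] at huv
      obtain ⟨b, rfl, rfl⟩ := (h.tangent_iff q u v).2 huv
      exact (productForm_apply q b a).symm.trans (ha b))
    obtain ⟨f, hf⟩ := exists_smooth_mfderiv_eq (I := 𝓡 k) (J q.fst) (LinearMap.toContinuousLinearMap φ)
    have hα : ∀ w, α ![w, a1] = φ (Jd w) := by
      intro w
      have h1 : α ![w, a1] + β ![0, a2] = φ (Jd w - ρd 0) := by
        rw [← hL, ← hφ, hl]
      rwa [← altToBilin_apply β, map_zero, map_zero, zero_apply, add_zero, sub_zero] at h1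
    -- The sign in L makes -a2, rather than a2, the Hamiltonian vector of f∘ρ.
    have hβ : ∀ w, β ![w, -a2] = φ (ρd w) := by
      intro w
      have h1 : α ![0, a1] + β ![w, a2] = φ (Jd 0 - ρd w) := by
        rw [← hL, ← hφ, hl]
      rw [← altToBilin_apply α, map_zero, map_zero, zero_apply, zero_add, zero_sub, map_neg] at h1
      rw [← altToBilin_apply, map_neg, altToBilin_apply, h1, neg_neg]
    have h1 : mfderiv (𝓡 m) (𝓡 n) (Pullback.fst : J.Pullback ρ → S) q a = Ω.hamVec (f ∘ J) q.fst := by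
      refine Ω.eq_hamVec fun w => (hα w).trans (Eq.trans ?_ (hcompJ f w).symm)
      rw [hf.mfderiv]
      rfl
    have h2 : -mfderiv (𝓡 m) (𝓡 nρ) (Pullback.snd : J.Pullback ρ → Sρ) q a =
        Ωρ.hamVec (f ∘ ρ) q.snd := by
      refine Ωρ.eq_hamVec fun w => (hβ w).trans (Eq.trans ?_ (hcompρ f w).symm)
      rw [hf.mfderiv]
      rfl
    exact ⟨f, h1, neg_eq_iff_eq_neg.1 h2⟩
  · rintro ⟨f, h1, h2⟩ b
    rw [productForm_apply, h1, h2]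
    have h3 : Ωρ.form q.snd
        ![mfderiv (𝓡 m) (𝓡 nρ) (Pullback.snd : J.Pullback ρ → Sρ) q b,
          -Ωρ.hamVec (f ∘ ρ) q.snd] = -(mfderiv (𝓡 nρ) 𝓘(ℝ, ℝ) (f ∘ ρ) q.snd
          (mfderiv (𝓡 m) (𝓡 nρ) (Pullback.snd : J.Pullback ρ → Sρ) q b)) := by
      exact (map_neg (Ωρ.bilin q.snd _) _).trans (congrArg Neg.neg (Ωρ.hamVec_spec _ _ _))
    rw [h3, Ω.hamVec_spec]
    have h4 := (h.tangent_iff q _ _).1 ⟨b, rfl, rfl⟩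
    have h5 := congrArg (mfderiv (𝓡 k) 𝓘(ℝ, ℝ) f (J q.fst)) h4
    exact (congrArg₂ (fun x y : ℝ => x + -y) (hcompJ f _) (hcompρ f _)).trans
      (add_neg_eq_zero.2 h5)

theorem productForm_congr (h : IsManifoldReduction (k := k) Ω Ωρ J ρ m r)
    (hJ : ContMDiff (𝓡 n) (𝓡 k) ∞ J) (hρ : ContMDiff (𝓡 nρ) (𝓡 k) ∞ ρ)
    {q : J.Pullback ρ} {a b a' b' : TangentSpace (𝓡 m) q}
    (ha : mfderiv (𝓡 m) (𝓡 r) (toLeaf (k := k) Ω Ωρ J ρ) q a =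
      mfderiv (𝓡 m) (𝓡 r) (toLeaf (k := k) Ω Ωρ J ρ) q a')
    (hb : mfderiv (𝓡 m) (𝓡 r) (toLeaf (k := k) Ω Ωρ J ρ) q b =
      mfderiv (𝓡 m) (𝓡 r) (toLeaf (k := k) Ω Ωρ J ρ) q b') :
    productForm Ω Ωρ J ρ m q ![a, b] = productForm Ω Ωρ J ρ m q ![a', b'] := by
  let B : TangentSpace (𝓡 m) q →L[ℝ] TangentSpace (𝓡 m) q →L[ℝ] ℝ :=
    altToBilin (EuclideanSpace ℝ (Fin m)) (productForm Ω Ωρ J ρ m q)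
  have key : ∀ c d d' : TangentSpace (𝓡 m) q,
      mfderiv (𝓡 m) (𝓡 r) (toLeaf (k := k) Ω Ωρ J ρ) q d =
        mfderiv (𝓡 m) (𝓡 r) (toLeaf (k := k) Ω Ωρ J ρ) q d' →
      productForm Ω Ωρ J ρ m q ![c, d] = productForm Ω Ωρ J ρ m q ![c, d'] := by
    intro c d d' hd
    have h1 : mfderiv (𝓡 m) (𝓡 r) (toLeaf (k := k) Ω Ωρ J ρ) q (d - d') = 0 := by
      rw [map_sub, hd, sub_self]
    have h2 : B c (d - d') = 0 := (h.productForm_ker_iff hJ hρ q _).2 h1 c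
    rw [map_sub] at h2
    exact sub_eq_zero.1 h2
  rw [key a b b' hb, productForm_swap, key b' a a' ha, ← productForm_swap]

end IsManifoldReduction

end ReducedForm

theorem hasMFDerivAt_extChartAt_symm_self {E H M : Type*} [NormedAddCommGroup E] [NormedSpace ℝ E]
    [TopologicalSpace H] {I : ModelWithCorners ℝ E H} [I.Boundaryless] [TopologicalSpace M]
    [ChartedSpace H M] [IsManifold I ∞ M] (x : M) :
    HasMFDerivAt 𝓘(ℝ, E) I (extChartAt I x).symm (extChartAt I x x) (ContinuousLinearMap.id ℝ E) := by
  have hx : (extChartAt I x).symm (extChartAt I x x) = x := extChartAt_to_inv x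
  refine ⟨continuousAt_extChartAt_symm x, ?_⟩
  suffices hd : HasFDerivAt (𝕜 := ℝ) (writtenInExtChartAt 𝓘(ℝ, E) I (extChartAt I x x)
      (extChartAt I x).symm) (ContinuousLinearMap.id ℝ E) (extChartAt I x x) from
    hd.hasFDerivWithinAt
  refine (hasFDerivAt_id (𝕜 := ℝ) (extChartAt I x x)).congr_of_eventuallyEq ?_
  filter_upwards [extChartAt_target_mem_nhds (I := I) x] with z hz
  have h2 := (extChartAt I x).right_inv hz
  have h3 : ∀ x', x' = x → extChartAt I x' ((extChartAt I x).symm z) = z := by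
    rintro _ rfl
    exact h2
  exact h3 _ hx

/-- A closed two-form annihilating the vertical directions is constant along the fibres. -/
theorem closed_form_const_on_fiber {X Y : Type*} [NormedAddCommGroup X] [NormedSpace ℝ X]
    [NormedAddCommGroup Y] [NormedSpace ℝ Y] {β : X × Y → (X × Y) [⋀^Fin 2]→L[ℝ] ℝ}
    {z₀ : X} {d₀ : Y} {ε : ℝ} (h : ∀ w ∈ Metric.ball (z₀, d₀) ε,
      (DifferentiableAt ℝ β w ∧ extDeriv β w = 0) ∧
        ∀ᶠ w' in 𝓝 w, ∀ η v, β w' ![(0, η), v] = 0)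
    (u v : X) {d : Y} (hd : d ∈ Metric.ball d₀ ε) :
    β (z₀, d) ![(u, 0), (v, 0)] = β (z₀, d₀) ![(u, 0), (v, 0)] := by
  have hε : 0 < ε := Metric.pos_of_mem_ball hd
  have hmem : ∀ d ∈ Metric.ball d₀ ε, (z₀, d) ∈ Metric.ball (z₀, d₀) ε := by
    intro d hd
    rw [← ball_prod_same]
    exact ⟨Metric.mem_ball_self hε, hd⟩
  -- Moving d differentiates the form in a direction (0, η) which it annihilates near the point;
  -- `closed_form_fderiv_eq_zero` makes this derivative vanish, and a ball is convex.
  have hder : ∀ d ∈ Metric.ball d₀ ε,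
      HasFDerivWithinAt (fun d => β (z₀, d) ![(u, 0), (v, 0)]) (0 : Y →L[ℝ] ℝ)
        (Metric.ball d₀ ε) d := by
    intro d hd
    obtain ⟨⟨h1, h2⟩, h3⟩ := h _ (hmem d hd)
    have g0 : DifferentiableAt ℝ (fun w => altToBilin (X × Y) (β w)) (z₀, d) :=
      ((contDiff_altToBilin (k := 1)).differentiable (by simp)).differentiableAt.comp (z₀, d) h1
    have g1 : DifferentiableAt ℝ (fun w => altToBilin (X × Y) (β w) (u, 0) (v, 0)) (z₀, d) :=
      (g0.clm_apply (differentiableAt_const _)).clm_apply (differentiableAt_const _)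
    have g2 := g1.hasFDerivAt.comp d (hasFDerivAt_prodMk_right (𝕜 := ℝ) z₀ d)
    refine (g2.congr_fderiv ?_).hasFDerivWithinAt
    ext η
    exact closed_form_fderiv_eq_zero h1 h2 (h3.mono fun w hw => hw η) _ _
  exact (convex_ball d₀ ε).is_const_of_fderivWithin_eq_zero (𝕜 := ℝ)
    (fun d hd => (hder d hd).differentiableWithinAt)
    (fun d hd => (hder d hd).fderivWithin (Metric.isOpen_ball.uniqueDiffWithinAt hd))
    hd (Metric.mem_ball_self hε)

/-! ### Existence of the reduced symplectic form -/

section ReducedForm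

variable {n nρ k m r : ℕ} {S Sρ P : Type*}
  [TopologicalSpace S] [SmoothManifold n S]
  [TopologicalSpace Sρ] [SmoothManifold nρ Sρ]
  [TopologicalSpace P] [SmoothManifold k P]
  {Ω : SymplecticForm n S} {Ωρ : SymplecticForm nρ Sρ} {J : S → P} {ρ : Sρ → P}

theorem LeafStep.exists_curve {a b : J.Pullback ρ} (h : LeafStep (k := k) Ω Ωρ J ρ a b) :
    ∃ (f : SmoothFn k P) (γ : ℝ → S) (δ : ℝ → Sρ) (c : ℝ → J.Pullback ρ),
      IsMIntegralCurveOn (I := 𝓡 n) γ (fun x => Ω.hamVec (f ∘ J) x) (Icc 0 1) ∧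
      IsMIntegralCurveOn (I := 𝓡 nρ) δ (fun y => -Ωρ.hamVec (f ∘ ρ) y) (Icc 0 1) ∧
      (∀ t ∈ Icc (0 : ℝ) 1, (c t).1 = (γ t, δ t)) ∧ c 0 = a ∧ c 1 = b ∧
      ContinuousOn c (Icc 0 1) := by
  classical
  obtain ⟨f, γ, δ, hγ, hδ, hJ, h1, h2, h3, h4⟩ := h
  let c : ℝ → J.Pullback ρ := fun t => if h : J (γ t) = ρ (δ t) then ⟨(γ t, δ t), h⟩ else a
  have hc : ∀ t ∈ Icc (0 : ℝ) 1, (c t).1 = (γ t, δ t) := fun t ht => by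
    simp only [c, dif_pos (hJ t ht)]
  refine ⟨f, γ, δ, c, hγ, hδ, hc, Subtype.ext ((hc 0 (by simp)).trans (Prod.ext h1 h2)),
    Subtype.ext ((hc 1 (by simp)).trans (Prod.ext h3 h4)), ?_⟩
  refine (IsImmersedPullback.isInducing_val (J := J) (ρ := ρ)).continuousOn_iff.2 ?_
  exact (hγ.continuousOn.prodMk hδ.continuousOn).congr hc

variable [SmoothManifold m (J.Pullback ρ)] [SmoothManifold r (LeafSpace (k := k) Ω Ωρ J ρ)]

namespace IsManifoldReduction

/-- A lift of the submersion gives a map K(z, d) onto a neighbourhood of q₀, with z a coordinate of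
the leaf space and d a parameter in the fibre. The pull-back of the product form along K is closed
and annihilates the d-directions, so its values on z-directions do not depend on d. -/
theorem productForm_locally_invariant (h : IsManifoldReduction (k := k) Ω Ωρ J ρ m r)
    (hJ : ContMDiff (𝓡 n) (𝓡 k) ∞ J) (hρ : ContMDiff (𝓡 nρ) (𝓡 k) ∞ ρ) (q₀ : J.Pullback ρ) :
    ∀ᶠ q in 𝓝 q₀, toLeaf (k := k) Ω Ωρ J ρ q = toLeaf (k := k) Ω Ωρ J ρ q₀ →
      ∀ (a b : TangentSpace (𝓡 m) q) (a₀ b₀ : TangentSpace (𝓡 m) q₀),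
      (mfderiv (𝓡 m) (𝓡 r) (toLeaf (k := k) Ω Ωρ J ρ) q a : EuclideanSpace ℝ (Fin r)) =
        mfderiv (𝓡 m) (𝓡 r) (toLeaf (k := k) Ω Ωρ J ρ) q₀ a₀ →
      (mfderiv (𝓡 m) (𝓡 r) (toLeaf (k := k) Ω Ωρ J ρ) q b : EuclideanSpace ℝ (Fin r)) =
        mfderiv (𝓡 m) (𝓡 r) (toLeaf (k := k) Ω Ωρ J ρ) q₀ b₀ →
      productForm Ω Ωρ J ρ m q ![a, b] = productForm Ω Ωρ J ρ m q₀ ![a₀, b₀] := by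
  set p := toLeaf (k := k) Ω Ωρ J ρ with hp
  obtain ⟨L, hL1, hL2⟩ := exists_submersion_lift (I := 𝓡 m) (I' := 𝓡 r) (f := p) (q := q₀)
    (Eventually.of_forall fun x => h.smooth_proj x) (h.submersion q₀)
  set ψ := extChartAt (𝓡 r) (p q₀) with hψ
  set φ := extChartAt (𝓡 m) q₀ with hφ
  set z₀ := ψ (p q₀) with hz₀
  set d₀ := φ q₀ with hd₀
  let j : EuclideanSpace ℝ (Fin r) × EuclideanSpace ℝ (Fin m) →
    LeafSpace (k := k) Ω Ωρ J ρ × J.Pullback ρ := fun w => (ψ.symm w.1, φ.symm w.2)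
  let K : EuclideanSpace ℝ (Fin r) × EuclideanSpace ℝ (Fin m) → J.Pullback ρ := fun w => L (j w)
  have hψs : ψ.symm z₀ = p q₀ := extChartAt_to_inv _
  have hφs : φ.symm d₀ = q₀ := extChartAt_to_inv _
  have hj0 : j (z₀, d₀) = (p q₀, q₀) := Prod.ext hψs hφs
  have hψn : ∀ᶠ z in 𝓝 z₀, ContMDiffAt 𝓘(ℝ, EuclideanSpace ℝ (Fin r)) (𝓡 r) ∞ ψ.symm z := by
    filter_upwards [(extChartAt_target_mem_nhds (I := 𝓡 r) (p q₀)),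
      eventually_mem_nhds_iff.2 (extChartAt_target_mem_nhds (I := 𝓡 r) (p q₀))] with z hz hz'
    exact (contMDiffOn_extChartAt_symm (p q₀)).contMDiffAt hz'
  have hφn : ∀ᶠ z in 𝓝 d₀, ContMDiffAt 𝓘(ℝ, EuclideanSpace ℝ (Fin m)) (𝓡 m) ∞ φ.symm z := by
    filter_upwards [(extChartAt_target_mem_nhds (I := 𝓡 m) q₀),
      eventually_mem_nhds_iff.2 (extChartAt_target_mem_nhds (I := 𝓡 m) q₀)] with z hz hz'
    exact (contMDiffOn_extChartAt_symm q₀).contMDiffAt hz'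
  let E := EuclideanSpace ℝ (Fin r) × EuclideanSpace ℝ (Fin m)
  have hψn' : ∀ᶠ w in 𝓝 ((z₀, d₀) : E),
      ContMDiffAt 𝓘(ℝ, EuclideanSpace ℝ (Fin r)) (𝓡 r) ∞ ψ.symm w.1 :=
    (continuous_fst.tendsto _).eventually hψn
  have hφn' : ∀ᶠ w in 𝓝 ((z₀, d₀) : E),
      ContMDiffAt 𝓘(ℝ, EuclideanSpace ℝ (Fin m)) (𝓡 m) ∞ φ.symm w.2 :=
    (continuous_snd.tendsto _).eventually hφn
  have hjn : ∀ᶠ w in 𝓝 ((z₀, d₀) : E), ContMDiffAt 𝓘(ℝ, E) ((𝓡 r).prod (𝓡 m)) ∞ j w := by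
    filter_upwards [hψn', hφn'] with w h1 h2
    exact (h1.comp w contDiff_fst.contMDiff.contMDiffAt).prodMk
      (h2.comp w contDiff_snd.contMDiff.contMDiffAt)
  have hLj : ∀ᶠ w in 𝓝 ((z₀, d₀) : E),
      ContMDiffAt ((𝓡 r).prod (𝓡 m)) (𝓡 m) ∞ L (j w) ∧ p (L (j w)) = (j w).1 := by
    have h1 := hjn.self_of_nhds.continuousAt
    refine h1.eventually (p := fun z => ContMDiffAt ((𝓡 r).prod (𝓡 m)) (𝓡 m) ∞ L z ∧ p (L z) = z.1) ?_
    rw [hj0]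
    exact hL1
  have hK : ∀ᶠ w in 𝓝 ((z₀, d₀) : E), ContMDiffAt 𝓘(ℝ, E) (𝓡 m) ∞ K w := by
    filter_upwards [hjn, hLj] with w h1 h2
    exact h2.1.comp w h1
  let Kd : E → E →L[ℝ] EuclideanSpace ℝ (Fin m) := fun w => mfderiv 𝓘(ℝ, E) (𝓡 m) K w
  let pd : J.Pullback ρ → EuclideanSpace ℝ (Fin m) →L[ℝ] EuclideanSpace ℝ (Fin r) := fun q =>
    mfderiv (𝓡 m) (𝓡 r) p q
  let ψd : EuclideanSpace ℝ (Fin r) → EuclideanSpace ℝ (Fin r) →L[ℝ] EuclideanSpace ℝ (Fin r) :=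
    fun z => mfderiv 𝓘(ℝ, EuclideanSpace ℝ (Fin r)) (𝓡 r) ψ.symm z
  have hpK : ∀ᶠ w in 𝓝 ((z₀, d₀) : E), ∀ u, pd (K w) (Kd w u) = ψd w.1 u.1 := by
    filter_upwards [hK, hLj.eventually_nhds, hψn']
      with w h1 h2 h3 u
    have e1 : HasMFDerivAt 𝓘(ℝ, E) (𝓡 r) (p ∘ K) w _ :=
      (h.hasMFDerivAt_proj (K w)).comp w (h1.mdifferentiableAt (by simp)).hasMFDerivAt
    have e2 : HasMFDerivAt 𝓘(ℝ, E) (𝓡 r) (ψ.symm ∘ Prod.fst) w _ :=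
      (h3.mdifferentiableAt (by simp)).hasMFDerivAt.comp w
        (hasFDerivAt_fst (𝕜 := ℝ) (p := w)).hasMFDerivAt
    have e3 := e2.congr_of_eventuallyEq (h2.mono fun w hw => hw.2)
    have e4 := hasMFDerivAt_unique e1 e3
    exact congrArg (fun l : E →L[ℝ] EuclideanSpace ℝ (Fin r) => l u) e4
  let β := (productForm Ω Ωρ J ρ m).pullback K
  have hβ : ∀ᶠ w in 𝓝 ((z₀, d₀) : E), DifferentiableAt ℝ β w ∧ extDeriv β w = 0 := by
    filter_upwards [hK.eventually_nhds] with w hw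
    have := h.immersed.productForm_pullback_contDiffAt_and_closed (Ω := Ω) (Ωρ := Ωρ) hw
    exact ⟨this.1.differentiableAt (by simp), this.2⟩
  have hβ0 : ∀ᶠ w in 𝓝 ((z₀, d₀) : E), ∀ η v, β w ![(0, η), v] = 0 := by
    filter_upwards [hpK] with w hw η v
    refine (TwoForm.pullback_apply _ K w _ _).trans ?_
    refine (productForm_swap _ _ _).trans (neg_eq_zero.2 ?_)
    refine (h.productForm_ker_iff hJ hρ (K w) _).2 ?_ _
    exact (hw (0, η)).trans (map_zero _)
  obtain ⟨ε, hε, hball⟩ := Metric.eventually_nhds_iff_ball.1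
    ((hpK.and hβ).and hβ0.eventually_nhds)
  have hmem : ∀ d ∈ Metric.ball d₀ ε, ((z₀, d) : E) ∈ Metric.ball ((z₀, d₀) : E) ε := by
    intro d hd
    rw [← ball_prod_same]
    exact ⟨Metric.mem_ball_self hε, hd⟩
  have hconst : ∀ u v, ∀ d ∈ Metric.ball d₀ ε, β (z₀, d) ![(u, 0), (v, 0)] =
      β (z₀, d₀) ![(u, 0), (v, 0)] := by
    intro u v d hd
    exact closed_form_const_on_fiber (fun w hw => ⟨(hball w hw).1.2, (hball w hw).2⟩) u v hd
  -- The vectors a, b may be replaced by the images under K of (u, 0), (v, 0), which have the same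
  -- projection.
  have hval : ∀ d ∈ Metric.ball d₀ ε, ∀ q, K (z₀, d) = q → ∀ (a b : TangentSpace (𝓡 m) q) u v,
      pd q a = u → pd q b = v →
      productForm Ω Ωρ J ρ m q ![a, b] = β (z₀, d₀) ![(u, 0), (v, 0)] := by
    rintro d hd q rfl a b u v ha hb
    rw [← hconst u v d hd]
    refine Eq.trans ?_ (TwoForm.pullback_apply _ K _ _ _).symm
    have hψd : ∀ u, ψd z₀ u = u := fun u =>
      congrArg (fun l : EuclideanSpace ℝ (Fin r) →L[ℝ] EuclideanSpace ℝ (Fin r) => l u)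
        (hasMFDerivAt_extChartAt_symm_self (I := 𝓡 r) (p q₀)).mfderiv
    have hw := (hball _ (hmem d hd)).1.1
    exact h.productForm_congr hJ hρ (ha.trans ((hw (u, 0)).trans (hψd u)).symm)
      (hb.trans ((hw (v, 0)).trans (hψd v)).symm)
  have hK0 : K (z₀, d₀) = q₀ := by
    change L (j (z₀, d₀)) = q₀
    rw [hj0]
    exact hL2.self_of_nhds
  have hφc : ContinuousAt φ q₀ := continuousAt_extChartAt q₀
  filter_upwards [hL2, hφc.eventually (Metric.ball_mem_nhds d₀ hε),
    extChartAt_source_mem_nhds (I := 𝓡 m) q₀] with q h1 h2 h3 hpq a b a₀ b₀ ha hb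
  refine (hval (φ q) h2 q ?_ a b _ _ ha hb).trans
    (hval d₀ (Metric.mem_ball_self hε) q₀ hK0 a₀ b₀ _ _ rfl rfl).symm
  change L (ψ.symm z₀, φ.symm (φ q)) = q
  rw [hψs, φ.left_inv h3, ← hpq]
  exact h1

/-- Local invariance is chained along the leaf curves by connectedness of the unit interval. -/
theorem productForm_invariant (h : IsManifoldReduction (k := k) Ω Ωρ J ρ m r)
    (hJ : ContMDiff (𝓡 n) (𝓡 k) ∞ J) (hρ : ContMDiff (𝓡 nρ) (𝓡 k) ∞ ρ) {q q' : J.Pullback ρ}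
    (hq : toLeaf (k := k) Ω Ωρ J ρ q = toLeaf (k := k) Ω Ωρ J ρ q')
    {a b : TangentSpace (𝓡 m) q} {a' b' : TangentSpace (𝓡 m) q'}
    (ha : (mfderiv (𝓡 m) (𝓡 r) (toLeaf (k := k) Ω Ωρ J ρ) q a : EuclideanSpace ℝ (Fin r)) =
        mfderiv (𝓡 m) (𝓡 r) (toLeaf (k := k) Ω Ωρ J ρ) q' a')
    (hb : (mfderiv (𝓡 m) (𝓡 r) (toLeaf (k := k) Ω Ωρ J ρ) q b : EuclideanSpace ℝ (Fin r)) =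
        mfderiv (𝓡 m) (𝓡 r) (toLeaf (k := k) Ω Ωρ J ρ) q' b') :
    productForm Ω Ωρ J ρ m q ![a, b] = productForm Ω Ωρ J ρ m q' ![a', b'] := by
  let l : (q : J.Pullback ρ) → EuclideanSpace ℝ (Fin r) → TangentSpace (𝓡 m) q := fun q =>
    surjInv (h.submersion q)
  have hl : ∀ q u, mfderiv (𝓡 m) (𝓡 r) (toLeaf (k := k) Ω Ωρ J ρ) q (l q u) = u := fun q u =>
    surjInv_eq (h.submersion q) u
  let u : EuclideanSpace ℝ (Fin r) := mfderiv (𝓡 m) (𝓡 r) (toLeaf (k := k) Ω Ωρ J ρ) q a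
  let v : EuclideanSpace ℝ (Fin r) := mfderiv (𝓡 m) (𝓡 r) (toLeaf (k := k) Ω Ωρ J ρ) q b
  -- The vectors u, v of the model space are fixed while q moves. The lifts l need not be continuous
  -- in q, since only their projections matter.
  let g : J.Pullback ρ → ℝ := fun q => productForm Ω Ωρ J ρ m q ![l q u, l q v]
  have hg : g q = g q' := by
    refine leaf_induction (k := k) (Ω := Ω) (Ωρ := Ωρ) ?_ hq
    intro c₀ c₁ hstep
    obtain ⟨f, γ, δ, c, hγ, hδ, hc, rfl, rfl, hcont⟩ := hstep.exists_curve
    refine eq_of_locally_constant_Icc (f := g ∘ c) fun t ht => ?_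
    have h1 := (hcont t ht).eventually (h.productForm_locally_invariant hJ hρ (c t))
    filter_upwards [h1, self_mem_nhdsWithin] with t' h2 ht'
    refine h2 ?_ _ _ _ _ ((hl _ u).trans (hl _ u).symm) ((hl _ v).trans (hl _ v).symm)
    exact h.immersed.constant_along_curve h.smooth_proj
      (fun q a h1 h2 => (h.vertical_iff q a).2 ⟨f, h1, h2⟩) (convex_Icc 0 1) hγ hδ
      (fun t ht => by
        have h3 := (c t).2
        rw [hc t ht] at h3
        exact h3) ht' ht (hc t' ht') (hc t ht)
  have e1 : productForm Ω Ωρ J ρ m q ![a, b] = g q :=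
    h.productForm_congr hJ hρ (hl q u).symm (hl q v).symm
  have e2 : productForm Ω Ωρ J ρ m q' ![a', b'] = g q' :=
    h.productForm_congr hJ hρ (ha.symm.trans (hl q' u).symm) (hb.symm.trans (hl q' v).symm)
  rw [e1, e2, hg]

/-- The value at y is computed at any point over y with any lifts of the vectors; invariance makes
it independent of the choices. Locally the form is the pull-back of the product form along a smooth
section, hence smooth and closed. It is non-degenerate because the kernel upstairs is exactly
vertical. -/
theorem exists_reducedForm (h : IsManifoldReduction (k := k) Ω Ωρ J ρ m r)
    (hJ : ContMDiff (𝓡 n) (𝓡 k) ∞ J) (hρ : ContMDiff (𝓡 nρ) (𝓡 k) ∞ ρ) :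
    ∃ ΩR : SymplecticForm r (LeafSpace (k := k) Ω Ωρ J ρ),
      PullsBackToProduct Ω Ωρ J ρ m ΩR (toLeaf (k := k) Ω Ωρ J ρ) := by
  set p := toLeaf (k := k) Ω Ωρ J ρ with hp
  let pd : J.Pullback ρ → EuclideanSpace ℝ (Fin m) →L[ℝ] EuclideanSpace ℝ (Fin r) := fun q =>
    mfderiv (𝓡 m) (𝓡 r) p q
  have hs : ∀ q, ∃ s : EuclideanSpace ℝ (Fin r) →ₗ[ℝ] EuclideanSpace ℝ (Fin m),
      ∀ u, pd q (s u) = u := by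
    intro q
    obtain ⟨s, hs⟩ := (pd q).toLinearMap.exists_rightInverse_of_surjective
      (LinearMap.range_eq_top.2 (h.submersion q))
    exact ⟨s, fun u => LinearMap.congr_fun hs u⟩
  choose s hs using hs
  let c : LeafSpace (k := k) Ω Ωρ J ρ → J.Pullback ρ := surjInv toLeaf_surjective
  have hc : ∀ y, p (c y) = y := surjInv_eq toLeaf_surjective
  let B : J.Pullback ρ → EuclideanSpace ℝ (Fin m) [⋀^Fin 2]→L[ℝ] ℝ := productForm Ω Ωρ J ρ m
  let α : LeafSpace (k := k) Ω Ωρ J ρ → EuclideanSpace ℝ (Fin r) [⋀^Fin 2]→L[ℝ] ℝ := fun y =>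
    (B (c y)).compContinuousLinearMap (LinearMap.toContinuousLinearMap (s (c y)))
  have hα : ∀ q a b, α (p q) ![pd q a, pd q b] = B q ![a, b] := by
    intro q a b
    refine (alt_comp_apply (B (c (p q))) _ _ _).trans ?_
    exact h.productForm_invariant hJ hρ (hc (p q)) (hs _ _) (hs _ _)
  have hchart : ∀ e ∈ atlas (EuclideanSpace ℝ (Fin r)) (LeafSpace (k := k) Ω Ωρ J ρ),
      ∀ y ∈ e.target, ContDiffAt ℝ ∞ (TwoForm.inChart α e) y ∧
        extDeriv (TwoForm.inChart α e) y = 0 := by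
    intro e he y hy
    obtain ⟨q₀, hq₀⟩ : ∃ q, p q = e.symm y := toLeaf_surjective _
    obtain ⟨κ, -, hκ⟩ := exists_local_section (I := 𝓡 m) (I' := 𝓡 r) (f := p) (q := q₀)
      (Eventually.of_forall fun x => h.smooth_proj x) (h.submersion q₀)
    rw [hq₀] at hκ
    have hes : ∀ z ∈ e.target, ContMDiffAt (𝓡 r) (𝓡 r) ∞ e.symm z := fun z hz =>
      contMDiffAt_symm_of_mem_maximalAtlas (IsManifold.subset_maximalAtlas he) hz
    have hF : ∀ᶠ z in 𝓝 y, ContMDiffAt (𝓡 r) (𝓡 m) ∞ (κ ∘ e.symm) z ∧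
        p (κ (e.symm z)) = e.symm z := by
      filter_upwards [e.open_target.mem_nhds hy, (hes y hy).continuousAt.eventually hκ]
        with z hz h1
      exact ⟨h1.1.comp z (hes z hz), h1.2⟩
    -- As p∘κ is the identity, κ∘e.symm is a lift of e.symm, so its differential provides admissible
    -- lifts of vectors.
    have heq : TwoForm.inChart α e =ᶠ[𝓝 y] (productForm Ω Ωρ J ρ m).pullback (κ ∘ e.symm) := by
      filter_upwards [hF.eventually_nhds] with z hz
      refine alt_ext fun u v => ?_
      refine (TwoForm.inChart_apply α e z u v).trans
        (Eq.trans ?_ (TwoForm.pullback_apply _ _ _ _ _).symm)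
      have e1 : HasMFDerivAt (𝓡 r) (𝓡 r) (p ∘ (κ ∘ e.symm)) z _ :=
        (h.hasMFDerivAt_proj _).comp z (hz.self_of_nhds.1.mdifferentiableAt (by simp)).hasMFDerivAt
      have e2 : HasMFDerivAt (𝓡 r) (𝓡 r) e.symm z _ :=
        e1.congr_of_eventuallyEq (hz.mono fun x hx => hx.2.symm)
      let D : EuclideanSpace ℝ (Fin r) →L[ℝ] EuclideanSpace ℝ (Fin r) := mfderiv (𝓡 r) (𝓡 r) e.symm z
      let K : EuclideanSpace ℝ (Fin r) →L[ℝ] EuclideanSpace ℝ (Fin m) :=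
        mfderiv (𝓡 r) (𝓡 m) (κ ∘ e.symm) z
      have e3 : ∀ w, D w = pd (κ (e.symm z)) (K w) := fun w =>
        congrArg (fun l : EuclideanSpace ℝ (Fin r) →L[ℝ] EuclideanSpace ℝ (Fin r) => l w) e2.mfderiv
      change α (e.symm z) ![D u, D v] = B (κ (e.symm z)) ![K u, K v]
      rw [← hα, ← e3, ← e3, hz.self_of_nhds.2]
    have hcl := h.immersed.productForm_pullback_contDiffAt_and_closed (Ω := Ω) (Ωρ := Ωρ)
      (hF.mono fun z hz => hz.1)
    exact ⟨hcl.1.congr_of_eventuallyEq heq, heq.extDeriv_eq.trans hcl.2⟩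
  refine ⟨⟨α, fun e he y hy => (hchart e he y hy).1.contDiffWithinAt,
    fun e he y hy => (hchart e he y hy).2, ?_⟩, fun q a b => (hα q a b).trans (productForm_apply q a b)⟩
  intro y u hu
  obtain ⟨q, rfl⟩ : ∃ q, p q = y := toLeaf_surjective y
  obtain ⟨a, rfl⟩ := h.submersion q u
  refine (h.productForm_ker_iff hJ hρ q a).1 fun b => ?_
  refine (productForm_swap _ _ _).trans (neg_eq_zero.2 ?_)
  exact (hα q a b).symm.trans (hu _)

end IsManifoldReduction

end ReducedForm

namespace SymplecticForm

variable {n : ℕ} {S : Type*} [TopologicalSpace S] [SmoothManifold n S]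

theorem hamVec_zero (Ω : SymplecticForm n S) (x : S) : Ω.hamVec (fun _ => 0) x = 0 := by
  symm
  refine Ω.eq_hamVec fun w => ?_
  rw [mfderiv_const]
  exact map_zero (Ω.bilin x w)

/-- The brackets are the derivatives of g along the image vector, and smooth functions on P separate
tangent vectors. This is how commuting functions turn into vectors tangent to fibres. -/
theorem mfderiv_hamVec_eq_zero (Ω : SymplecticForm n S) {k : ℕ} {P : Type*} [TopologicalSpace P]
    [SmoothManifold k P] {K : S → P} (hK : ContMDiff (𝓡 n) (𝓡 k) ∞ K) {F : S → ℝ} {x : S}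
    (h : ∀ g : SmoothFn k P, Ω.bracket F (g ∘ K) x = 0) :
    mfderiv (𝓡 n) (𝓡 k) K x (Ω.hamVec F x) = 0 := by
  refine tangent_eq_of_forall_smooth (I := 𝓡 k) fun g => ?_
  rw [map_zero]
  have h1 := (((g.contMDiff (K x)).mdifferentiableAt (by simp)).hasMFDerivAt.comp x
    ((hK x).mdifferentiableAt (by simp)).hasMFDerivAt).mfderiv
  have h2 := h g
  rw [bracket, h1] at h2
  exact h2

end SymplecticForm

/-! ### Functions, Hamiltonian vectors and Poisson maps on the reduced space -/

section Reduction

variable {n nρ k m r : ℕ} {S Sρ P : Type*}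
  [TopologicalSpace S] [SmoothManifold n S]
  [TopologicalSpace Sρ] [SmoothManifold nρ Sρ]
  [TopologicalSpace P] [SmoothManifold k P]
  {Ω : SymplecticForm n S} {Ωρ : SymplecticForm nρ Sρ} {J : S → P} {ρ : Sρ → P}
  [SmoothManifold m (J.Pullback ρ)] [SmoothManifold r (LeafSpace (k := k) Ω Ωρ J ρ)]

namespace IsImmersedPullback

variable {l : ℕ} {R : Type*} [TopologicalSpace R] [SmoothManifold l R] {p : J.Pullback ρ → R}

theorem mfderiv_of_comp_eq_add (hi : IsImmersedPullback n nρ J ρ m)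
    (hp : ContMDiff (𝓡 m) (𝓡 l) ∞ p) {F : R → ℝ} {f : S → ℝ} {g : Sρ → ℝ}
    (hF : ContMDiff (𝓡 l) 𝓘(ℝ, ℝ) ∞ F) (hf : ContMDiff (𝓡 n) 𝓘(ℝ, ℝ) ∞ f)
    (hg : ContMDiff (𝓡 nρ) 𝓘(ℝ, ℝ) ∞ g) (hFp : ∀ q, F (p q) = f q.fst + g q.snd)
    (q : J.Pullback ρ) (b : TangentSpace (𝓡 m) q) :
    mfderiv (𝓡 l) 𝓘(ℝ, ℝ) F (p q) (mfderiv (𝓡 m) (𝓡 l) p q b) =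
      HAdd.hAdd (α := ℝ) (β := ℝ) (γ := ℝ)
        (mfderiv (𝓡 n) 𝓘(ℝ, ℝ) f q.fst
          (mfderiv (𝓡 m) (𝓡 n) (Pullback.fst : J.Pullback ρ → S) q b))
        (mfderiv (𝓡 nρ) 𝓘(ℝ, ℝ) g q.snd
          (mfderiv (𝓡 m) (𝓡 nρ) (Pullback.snd : J.Pullback ρ → Sρ) q b)) := by
  have e1 : HasMFDerivAt (𝓡 m) 𝓘(ℝ, ℝ) (F ∘ p) q _ :=
    ((hF _).mdifferentiableAt (by simp)).hasMFDerivAt.comp q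
      ((hp q).mdifferentiableAt (by simp)).hasMFDerivAt
  have e2 : HasMFDerivAt (𝓡 m) 𝓘(ℝ, ℝ) (f ∘ (Pullback.fst : J.Pullback ρ → S)) q _ :=
    ((hf q.fst).mdifferentiableAt (by simp)).hasMFDerivAt.comp q (hi.hasMFDerivAt_fst q)
  have e3 : HasMFDerivAt (𝓡 m) 𝓘(ℝ, ℝ) (g ∘ (Pullback.snd : J.Pullback ρ → Sρ)) q _ :=
    ((hg q.snd).mdifferentiableAt (by simp)).hasMFDerivAt.comp q (hi.hasMFDerivAt_snd q)
  have e4 := e2.add e3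
  have e5 : F ∘ p = f ∘ (Pullback.fst : J.Pullback ρ → S) +
    g ∘ (Pullback.snd : J.Pullback ρ → Sρ) := funext hFp
  rw [← e5] at e4
  exact congrArg (fun l : EuclideanSpace ℝ (Fin m) →L[ℝ] ℝ => l b) (hasMFDerivAt_unique e1 e4)

/-- Vectors on R are images of vectors b upstairs; pairing with them turns the claim into dF(p b) =
df(b₁) + dg(b₂). The map p is arbitrary because, besides the projection to the leaf space, its
composition with `T` is needed. -/
theorem hamVec_of_comp_eq_add (hi : IsImmersedPullback n nρ J ρ m)
    (hp : ContMDiff (𝓡 m) (𝓡 l) ∞ p) (hs : ∀ q, Surjective (mfderiv (𝓡 m) (𝓡 l) p q))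
    {ΩR : SymplecticForm l R} (hR : PullsBackToProduct Ω Ωρ J ρ m ΩR p)
    {F : R → ℝ} {f : S → ℝ} {g : Sρ → ℝ}
    (hF : ContMDiff (𝓡 l) 𝓘(ℝ, ℝ) ∞ F) (hf : ContMDiff (𝓡 n) 𝓘(ℝ, ℝ) ∞ f)
    (hg : ContMDiff (𝓡 nρ) 𝓘(ℝ, ℝ) ∞ g) (hFp : ∀ q, F (p q) = f q.fst + g q.snd)
    (q : J.Pullback ρ) {a : TangentSpace (𝓡 m) q}
    (h1 : mfderiv (𝓡 m) (𝓡 n) (Pullback.fst : J.Pullback ρ → S) q a = Ω.hamVec f q.fst)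
    (h2 : mfderiv (𝓡 m) (𝓡 nρ) (Pullback.snd : J.Pullback ρ → Sρ) q a = Ωρ.hamVec g q.snd) :
    mfderiv (𝓡 m) (𝓡 l) p q a = ΩR.hamVec F (p q) := by
  refine ΩR.eq_hamVec fun w => ?_
  obtain ⟨b, rfl⟩ := hs q w
  rw [hR q b a, h1, h2, Ω.hamVec_spec, Ωρ.hamVec_spec]
  exact (hi.mfderiv_of_comp_eq_add hp hF hf hg hFp q b).symm

end IsImmersedPullback

namespace IsManifoldReduction

theorem exists_descent_fst (h : IsManifoldReduction (k := k) Ω Ωρ J ρ m r)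
    {E H N : Type*} [NormedAddCommGroup E] [NormedSpace ℝ E] [FiniteDimensional ℝ E]
    [TopologicalSpace H] {I : ModelWithCorners ℝ E H} [I.Boundaryless] [TopologicalSpace N]
    [ChartedSpace H N] [IsManifold I ∞ N] [T2Space N] {K : S → N} (hK : ContMDiff (𝓡 n) I ∞ K)
    (hker : ∀ (f : SmoothFn k P) (x : S), mfderiv (𝓡 n) I K x (Ω.hamVec (f ∘ J) x) = 0) :
    ∃ G : LeafSpace (k := k) Ω Ωρ J ρ → N, ContMDiff (𝓡 r) I ∞ G ∧
      ∀ q, G (toLeaf (k := k) Ω Ωρ J ρ q) = K q.fst := by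
  refine h.exists_descent (F := fun q => K q.fst) (hK.comp h.smooth_fst) fun f q a h1 h2 => ?_
  have e : mfderiv (𝓡 m) I (fun q : J.Pullback ρ => K q.fst) q = _ :=
    (((hK q.fst).mdifferentiableAt (by simp)).hasMFDerivAt.comp q
      (h.immersed.hasMFDerivAt_fst q)).mfderiv
  rw [e]
  exact (congrArg (mfderiv (𝓡 n) I K q.fst) h1).trans (hker f q.fst)

theorem exists_descent_snd (h : IsManifoldReduction (k := k) Ω Ωρ J ρ m r)
    {E H N : Type*} [NormedAddCommGroup E] [NormedSpace ℝ E] [FiniteDimensional ℝ E]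
    [TopologicalSpace H] {I : ModelWithCorners ℝ E H} [I.Boundaryless] [TopologicalSpace N]
    [ChartedSpace H N] [IsManifold I ∞ N] [T2Space N] {K : Sρ → N} (hK : ContMDiff (𝓡 nρ) I ∞ K)
    (hker : ∀ (f : SmoothFn k P) (x : Sρ), mfderiv (𝓡 nρ) I K x (Ωρ.hamVec (f ∘ ρ) x) = 0) :
    ∃ G : LeafSpace (k := k) Ω Ωρ J ρ → N, ContMDiff (𝓡 r) I ∞ G ∧
      ∀ q, G (toLeaf (k := k) Ω Ωρ J ρ q) = K q.snd := by
  refine h.exists_descent (F := fun q => K q.snd) (hK.comp h.smooth_snd) fun f q a h1 h2 => ?_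
  have e : mfderiv (𝓡 m) I (fun q : J.Pullback ρ => K q.snd) q = _ :=
    (((hK q.snd).mdifferentiableAt (by simp)).hasMFDerivAt.comp q
      (h.immersed.hasMFDerivAt_snd q)).mfderiv
  rw [e]
  refine (congrArg (mfderiv (𝓡 nρ) I K q.snd) h2).trans ?_
  rw [map_neg, hker f q.snd, neg_zero]

variable {ΩR : SymplecticForm r (LeafSpace (k := k) Ω Ωρ J ρ)}

theorem mfderiv_descended (h : IsManifoldReduction (k := k) Ω Ωρ J ρ m r)
    {F : LeafSpace (k := k) Ω Ωρ J ρ → ℝ} {f : S → ℝ} {g : Sρ → ℝ}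
    (hF : ContMDiff (𝓡 r) 𝓘(ℝ, ℝ) ∞ F) (hf : ContMDiff (𝓡 n) 𝓘(ℝ, ℝ) ∞ f)
    (hg : ContMDiff (𝓡 nρ) 𝓘(ℝ, ℝ) ∞ g)
    (hFp : ∀ q, F (toLeaf (k := k) Ω Ωρ J ρ q) = f q.fst + g q.snd) (q : J.Pullback ρ)
    (b : TangentSpace (𝓡 m) q) :
    mfderiv (𝓡 r) 𝓘(ℝ, ℝ) F (toLeaf (k := k) Ω Ωρ J ρ q)
        (mfderiv (𝓡 m) (𝓡 r) (toLeaf (k := k) Ω Ωρ J ρ) q b) =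
      HAdd.hAdd (α := ℝ) (β := ℝ) (γ := ℝ)
        (mfderiv (𝓡 n) 𝓘(ℝ, ℝ) f q.fst
          (mfderiv (𝓡 m) (𝓡 n) (Pullback.fst : J.Pullback ρ → S) q b))
        (mfderiv (𝓡 nρ) 𝓘(ℝ, ℝ) g q.snd
          (mfderiv (𝓡 m) (𝓡 nρ) (Pullback.snd : J.Pullback ρ → Sρ) q b)) :=
  h.immersed.mfderiv_of_comp_eq_add h.smooth_proj hF hf hg hFp q b

theorem hamVec_descended (h : IsManifoldReduction (k := k) Ω Ωρ J ρ m r)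
    (hR : PullsBackToProduct Ω Ωρ J ρ m ΩR (toLeaf (k := k) Ω Ωρ J ρ))
    {F : LeafSpace (k := k) Ω Ωρ J ρ → ℝ} {f : S → ℝ} {g : Sρ → ℝ}
    (hF : ContMDiff (𝓡 r) 𝓘(ℝ, ℝ) ∞ F) (hf : ContMDiff (𝓡 n) 𝓘(ℝ, ℝ) ∞ f)
    (hg : ContMDiff (𝓡 nρ) 𝓘(ℝ, ℝ) ∞ g)
    (hFp : ∀ q, F (toLeaf (k := k) Ω Ωρ J ρ q) = f q.fst + g q.snd) (q : J.Pullback ρ)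
    {a : TangentSpace (𝓡 m) q}
    (h1 : mfderiv (𝓡 m) (𝓡 n) (Pullback.fst : J.Pullback ρ → S) q a = Ω.hamVec f q.fst)
    (h2 : mfderiv (𝓡 m) (𝓡 nρ) (Pullback.snd : J.Pullback ρ → Sρ) q a = Ωρ.hamVec g q.snd) :
    mfderiv (𝓡 m) (𝓡 r) (toLeaf (k := k) Ω Ωρ J ρ) q a =
      ΩR.hamVec F (toLeaf (k := k) Ω Ωρ J ρ q) :=
  h.immersed.hamVec_of_comp_eq_add h.smooth_proj h.submersion hR hF hf hg hFp q h1 h2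

/-- The hypothesis `hfg` says that (X_f, X_g) is tangent to the fibre product; its projection is
then X_F, and the bracket is the derivative of G along it. -/
theorem bracket_descended (h : IsManifoldReduction (k := k) Ω Ωρ J ρ m r)
    (hR : PullsBackToProduct Ω Ωρ J ρ m ΩR (toLeaf (k := k) Ω Ωρ J ρ))
    {F G : LeafSpace (k := k) Ω Ωρ J ρ → ℝ} {f f' : S → ℝ} {g g' : Sρ → ℝ}
    (hF : ContMDiff (𝓡 r) 𝓘(ℝ, ℝ) ∞ F) (hf : ContMDiff (𝓡 n) 𝓘(ℝ, ℝ) ∞ f)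
    (hg : ContMDiff (𝓡 nρ) 𝓘(ℝ, ℝ) ∞ g)
    (hFp : ∀ q, F (toLeaf (k := k) Ω Ωρ J ρ q) = f q.fst + g q.snd)
    (hG : ContMDiff (𝓡 r) 𝓘(ℝ, ℝ) ∞ G) (hf' : ContMDiff (𝓡 n) 𝓘(ℝ, ℝ) ∞ f')
    (hg' : ContMDiff (𝓡 nρ) 𝓘(ℝ, ℝ) ∞ g')
    (hGp : ∀ q, G (toLeaf (k := k) Ω Ωρ J ρ q) = f' q.fst + g' q.snd) (q : J.Pullback ρ)
    (hfg : (mfderiv (𝓡 n) (𝓡 k) J q.fst (Ω.hamVec f q.fst) : EuclideanSpace ℝ (Fin k)) =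
      mfderiv (𝓡 nρ) (𝓡 k) ρ q.snd (Ωρ.hamVec g q.snd)) :
    ΩR.bracket F G (toLeaf (k := k) Ω Ωρ J ρ q) =
      Ω.bracket f f' q.fst + Ωρ.bracket g g' q.snd := by
  obtain ⟨a, h1, h2⟩ := (h.tangent_iff q _ _).2 hfg
  rw [SymplecticForm.bracket, ← h.hamVec_descended hR hF hf hg hFp q h1 h2]
  refine (h.mfderiv_descended hG hf' hg' hGp q a).trans ?_
  rw [h1, h2]
  rfl

theorem bracket_descended_fst (h : IsManifoldReduction (k := k) Ω Ωρ J ρ m r)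
    (hR : PullsBackToProduct Ω Ωρ J ρ m ΩR (toLeaf (k := k) Ω Ωρ J ρ))
    {F G : LeafSpace (k := k) Ω Ωρ J ρ → ℝ} {f f' : S → ℝ}
    (hF : ContMDiff (𝓡 r) 𝓘(ℝ, ℝ) ∞ F) (hf : ContMDiff (𝓡 n) 𝓘(ℝ, ℝ) ∞ f)
    (hFp : ∀ q, F (toLeaf (k := k) Ω Ωρ J ρ q) = f q.fst)
    (hG : ContMDiff (𝓡 r) 𝓘(ℝ, ℝ) ∞ G) (hf' : ContMDiff (𝓡 n) 𝓘(ℝ, ℝ) ∞ f')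
    (hGp : ∀ q, G (toLeaf (k := k) Ω Ωρ J ρ q) = f' q.fst) (q : J.Pullback ρ)
    (hfJ : mfderiv (𝓡 n) (𝓡 k) J q.fst (Ω.hamVec f q.fst) = 0) :
    ΩR.bracket F G (toLeaf (k := k) Ω Ωρ J ρ q) = Ω.bracket f f' q.fst := by
  have h0 : ContMDiff (𝓡 nρ) 𝓘(ℝ, ℝ) ∞ (fun _ : Sρ => (0 : ℝ)) := contMDiff_const
  rw [h.bracket_descended hR hF hf h0 (fun q => by rw [hFp, add_zero]) hG hf' h0
    (fun q => by rw [hGp, add_zero]) q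
    (by rw [hfJ, Ωρ.hamVec_zero]; exact (map_zero _).symm), Ωρ.bracket_eq_form,
    Ωρ.hamVec_zero, add_eq_left]
  exact map_zero (Ωρ.bilin q.snd 0)

theorem bracket_descended_snd (h : IsManifoldReduction (k := k) Ω Ωρ J ρ m r)
    (hR : PullsBackToProduct Ω Ωρ J ρ m ΩR (toLeaf (k := k) Ω Ωρ J ρ))
    {F G : LeafSpace (k := k) Ω Ωρ J ρ → ℝ} {g g' : Sρ → ℝ}
    (hF : ContMDiff (𝓡 r) 𝓘(ℝ, ℝ) ∞ F) (hg : ContMDiff (𝓡 nρ) 𝓘(ℝ, ℝ) ∞ g)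
    (hFp : ∀ q, F (toLeaf (k := k) Ω Ωρ J ρ q) = g q.snd)
    (hG : ContMDiff (𝓡 r) 𝓘(ℝ, ℝ) ∞ G) (hg' : ContMDiff (𝓡 nρ) 𝓘(ℝ, ℝ) ∞ g')
    (hGp : ∀ q, G (toLeaf (k := k) Ω Ωρ J ρ q) = g' q.snd) (q : J.Pullback ρ)
    (hgρ : mfderiv (𝓡 nρ) (𝓡 k) ρ q.snd (Ωρ.hamVec g q.snd) = 0) :
    ΩR.bracket F G (toLeaf (k := k) Ω Ωρ J ρ q) = Ωρ.bracket g g' q.snd := by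
  have h0 : ContMDiff (𝓡 n) 𝓘(ℝ, ℝ) ∞ (fun _ : S => (0 : ℝ)) := contMDiff_const
  rw [h.bracket_descended hR hF h0 hg (fun q => by rw [hFp, zero_add]) hG h0 hg'
    (fun q => by rw [hGp, zero_add]) q
    (by rw [hgρ, Ω.hamVec_zero]; exact map_zero _), Ω.bracket_eq_form,
    Ω.hamVec_zero, add_eq_right]
  exact map_zero (Ω.bilin q.fst 0)

theorem isPoissonMap_descended_fst (h : IsManifoldReduction (k := k) Ω Ωρ J ρ m r)
    (hR : PullsBackToProduct Ω Ωρ J ρ m ΩR (toLeaf (k := k) Ω Ωρ J ρ))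
    (hJ : ContMDiff (𝓡 n) (𝓡 k) ∞ J)
    {k₂ : ℕ} {P₂ : Type*} [TopologicalSpace P₂] [SmoothManifold k₂ P₂]
    {π₂ : PoissonStructure k₂ P₂} {K : S → P₂} {K' : LeafSpace (k := k) Ω Ωρ J ρ → P₂}
    (hK : IsPoissonMap Ω π₂ K) (hK' : ContMDiff (𝓡 r) (𝓡 k₂) ∞ K')
    (hp : ∀ q, K' (toLeaf (k := k) Ω Ωρ J ρ q) = K q.fst)
    (hcomm : ∀ (g : SmoothFn k₂ P₂) (f : SmoothFn k P) (x : S),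
      Ω.bracket (g ∘ K) (f ∘ J) x = 0) : IsPoissonMap ΩR π₂ K' := by
  refine ⟨hK', fun f g y => ?_⟩
  obtain ⟨q, rfl⟩ : ∃ q, toLeaf (k := k) Ω Ωρ J ρ q = y := toLeaf_surjective y
  rw [h.bracket_descended_fst hR (f.contMDiff.comp hK') (f.contMDiff.comp hK.1)
    (fun q => congrArg f (hp q)) (g.contMDiff.comp hK') (g.contMDiff.comp hK.1)
    (fun q => congrArg g (hp q)) q (Ω.mfderiv_hamVec_eq_zero hJ fun φ => hcomm f φ _), hK.2, hp]

theorem isPoissonMap_descended_snd (h : IsManifoldReduction (k := k) Ω Ωρ J ρ m r)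
    (hR : PullsBackToProduct Ω Ωρ J ρ m ΩR (toLeaf (k := k) Ω Ωρ J ρ))
    (hρ : ContMDiff (𝓡 nρ) (𝓡 k) ∞ ρ)
    {k₂ : ℕ} {P₂ : Type*} [TopologicalSpace P₂] [SmoothManifold k₂ P₂]
    {π₂ : PoissonStructure k₂ P₂} {K : Sρ → P₂} {K' : LeafSpace (k := k) Ω Ωρ J ρ → P₂}
    (hK : IsPoissonMap Ωρ π₂ K) (hK' : ContMDiff (𝓡 r) (𝓡 k₂) ∞ K')
    (hp : ∀ q, K' (toLeaf (k := k) Ω Ωρ J ρ q) = K q.snd)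
    (hcomm : ∀ (g : SmoothFn k₂ P₂) (f : SmoothFn k P) (x : Sρ),
      Ωρ.bracket (g ∘ K) (f ∘ ρ) x = 0) : IsPoissonMap ΩR π₂ K' := by
  refine ⟨hK', fun f g y => ?_⟩
  obtain ⟨q, rfl⟩ : ∃ q, toLeaf (k := k) Ω Ωρ J ρ q = y := toLeaf_surjective y
  rw [h.bracket_descended_snd hR (f.contMDiff.comp hK') (f.contMDiff.comp hK.1)
    (fun q => congrArg f (hp q)) (g.contMDiff.comp hK') (g.contMDiff.comp hK.1)
    (fun q => congrArg g (hp q)) q (Ωρ.mfderiv_hamVec_eq_zero hρ fun φ => hcomm f φ _), hK.2, hp]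

/-- The representation induced on the reduced space. -/
theorem exists_representation (h : IsManifoldReduction (k := k) Ω Ωρ J ρ m r)
    (hR : PullsBackToProduct Ω Ωρ J ρ m ΩR (toLeaf (k := k) Ω Ωρ J ρ))
    (hJ : ContMDiff (𝓡 n) (𝓡 k) ∞ J) {A : NonUnitalSubalgebra ℝ (SmoothFn n S)}
    (hAJ : ∀ f ∈ A, ∀ (g : SmoothFn k P) (x : S), Ω.bracket f (g ∘ J) x = 0) :
    ∃ φ : A →ₙₐ[ℝ] SmoothFn r (LeafSpace (k := k) Ω Ωρ J ρ),
      (∀ (f : A) (q : J.Pullback ρ), φ f (toLeaf (k := k) Ω Ωρ J ρ q) = f.1 q.fst) ∧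
      IsPoissonMorphism Ω ΩR φ := by
  have hex : ∀ f : A, ∃ G : SmoothFn r (LeafSpace (k := k) Ω Ωρ J ρ),
      ∀ q : J.Pullback ρ, G (toLeaf (k := k) Ω Ωρ J ρ q) = f.1 q.fst := by
    intro f
    obtain ⟨G, hG, hGp⟩ := h.exists_descent_fst (K := f.1) f.1.contMDiff (fun g x => by
      have h1 := hAJ f.1 f.2 g x
      rw [SymplecticForm.bracket_swap, neg_eq_zero] at h1
      exact h1)
    exact ⟨⟨G, hG⟩, hGp⟩
  choose G hG using hex
  have hext : ∀ F F' : SmoothFn r (LeafSpace (k := k) Ω Ωρ J ρ),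
      (∀ q : J.Pullback ρ, F (toLeaf (k := k) Ω Ωρ J ρ q) = F' (toLeaf (k := k) Ω Ωρ J ρ q)) →
      F = F' := fun F F' hF => ContMDiffMap.ext fun y => by
    obtain ⟨q, rfl⟩ : ∃ q, toLeaf (k := k) Ω Ωρ J ρ q = y := toLeaf_surjective y
    exact hF q
  let φ : A →ₙₐ[ℝ] SmoothFn r (LeafSpace (k := k) Ω Ωρ J ρ) :=
    { toFun := G
      map_smul' := fun c f => hext _ _ fun q => by
        rw [hG]
        exact (congrArg (c • ·) (hG f q)).symm
      map_zero' := hext _ _ fun q => by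
        rw [hG]
        rfl
      map_add' := fun f g => hext _ _ fun q => by
        rw [hG]
        exact (congrArg₂ (· + ·) (hG f q) (hG g q)).symm
      map_mul' := fun f g => hext _ _ fun q => by
        rw [hG]
        exact (congrArg₂ (· * ·) (hG f q) (hG g q)).symm }
  refine ⟨φ, hG, fun f g f' hf' y => ?_⟩
  obtain ⟨q, rfl⟩ : ∃ q, toLeaf (k := k) Ω Ωρ J ρ q = y := toLeaf_surjective y
  change G f' _ = _
  rw [hG, hf']
  exact (h.bracket_descended_fst hR (G f).contMDiff f.1.contMDiff (hG f) (G g).contMDiff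
    g.1.contMDiff (hG g) q (Ω.mfderiv_hamVec_eq_zero hJ fun ψ => hAJ f.1 f.2 ψ _)).symm

end IsManifoldReduction

end Reduction

/-! ### Calculus of tangent vectors with values in the model spaces -/

section TangentVectors

variable {E H M E' H' N E'' H'' X : Type*}
  [NormedAddCommGroup E] [NormedSpace ℝ E]
  [TopologicalSpace H] {I : ModelWithCorners ℝ E H} [TopologicalSpace M] [ChartedSpace H M]
  [NormedAddCommGroup E'] [NormedSpace ℝ E']
  [TopologicalSpace H'] {I' : ModelWithCorners ℝ E' H'} [TopologicalSpace N] [ChartedSpace H' N]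
  [NormedAddCommGroup E''] [NormedSpace ℝ E'']
  [TopologicalSpace H''] {I'' : ModelWithCorners ℝ E'' H''} [TopologicalSpace X]
  [ChartedSpace H'' X]

/-- The differential of `f` at `x` exists and sends the tangent vector `v` to `v'`. -/
structure MapsTangent (I : ModelWithCorners ℝ E H) (I' : ModelWithCorners ℝ E' H') (f : M → N)
    (x : M) (v : E) (v' : E') : Prop where
  diff : MDifferentiableAt I I' f x
  map : mfderiv I I' f x v = v'

theorem ContMDiffAt.mapsTangent {f : M → N} {x : M} (h : ContMDiffAt I I' ∞ f x) (v : E) :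
    MapsTangent I I' f x v (mfderiv I I' f x v) :=
  ⟨h.mdifferentiableAt (by simp), rfl⟩

namespace MapsTangent

variable {f : M → N} {x : M} {v w : E} {v' w' : E'}

theorem comp {g : N → X} {v'' : E''} (hg : MapsTangent I' I'' g (f x) v' v'')
    (hf : MapsTangent I I' f x v v') : MapsTangent I I'' (g ∘ f) x v v'' := by
  refine ⟨hg.diff.comp x hf.diff, ?_⟩
  rw [mfderiv_comp x hg.diff hf.diff]
  exact (congrArg (mfderiv I' I'' g (f x)) hf.map).trans hg.map

/-- Vectors live in the model spaces, so base points that agree only propositionally can be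
identified without transport. -/
theorem comp_of_eq {g : N → X} {v'' : E''} {y : N} (hg : MapsTangent I' I'' g y v' v'')
    (hf : MapsTangent I I' f x v v') (hy : f x = y) : MapsTangent I I'' (g ∘ f) x v v'' := by
  subst hy
  exact hg.comp hf

theorem prodMk {g : M → X} {v'' : E''} (hf : MapsTangent I I' f x v v')
    (hg : MapsTangent I I'' g x v v'') :
    MapsTangent I (I'.prod I'') (fun x => (f x, g x)) x v (v', v'') := by
  have h := hf.diff.hasMFDerivAt.prodMk hg.diff.hasMFDerivAt
  refine ⟨h.mdifferentiableAt, ?_⟩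
  rw [h.mfderiv]
  exact Prod.ext hf.map hg.map

theorem congr {g : M → N} (hf : MapsTangent I I' f x v v') (h : g =ᶠ[𝓝 x] f) :
    MapsTangent I I' g x v v' := by
  refine ⟨hf.diff.congr_of_eventuallyEq h, ?_⟩
  rw [(hf.diff.hasMFDerivAt.congr_of_eventuallyEq h).mfderiv]
  exact hf.map

theorem unique (hf : MapsTangent I I' f x v v') (hg : MapsTangent I I' f x v w') : v' = w' :=
  hf.map.symm.trans hg.map

theorem sub (hf : MapsTangent I I' f x v v') (hg : MapsTangent I I' f x w w') :
    MapsTangent I I' f x (v - w) (v' - w') := by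
  refine ⟨hf.diff, ?_⟩
  rw [← hf.map, ← hg.map]
  exact map_sub (mfderiv I I' f x) v w

theorem neg (hf : MapsTangent I I' f x v v') : MapsTangent I I' f x (-v) (-v') := by
  refine ⟨hf.diff, ?_⟩
  rw [← hf.map]
  exact map_neg (mfderiv I I' f x) v

theorem zero (hf : MDifferentiableAt I I' f x) : MapsTangent I I' f x 0 0 :=
  ⟨hf, map_zero (mfderiv I I' f x)⟩

theorem id : MapsTangent I I (fun x : M => x) x v v :=
  ⟨mdifferentiableAt_id, congrArg (fun l : E →L[ℝ] E => l v) (mfderiv_id (I := I) (x := x))⟩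

theorem fst {z : M × N} {a : E × E'} : MapsTangent (I.prod I') I Prod.fst z a a.1 :=
  ⟨mdifferentiableAt_fst, congrArg (fun l : E × E' →L[ℝ] E => l a) (mfderiv_fst (I := I) (I' := I'))⟩

theorem snd {z : M × N} {a : E × E'} : MapsTangent (I.prod I') I' Prod.snd z a a.2 :=
  ⟨mdifferentiableAt_snd, congrArg (fun l : E × E' →L[ℝ] E' => l a) (mfderiv_snd (I := I) (I' := I'))⟩

theorem curve {c : ℝ → M} {s : Set ℝ} {t : ℝ} (hf : MapsTangent I I' f (c t) v v')
    (hc : HasMFDerivWithinAt 𝓘(ℝ, ℝ) I c s t ((1 : ℝ →L[ℝ] ℝ).smulRight v)) :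
    HasMFDerivWithinAt 𝓘(ℝ, ℝ) I' (f ∘ c) s t ((1 : ℝ →L[ℝ] ℝ).smulRight v') := by
  have h := hf.diff.hasMFDerivAt.comp_hasMFDerivWithinAt t hc
  have e : (1 : ℝ →L[ℝ] ℝ).smulRight v' =
      (mfderiv I I' f (c t) : E →L[ℝ] E').comp ((1 : ℝ →L[ℝ] ℝ).smulRight v) := by
    refine ContinuousLinearMap.ext_ring ((one_smul ℝ v').trans ?_)
    refine hf.map.symm.trans ?_
    exact congrArg (mfderiv I I' f (c t)) (one_smul ℝ v).symm
  exact e.symm ▸ h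

end MapsTangent

end TangentVectors

/-! ### Uniqueness of integral curves on the closed unit interval -/

section IntegralCurves

variable {n : ℕ} {S : Type*} [TopologicalSpace S] [SmoothManifold n S]

/-- An integral curve on the unit interval agrees near a point of the interval with any local
integral curve through the same point. -/
theorem isMIntegralCurveOn_Icc_eventuallyEq {X : (x : S) → TangentSpace (𝓡 n) x}
    (hX : ContMDiff (𝓡 n) (𝓡 n).tangent ∞ (fun x => (⟨x, X x⟩ : TangentBundle (𝓡 n) S)))
    {δ η : ℝ → S} (hδ : IsMIntegralCurveOn (I := 𝓡 n) δ X (Icc 0 1)) {t₀ : ℝ}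
    (ht₀ : t₀ ∈ Icc (0 : ℝ) 1) (hη : IsMIntegralCurveAt (I := 𝓡 n) η X t₀) (h0 : η t₀ = δ t₀) :
    ∀ᶠ t in 𝓝[Icc 0 1] t₀, η t = δ t := by
  classical
  -- If t₀ is an end point, δ is an integral curve on one side only. Continued by η outside the
  -- interval it becomes a two-sided integral curve near t₀, to which uniqueness applies.
  let ζ : ℝ → S := fun t => if t ∈ Icc (0 : ℝ) 1 then δ t else η t
  have hζδ : ∀ t ∈ Icc (0 : ℝ) 1, ζ t = δ t := fun t ht => if_pos ht
  have hζη : ∀ t ∉ Icc (0 : ℝ) 1, ζ t = η t := fun t ht => if_neg ht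
  have hζ : IsMIntegralCurveAt (I := 𝓡 n) ζ X t₀ := by
    -- Near t₀ the two curves are glued at no parameter other than possibly t₀ itself.
    have hne : ∀ᶠ t in 𝓝 t₀, t ≠ t₀ → t ≠ 0 ∧ t ≠ 1 := by
      have h1 : ∀ a : ℝ, ∀ᶠ t in 𝓝 t₀, t ≠ t₀ → t ≠ a := by
        intro a
        by_cases ha : a = t₀
        · exact Eventually.of_forall fun t ht h => ht (h.trans ha)
        · filter_upwards [eventually_ne_nhds (Ne.symm ha)] with t ht _ using ht
      filter_upwards [h1 0, h1 1] with t h2 h3 h4 using ⟨h2 h4, h3 h4⟩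
    filter_upwards [hη, hne] with t ht htn
    by_cases hteq : t = t₀
    · subst hteq
      have e0 : ζ t = δ t := hζδ t ht₀
      have d1 : HasMFDerivWithinAt 𝓘(ℝ, ℝ) (𝓡 n) ζ (Icc 0 1) t
          ((1 : ℝ →L[ℝ] ℝ).smulRight (X (ζ t))) := by
        rw [e0]
        exact (hδ t ht₀).congr_of_eventuallyEq
          (eventually_of_mem self_mem_nhdsWithin hζδ) e0
      have d2 : HasMFDerivWithinAt 𝓘(ℝ, ℝ) (𝓡 n) ζ (Icc 0 1)ᶜ t
          ((1 : ℝ →L[ℝ] ℝ).smulRight (X (ζ t))) := by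
        rw [e0, ← h0]
        exact ht.hasMFDerivWithinAt.congr_of_eventuallyEq
          (eventually_of_mem self_mem_nhdsWithin hζη) (e0.trans h0.symm)
      have d3 := d1.union d2
      rw [union_compl_self] at d3
      exact hasMFDerivWithinAt_univ.1 d3
    · obtain ⟨hn0, hn1⟩ := htn hteq
      by_cases hti : t ∈ Icc (0 : ℝ) 1
      · have hn : Icc (0 : ℝ) 1 ∈ 𝓝 t :=
          Icc_mem_nhds (lt_of_le_of_ne hti.1 (Ne.symm hn0)) (lt_of_le_of_ne hti.2 hn1)
        rw [hζδ t hti]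
        exact ((hδ t hti).hasMFDerivAt hn).congr_of_eventuallyEq (eventually_of_mem hn hζδ)
      · have hn : (Icc (0 : ℝ) 1)ᶜ ∈ 𝓝 t := isClosed_Icc.isOpen_compl.mem_nhds hti
        rw [hζη t hti]
        exact ht.congr_of_eventuallyEq (eventually_of_mem hn hζη)
  have h1 := isMIntegralCurveAt_eventuallyEq_of_contMDiffAt_boundaryless
    ((hX (η t₀)).of_le (by simp)) hη hζ (h0.trans (hζδ t₀ ht₀).symm)
  filter_upwards [nhdsWithin_le_nhds h1, self_mem_nhdsWithin] with t h2 h3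
  exact h2.trans (hζδ t h3)

end IntegralCurves

/-! ### Transport of a smooth structure along a homeomorphism -/

section Transport

/-- A space homeomorphic to a manifold is a manifold, diffeomorphic to the given one. -/
theorem exists_smoothManifold_of_homeomorph {r : ℕ} {X R : Type*} [TopologicalSpace X]
    [TopologicalSpace R] [SmoothManifold r R] (e : X ≃ₜ R) :
    ∃ _ : SmoothManifold r X, ∃ Φ : X ≃ₘ⟮𝓡 r, 𝓡 r⟯ R, ∀ x, Φ x = e x := by
  let cs : ChartedSpace (EuclideanSpace ℝ (Fin r)) X :=
    { atlas := {c | ∃ d ∈ atlas (EuclideanSpace ℝ (Fin r)) R,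
        c = e.toOpenPartialHomeomorph.trans d}
      chartAt := fun x => e.toOpenPartialHomeomorph.trans (chartAt _ (e x))
      mem_chart_source := fun x => by simp
      chart_mem_atlas := fun x => ⟨_, chart_mem_atlas _ _, rfl⟩ }
  have hm : IsManifold (𝓡 r) ∞ X :=
    { compatible := by
        rintro _ _ ⟨c, hc, rfl⟩ ⟨d, hd, rfl⟩
        have h1 : (e.toOpenPartialHomeomorph.trans c).symm.trans
            (e.toOpenPartialHomeomorph.trans d) = c.symm.trans d := by
          refine OpenPartialHomeomorph.ext _ _ (fun x => by simp) (fun x => by simp) ?_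
          ext x
          simp
        rw [h1]
        exact (contDiffGroupoid ∞ (𝓡 r)).compatible hc hd }
  have h2 : T2Space X := e.symm.t2Space
  have h3 : SecondCountableTopology X := e.secondCountableTopology
  have hmem : ∀ y : R, e.toOpenPartialHomeomorph.trans (chartAt (EuclideanSpace ℝ (Fin r)) y) ∈
      IsManifold.maximalAtlas (𝓡 r) ∞ X := fun y =>
    IsManifold.subset_maximalAtlas ⟨_, chart_mem_atlas _ _, rfl⟩
  refine ⟨{ cs, hm, h2, h3 with }, ⟨e.toEquiv, ?_, ?_⟩, fun x => rfl⟩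
  · intro x
    set d := chartAt (EuclideanSpace ℝ (Fin r)) (e x) with hd
    have hx : e x ∈ d.source := mem_chart_source _ _
    have g1 : ContMDiffAt (𝓡 r) (𝓡 r) ∞ (e.toOpenPartialHomeomorph.trans d) x :=
      contMDiffAt_of_mem_maximalAtlas (hmem (e x)) (by simpa using hx)
    have g2 : ContMDiffAt (𝓡 r) (𝓡 r) ∞ d.symm (e.toOpenPartialHomeomorph.trans d x) :=
      contMDiffAt_symm_of_mem_maximalAtlas (IsManifold.chart_mem_maximalAtlas _) (d.map_source hx)
    refine (g2.comp x g1).congr_of_eventuallyEq ?_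
    filter_upwards [e.continuous.continuousAt.preimage_mem_nhds (d.open_source.mem_nhds hx)] with z hz
    exact (d.left_inv hz).symm
  · intro y
    set d := chartAt (EuclideanSpace ℝ (Fin r)) y with hd
    have hy : y ∈ d.source := mem_chart_source _ _
    have g1 : ContMDiffAt (𝓡 r) (𝓡 r) ∞ d y :=
      contMDiffAt_of_mem_maximalAtlas (IsManifold.chart_mem_maximalAtlas _) hy
    have g2 : ContMDiffAt (𝓡 r) (𝓡 r) ∞ (e.toOpenPartialHomeomorph.trans d).symm (d y) :=
      contMDiffAt_symm_of_mem_maximalAtlas (hmem y) (by simpa using d.map_source hy)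
    refine (g2.comp y g1).congr_of_eventuallyEq ?_
    filter_upwards [d.open_source.mem_nhds hy] with z hz
    exact congrArg e.symm (d.left_inv hz).symm

end Transport

/-! ### Tangent vectors and left inverses -/

section TangentVectors

variable {E H M E' H' N : Type*}
  [NormedAddCommGroup E] [NormedSpace ℝ E]
  [TopologicalSpace H] {I : ModelWithCorners ℝ E H} [TopologicalSpace M] [ChartedSpace H M]
  [NormedAddCommGroup E'] [NormedSpace ℝ E']
  [TopologicalSpace H'] {I' : ModelWithCorners ℝ E' H'} [TopologicalSpace N] [ChartedSpace H' N]

theorem MapsTangent.of_leftInverse {f : M → N} {g : N → M} {x : M} {v : E} {v' : E'}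
    (hf : MapsTangent I I' f x v v') (hg : MDifferentiableAt I' I g (f x))
    (hgf : ∀ᶠ x in 𝓝 x, g (f x) = x) : MapsTangent I' I g (f x) v' v := by
  have h1 : MapsTangent I' I g (f x) v' (mfderiv I' I g (f x) v') := ⟨hg, rfl⟩
  have h2 : MapsTangent I I (fun x : M => x) x v (mfderiv I' I g (f x) v') :=
    (h1.comp hf).congr (hgf.mono fun x hx => hx.symm)
  exact ⟨hg, h2.unique MapsTangent.id⟩

theorem ContMDiffAt.exists_mapsTangent {f : M → N} {x : M} (h : ContMDiffAt I I' ∞ f x) (v : E) :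
    ∃ v' : E', MapsTangent I I' f x v v' := ⟨_, h.mapsTangent v⟩

end TangentVectors

/-! ### Fibre products with the expected tangent spaces -/

section FiberProducts

variable {n nρ k m : ℕ} {S Sρ P : Type*}
  [TopologicalSpace S] [SmoothManifold n S]
  [TopologicalSpace Sρ] [SmoothManifold nρ Sρ]
  [TopologicalSpace P] [SmoothManifold k P]

/-- The fibre product is a submanifold with the expected tangent spaces. -/
structure IsSmoothPullback (n nρ k : ℕ) {S Sρ P : Type*} [TopologicalSpace S]
    [ChartedSpace (EuclideanSpace ℝ (Fin n)) S] [TopologicalSpace Sρ]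
    [ChartedSpace (EuclideanSpace ℝ (Fin nρ)) Sρ] [TopologicalSpace P]
    [ChartedSpace (EuclideanSpace ℝ (Fin k)) P] (J : S → P) (ρ : Sρ → P) (m : ℕ)
    [ChartedSpace (EuclideanSpace ℝ (Fin m)) (J.Pullback ρ)] : Prop extends
    IsImmersedPullback n nρ J ρ m where
  smooth_left : ContMDiff (𝓡 n) (𝓡 k) ∞ J
  smooth_right : ContMDiff (𝓡 nρ) (𝓡 k) ∞ ρ
  exists_lift : ∀ (q : J.Pullback ρ) (u : TangentSpace (𝓡 n) q.fst)
    (v : TangentSpace (𝓡 nρ) q.snd),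
    (mfderiv (𝓡 n) (𝓡 k) J q.fst u : EuclideanSpace ℝ (Fin k)) = mfderiv (𝓡 nρ) (𝓡 k) ρ q.snd v →
    ∃ a : TangentSpace (𝓡 m) q,
      mfderiv (𝓡 m) (𝓡 n) (Pullback.fst : J.Pullback ρ → S) q a = u ∧
      mfderiv (𝓡 m) (𝓡 nρ) (Pullback.snd : J.Pullback ρ → Sρ) q a = v

variable {J : S → P} {ρ : Sρ → P} [SmoothManifold m (J.Pullback ρ)]

/-- The tangent vector `a` of the fibre product has the components `u` and `v`. -/
structure HasComponents (n nρ : ℕ) {S Sρ P : Type*} [TopologicalSpace S]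
    [ChartedSpace (EuclideanSpace ℝ (Fin n)) S] [TopologicalSpace Sρ]
    [ChartedSpace (EuclideanSpace ℝ (Fin nρ)) Sρ] {J : S → P} {ρ : Sρ → P} {m : ℕ}
    [ChartedSpace (EuclideanSpace ℝ (Fin m)) (J.Pullback ρ)] (q : J.Pullback ρ)
    (a : EuclideanSpace ℝ (Fin m)) (u : EuclideanSpace ℝ (Fin n))
    (v : EuclideanSpace ℝ (Fin nρ)) : Prop where
  fst : MapsTangent (𝓡 m) (𝓡 n) (Pullback.fst : J.Pullback ρ → S) q a u
  snd : MapsTangent (𝓡 m) (𝓡 nρ) (Pullback.snd : J.Pullback ρ → Sρ) q a v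

namespace HasComponents

variable {q : J.Pullback ρ} {a b : EuclideanSpace ℝ (Fin m)} {u u' : EuclideanSpace ℝ (Fin n)}
  {v v' : EuclideanSpace ℝ (Fin nρ)}

theorem sub (h : HasComponents n nρ q a u v) (h' : HasComponents n nρ q b u' v') :
    HasComponents n nρ q (a - b) (u - u') (v - v') := ⟨h.fst.sub h'.fst, h.snd.sub h'.snd⟩

theorem neg (h : HasComponents n nρ q a u v) : HasComponents n nρ q (-a) (-u) (-v) :=
  ⟨h.fst.neg, h.snd.neg⟩

theorem val (h : HasComponents n nρ q a u v) :
    MapsTangent (𝓡 m) ((𝓡 n).prod (𝓡 nρ)) (Subtype.val : J.Pullback ρ → S × Sρ) q a (u, v) :=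
  h.fst.prodMk h.snd

theorem map_eq (ha : HasComponents n nρ q a u v) {w w' : EuclideanSpace ℝ (Fin k)}
    (hu : MapsTangent (𝓡 n) (𝓡 k) J q.fst u w) (hv : MapsTangent (𝓡 nρ) (𝓡 k) ρ q.snd v w') :
    w = w' := by
  have h1 : MapsTangent (𝓡 m) (𝓡 k) (fun q : J.Pullback ρ => J q.fst) q a w := hu.comp ha.fst
  have h2 : MapsTangent (𝓡 m) (𝓡 k) (fun q : J.Pullback ρ => ρ q.snd) q a w' := hv.comp ha.snd
  exact h1.unique (h2.congr (Eventually.of_forall fun q => q.2))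

end HasComponents

namespace IsImmersedPullback

theorem hasComponents (hi : IsImmersedPullback n nρ J ρ m) (q : J.Pullback ρ)
    (a : EuclideanSpace ℝ (Fin m)) :
    HasComponents n nρ q a (mfderiv (𝓡 m) (𝓡 n) (Pullback.fst : J.Pullback ρ → S) q a)
      (mfderiv (𝓡 m) (𝓡 nρ) (Pullback.snd : J.Pullback ρ → Sρ) q a) :=
  ⟨(hi.smooth_fst q).mapsTangent a, (hi.smooth_snd q).mapsTangent a⟩

/-- A smooth retraction of a neighbourhood of a point of the fibre product. -/
theorem exists_smooth_retraction (hi : IsImmersedPullback n nρ J ρ m) (q : J.Pullback ρ) :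
    ∃ R : S × Sρ → J.Pullback ρ,
      (∀ᶠ y in 𝓝 q.1, ContMDiffAt ((𝓡 n).prod (𝓡 nρ)) (𝓡 m) ∞ R y ∧
        ∀ h : J y.1 = ρ y.2, R y = ⟨y, h⟩) ∧
      ∀ a u v, HasComponents n nρ q a u v →
        MapsTangent ((𝓡 n).prod (𝓡 nρ)) (𝓡 m) R q.1 (u, v) a := by
  obtain ⟨R, h1, h2⟩ := hi.exists_retraction q
  have h3 : ∀ᶠ y in 𝓝 q.1, ∀ h : J y.1 = ρ y.2, R y = ⟨y, h⟩ := by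
    rw [nhds_subtype_eq_comap, eventually_comap] at h2
    exact h2.mono fun y hy h => hy ⟨y, h⟩ rfl
  refine ⟨R, h1.and h3, fun a u v ha => ?_⟩
  exact ha.val.of_leftInverse (h1.self_of_nhds.mdifferentiableAt (by simp)) h2

end IsImmersedPullback

namespace IsSmoothPullback

theorem exists_hasComponents (h : IsSmoothPullback n nρ k J ρ m) {q : J.Pullback ρ}
    {u : EuclideanSpace ℝ (Fin n)} {v : EuclideanSpace ℝ (Fin nρ)} {w : EuclideanSpace ℝ (Fin k)}
    (hu : MapsTangent (𝓡 n) (𝓡 k) J q.fst u w) (hv : MapsTangent (𝓡 nρ) (𝓡 k) ρ q.snd v w) :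
    ∃ a : EuclideanSpace ℝ (Fin m), HasComponents n nρ q a u v := by
  obtain ⟨a, h1, h2⟩ := h.exists_lift q u v (hu.map.trans hv.map.symm)
  refine ⟨a, ⟨?_, h1⟩, ⟨?_, h2⟩⟩
  · exact (h.smooth_fst q).mdifferentiableAt (by simp)
  · exact (h.smooth_snd q).mdifferentiableAt (by simp)

end IsSmoothPullback

variable {r : ℕ} {Ω : SymplecticForm n S} {Ωρ : SymplecticForm nρ Sρ}
  [SmoothManifold r (LeafSpace (k := k) Ω Ωρ J ρ)]

namespace IsManifoldReduction

theorem smoothPullback (h : IsManifoldReduction (k := k) Ω Ωρ J ρ m r)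
    (hJ : ContMDiff (𝓡 n) (𝓡 k) ∞ J) (hρ : ContMDiff (𝓡 nρ) (𝓡 k) ∞ ρ) :
    IsSmoothPullback n nρ k J ρ m :=
  { h.immersed with
    smooth_left := hJ
    smooth_right := hρ
    exists_lift := fun q u v huv => (h.tangent_iff q u v).2 huv }

end IsManifoldReduction

end FiberProducts

/-! ### A dimension count for fibre products of vector spaces -/

section LinearAlgebra

variable {A B C U Z V R X : Type*} [AddCommGroup A] [Module ℝ A] [FiniteDimensional ℝ A]
  [AddCommGroup B] [Module ℝ B] [FiniteDimensional ℝ B]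
  [AddCommGroup C] [Module ℝ C] [FiniteDimensional ℝ C]
  [AddCommGroup U] [Module ℝ U] [FiniteDimensional ℝ U] [AddCommGroup Z] [Module ℝ Z]
  [AddCommGroup V] [Module ℝ V] [AddCommGroup R] [Module ℝ R] [FiniteDimensional ℝ R]
  [AddCommGroup X] [Module ℝ X]

/-- The dimension of the image of a fibre product of vector spaces which also fibres over a third
space. -/
theorem finrank_of_common_cover {a₁ : A →ₗ[ℝ] X} {a₂ : A →ₗ[ℝ] V} {p : A →ₗ[ℝ] U}
    {b₁ : B →ₗ[ℝ] V} {b₂ : B →ₗ[ℝ] Z} {t : B →ₗ[ℝ] R} {c₁ : C →ₗ[ℝ] X} {c₂ : C →ₗ[ℝ] R}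
    {K : Submodule ℝ (U × Z)} (hp : Surjective p) (ht : Surjective t)
    (hK : ∀ x : U × Z, x ∈ K ↔ ∃ a b, a₂ a = b₁ b ∧ p a = x.1 ∧ b₂ b = x.2)
    (hC : ∀ c, ∃ a b, a₂ a = b₁ b ∧ a₁ a = c₁ c ∧ t b = c₂ c)
    (hC' : ∀ a b, a₂ a = b₁ b → ∃ c, a₁ a = c₁ c ∧ t b = c₂ c)
    (hA : ∀ a, a₁ a = 0 → a₂ a = 0 → a = 0) (hB : ∀ b, b₁ b = 0 → b₂ b = 0 → b = 0)
    (hCi : ∀ c, c₁ c = 0 → c₂ c = 0 → c = 0)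
    (hkp : ∀ a, p a = 0 → ∃ b, a₂ a = b₁ b ∧ b₂ b = 0)
    (hkt : ∀ b, t b = 0 → ∃ a, a₂ a = b₁ b ∧ a₁ a = 0) :
    Module.finrank ℝ K + Module.finrank ℝ A + Module.finrank ℝ R =
      Module.finrank ℝ C + Module.finrank ℝ B + Module.finrank ℝ U := by
  -- The common cover W = A ×_V B: it maps onto K with kernel isomorphic to ker p, and onto the
  -- image of C with kernel isomorphic to ker t. Both counts of dim W are compared.
  let W : Submodule ℝ (A × B) := LinearMap.eqLocus (a₂ ∘ₗ LinearMap.fst ℝ A B)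
    (b₁ ∘ₗ LinearMap.snd ℝ A B)
  have hW : ∀ a b, (a, b) ∈ W ↔ a₂ a = b₁ b := fun a b => Iff.rfl
  let f : W →ₗ[ℝ] U × Z := (p.prodMap b₂) ∘ₗ W.subtype
  let g : W →ₗ[ℝ] X × R := (a₁.prodMap t) ∘ₗ W.subtype
  let j : C →ₗ[ℝ] X × R := c₁.prod c₂
  have hf : LinearMap.range f = K := by
    ext x
    rw [hK, LinearMap.mem_range]
    constructor
    · rintro ⟨⟨⟨a, b⟩, hab⟩, rfl⟩
      exact ⟨a, b, hab, rfl, rfl⟩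
    · rintro ⟨a, b, hab, h1, h2⟩
      exact ⟨⟨(a, b), hab⟩, Prod.ext h1 h2⟩
  have hg : LinearMap.range g = LinearMap.range j := by
    ext x
    rw [LinearMap.mem_range, LinearMap.mem_range]
    constructor
    · rintro ⟨⟨⟨a, b⟩, hab⟩, rfl⟩
      obtain ⟨c, h1, h2⟩ := hC' a b hab
      exact ⟨c, Prod.ext h1.symm h2.symm⟩
    · rintro ⟨c, rfl⟩
      obtain ⟨a, b, hab, h1, h2⟩ := hC c
      exact ⟨⟨(a, b), hab⟩, Prod.ext h1 h2⟩
  have hj : Module.finrank ℝ (LinearMap.range j) = Module.finrank ℝ C :=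
    LinearMap.finrank_range_of_inj ((injective_iff_map_eq_zero j).2 fun c hc =>
      hCi c (congrArg Prod.fst hc) (congrArg Prod.snd hc))
  let φ : LinearMap.ker f →ₗ[ℝ] LinearMap.ker p :=
    ((LinearMap.fst ℝ A B ∘ₗ W.subtype) ∘ₗ (LinearMap.ker f).subtype).codRestrict _
      fun x => congrArg Prod.fst (LinearMap.mem_ker.1 x.2)
  have hφ : Bijective φ := by
    constructor
    · rintro ⟨⟨⟨a, b⟩, hab⟩, hk⟩ ⟨⟨⟨a', b'⟩, hab'⟩, hk'⟩ h0
      have ha : a = a' := congrArg Subtype.val h0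
      subst ha
      have h1 : a₂ a = b₁ b := hab
      have h2 : a₂ a = b₁ b' := hab'
      have h3 : b₂ b = 0 := congrArg Prod.snd (LinearMap.mem_ker.1 hk)
      have h4 : b₂ b' = 0 := congrArg Prod.snd (LinearMap.mem_ker.1 hk')
      have hb : b = b' := sub_eq_zero.1 (hB _ (by rw [map_sub, ← h1, ← h2, sub_self])
        (by rw [map_sub, h3, h4, sub_self]))
      subst hb
      rfl
    · rintro ⟨a, ha⟩
      obtain ⟨b, hab, hb⟩ := hkp a ha
      exact ⟨⟨⟨(a, b), hab⟩, LinearMap.mem_ker.2 (Prod.ext ha hb)⟩, rfl⟩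
  let ψ : LinearMap.ker g →ₗ[ℝ] LinearMap.ker t :=
    ((LinearMap.snd ℝ A B ∘ₗ W.subtype) ∘ₗ (LinearMap.ker g).subtype).codRestrict _
      fun x => congrArg Prod.snd (LinearMap.mem_ker.1 x.2)
  have hψ : Bijective ψ := by
    constructor
    · rintro ⟨⟨⟨a, b⟩, hab⟩, hk⟩ ⟨⟨⟨a', b'⟩, hab'⟩, hk'⟩ h0
      have hb : b = b' := congrArg Subtype.val h0
      subst hb
      have h1 : a₂ a = b₁ b := hab
      have h2 : a₂ a' = b₁ b := hab'
      have h3 : a₁ a = 0 := congrArg Prod.fst (LinearMap.mem_ker.1 hk)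
      have h4 : a₁ a' = 0 := congrArg Prod.fst (LinearMap.mem_ker.1 hk')
      have ha : a = a' := sub_eq_zero.1 (hA _ (by rw [map_sub, h3, h4, sub_self])
        (by rw [map_sub, h1, h2, sub_self]))
      subst ha
      rfl
    · rintro ⟨b, hb⟩
      obtain ⟨a, hab, ha⟩ := hkt b hb
      exact ⟨⟨⟨(a, b), hab⟩, LinearMap.mem_ker.2 (Prod.ext ha hb)⟩, rfl⟩
  have e1 := LinearMap.finrank_range_add_finrank_ker f
  have e2 := LinearMap.finrank_range_add_finrank_ker g
  have e3 := (LinearEquiv.ofBijective φ hφ).finrank_eq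
  have e4 := (LinearEquiv.ofBijective ψ hψ).finrank_eq
  have e5 := LinearMap.finrank_range_add_finrank_ker p
  have e6 := LinearMap.finrank_range_add_finrank_ker t
  rw [LinearMap.range_eq_top.2 hp, finrank_top] at e5
  rw [LinearMap.range_eq_top.2 ht, finrank_top] at e6
  rw [hf] at e1
  rw [hg, hj] at e2
  omega

end LinearAlgebra

/-! ### Induction in stages: the data and local lifts -/

section Stages

variable {n nt nσ nρ k kt m₁ m' r' m r : ℕ} {S St Sσ Sρ P Pt : Type*}
  [TopologicalSpace S] [SmoothManifold n S] [TopologicalSpace St] [SmoothManifold nt St]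
  [TopologicalSpace Sσ] [SmoothManifold nσ Sσ] [TopologicalSpace Sρ] [SmoothManifold nρ Sρ]
  [TopologicalSpace P] [SmoothManifold k P] [TopologicalSpace Pt] [SmoothManifold kt Pt]
  {Ω : SymplecticForm n S} {Ωt : SymplecticForm nt St}
  {Ωσ : SymplecticForm nσ Sσ} {Ωρ : SymplecticForm nρ Sρ}
  {J : S → P} {ρ : Sρ → P} {Jt : St → Pt} {Jh : St → P} {σ : Sσ → Pt}
  [SmoothManifold m₁ (Jt.Pullback σ)]
  [SmoothManifold m' (J.Pullback Jh)] [SmoothManifold r' (LeafSpace (k := k) Ω Ωt J Jh)]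
  [SmoothManifold m (J.Pullback ρ)] [SmoothManifold r (LeafSpace (k := k) Ω Ωρ J ρ)]

/-- The data of an induction in stages: the map `τ` presents the symplectic manifold `Sρ` as the
reduction of the fibre product of `Jt` and `σ`, and `J'` is the map induced by `Jt` on the
reduction of the fibre product of `J` and `Jh`. -/
structure IsInductionInStages (kt m₁ m' m r : ℕ) (Ωσ : SymplecticForm nσ Sσ)
    (Ωρ : SymplecticForm nρ Sρ) (ρ : Sρ → P) {Pt : Type*} [TopologicalSpace Pt]
    [SmoothManifold kt Pt] (Jt : St → Pt) (σ : Sσ → Pt)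
    [SmoothManifold m₁ (Jt.Pullback σ)]
    [SmoothManifold m' (J.Pullback Jh)] [SmoothManifold r' (LeafSpace (k := k) Ω Ωt J Jh)]
    [SmoothManifold m (J.Pullback ρ)] [SmoothManifold r (LeafSpace (k := k) Ω Ωρ J ρ)]
    (τ : Jt.Pullback σ → Sρ) (Ω' : SymplecticForm r' (LeafSpace (k := k) Ω Ωt J Jh))
    (J' : LeafSpace (k := k) Ω Ωt J Jh → Pt) : Prop where
  total : IsSmoothPullback n nρ k J ρ m
  left : IsSmoothPullback n nt k J Jh m'
  right : IsSmoothPullback nt nσ kt Jt σ m₁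
  reduction : IsManifoldReduction (k := k) Ω Ωρ J ρ m r
  leftReduction : IsManifoldReduction (k := k) Ω Ωt J Jh m' r'
  smooth_map : ContMDiff (𝓡 r') (𝓡 kt) ∞ J'
  map_proj : ∀ q, J' (toLeaf (k := k) Ω Ωt J Jh q) = Jt q.snd
  smooth : ContMDiff (𝓡 m₁) (𝓡 nρ) ∞ τ
  submersion : ∀ d, Surjective (mfderiv (𝓡 m₁) (𝓡 nρ) τ d)
  surjective : Surjective τ
  momentum : ∀ d, ρ (τ d) = Jh d.fst
  eq_iff : ∀ d d', τ d = τ d' ↔ toLeaf (k := kt) Ωt Ωσ Jt σ d = toLeaf (k := kt) Ωt Ωσ Jt σ d'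
  vertical_iff : ∀ (d : Jt.Pullback σ) (δ : EuclideanSpace ℝ (Fin m₁)),
    MapsTangent (𝓡 m₁) (𝓡 nρ) τ d δ 0 ↔ ∃ g : SmoothFn kt Pt,
      HasComponents nt nσ d δ (Ωt.hamVec (g ∘ Jt) d.fst) (-Ωσ.hamVec (g ∘ σ) d.snd)
  maps_hamVec : ∀ (f : SmoothFn k P) (d : Jt.Pullback σ) (δ : EuclideanSpace ℝ (Fin m₁)),
    HasComponents nt nσ d δ (Ωt.hamVec (f ∘ Jh) d.fst) 0 →
    MapsTangent (𝓡 m₁) (𝓡 nρ) τ d δ (Ωρ.hamVec (f ∘ ρ) (τ d))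
  left_commutes : ∀ (f : SmoothFn k P) (y : St),
    MapsTangent (𝓡 nt) (𝓡 kt) Jt y (Ωt.hamVec (f ∘ Jh) y) 0
  right_commutes : ∀ (g : SmoothFn kt Pt) (y : St),
    MapsTangent (𝓡 nt) (𝓡 k) Jh y (Ωt.hamVec (g ∘ Jt) y) 0
  proj_hamVec : ∀ (g : SmoothFn kt Pt) (q : J.Pullback Jh) (a : EuclideanSpace ℝ (Fin m')),
    HasComponents n nt q a 0 (Ωt.hamVec (g ∘ Jt) q.snd) →
    MapsTangent (𝓡 m') (𝓡 r') (toLeaf (k := k) Ω Ωt J Jh) q a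
      (Ω'.hamVec (g ∘ J') (toLeaf (k := k) Ω Ωt J Jh q))

theorem IsManifoldReduction.mapsTangent_zero_iff {q : J.Pullback ρ}
    (h : IsManifoldReduction (k := k) Ω Ωρ J ρ m r) {a : EuclideanSpace ℝ (Fin m)} :
    MapsTangent (𝓡 m) (𝓡 r) (toLeaf (k := k) Ω Ωρ J ρ) q a 0 ↔ ∃ f : SmoothFn k P,
      HasComponents n nρ q a (Ω.hamVec (f ∘ J) q.fst) (-Ωρ.hamVec (f ∘ ρ) q.snd) := by
  have d0 := (h.smooth_proj q).mdifferentiableAt (by simp)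
  have d1 := (h.smooth_fst q).mdifferentiableAt (by simp)
  have d2 := (h.smooth_snd q).mdifferentiableAt (by simp)
  have key := h.vertical_iff q a
  constructor
  · intro h1
    obtain ⟨f, h2, h3⟩ := key.1 h1.map
    exact ⟨f, ⟨d1, h2⟩, ⟨d2, h3⟩⟩
  · rintro ⟨f, h2, h3⟩
    exact ⟨d0, key.2 ⟨f, h2.map, h3.map⟩⟩

namespace IsInductionInStages

variable {τ : Jt.Pullback σ → Sρ} {Ω' : SymplecticForm r' (LeafSpace (k := k) Ω Ωt J Jh)}
  {J' : LeafSpace (k := k) Ω Ωt J Jh → Pt}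

theorem map_eq (H : IsInductionInStages kt m₁ m' m r Ωσ Ωρ ρ Jt σ τ Ω' J') (q : J.Pullback Jh)
    {b : EuclideanSpace ℝ (Fin m')} {u : EuclideanSpace ℝ (Fin r')}
    {b₁ : EuclideanSpace ℝ (Fin n)} {b₂ : EuclideanSpace ℝ (Fin nt)}
    {w w' : EuclideanSpace ℝ (Fin kt)}
    (hp : MapsTangent (𝓡 m') (𝓡 r') (toLeaf (k := k) Ω Ωt J Jh) q b u)
    (hb : HasComponents n nt q b b₁ b₂)
    (h1 : MapsTangent (𝓡 r') (𝓡 kt) J' (toLeaf (k := k) Ω Ωt J Jh q) u w)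
    (h2 : MapsTangent (𝓡 nt) (𝓡 kt) Jt q.snd b₂ w') : w = w' := by
  have e1 : MapsTangent (𝓡 m') (𝓡 kt) (fun q : J.Pullback Jh => Jt q.snd) q b w' :=
    h2.comp hb.snd
  exact (h1.comp hp).unique (e1.congr (Eventually.of_forall H.map_proj))

/-- As J' composed with the projection is Jt∘snd, compatibility of u and v over `J'` and `σ` is
compatibility of b₂ and v over `Jt` and `σ`. With the two lemmas that follow, this completes partial
data to a tangent vector of the space of triples (x, y, z). -/
theorem exists_components_right (H : IsInductionInStages kt m₁ m' m r Ωσ Ωρ ρ Jt σ τ Ω' J')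
    {q : J.Pullback Jh} {d : Jt.Pullback σ} (hd : d.fst = q.snd)
    {b : EuclideanSpace ℝ (Fin m')} {u : EuclideanSpace ℝ (Fin r')}
    {b₁ : EuclideanSpace ℝ (Fin n)} {b₂ : EuclideanSpace ℝ (Fin nt)}
    {v : EuclideanSpace ℝ (Fin nσ)} {w : EuclideanSpace ℝ (Fin kt)}
    (hp : MapsTangent (𝓡 m') (𝓡 r') (toLeaf (k := k) Ω Ωt J Jh) q b u)
    (hb : HasComponents n nt q b b₁ b₂)
    (h1 : MapsTangent (𝓡 r') (𝓡 kt) J' (toLeaf (k := k) Ω Ωt J Jh q) u w)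
    (h2 : MapsTangent (𝓡 nσ) (𝓡 kt) σ d.snd v w) :
    ∃ δ : EuclideanSpace ℝ (Fin m₁), HasComponents nt nσ d δ b₂ v := by
  have e1 := (H.right.smooth_left d.fst).mapsTangent b₂
  refine H.right.exists_hasComponents e1 ?_
  rw [hd] at e1 ⊢
  rwa [← H.map_eq q hp hb h1 e1]

theorem exists_components_total (H : IsInductionInStages kt m₁ m' m r Ωσ Ωρ ρ Jt σ τ Ω' J')
    {q : J.Pullback Jh} {d : Jt.Pullback σ} (hd : d.fst = q.snd) {e : J.Pullback ρ}
    (he1 : e.fst = q.fst) (he2 : e.snd = τ d)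
    {b : EuclideanSpace ℝ (Fin m')} {δ : EuclideanSpace ℝ (Fin m₁)}
    {b₁ : EuclideanSpace ℝ (Fin n)} {b₂ : EuclideanSpace ℝ (Fin nt)}
    {v : EuclideanSpace ℝ (Fin nσ)} {w : EuclideanSpace ℝ (Fin nρ)}
    (hb : HasComponents n nt q b b₁ b₂) (hδ : HasComponents nt nσ d δ b₂ v)
    (hτ : MapsTangent (𝓡 m₁) (𝓡 nρ) τ d δ w) :
    ∃ c : EuclideanSpace ℝ (Fin m), HasComponents n nρ e c b₁ w := by
  obtain ⟨xe1, e1⟩ := (H.total.smooth_left q.fst).exists_mapsTangent b₁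
  obtain ⟨xe2, e2⟩ := (H.total.smooth_right (τ d)).exists_mapsTangent w
  obtain ⟨xe3, e3⟩ := (H.left.smooth_right q.snd).exists_mapsTangent b₂
  have e4 := hb.map_eq e1 e3
  have e5 : MapsTangent (𝓡 m₁) (𝓡 k) (fun d : Jt.Pullback σ => Jh d.fst) d δ xe3 :=
    (hd ▸ e3 : MapsTangent (𝓡 nt) (𝓡 k) Jh d.fst b₂ xe3).comp hδ.fst
  have e6 := (e2.comp hτ).unique (e5.congr (Eventually.of_forall H.momentum))
  refine H.total.exists_hasComponents (q := e) (by rw [he1]; exact e1) ?_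
  rw [he2, e4, ← e6]
  exact e2

theorem exists_components_left (H : IsInductionInStages kt m₁ m' m r Ωσ Ωρ ρ Jt σ τ Ω' J')
    {q : J.Pullback Jh} {d : Jt.Pullback σ} (hd : d.fst = q.snd) {e : J.Pullback ρ}
    (he1 : e.fst = q.fst) (he2 : e.snd = τ d)
    {δ : EuclideanSpace ℝ (Fin m₁)} {c : EuclideanSpace ℝ (Fin m)}
    {b₁ : EuclideanSpace ℝ (Fin n)} {b₂ : EuclideanSpace ℝ (Fin nt)}
    {v : EuclideanSpace ℝ (Fin nσ)} {w : EuclideanSpace ℝ (Fin nρ)}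
    (hc : HasComponents n nρ e c b₁ w) (hδ : HasComponents nt nσ d δ b₂ v)
    (hτ : MapsTangent (𝓡 m₁) (𝓡 nρ) τ d δ w) :
    ∃ b : EuclideanSpace ℝ (Fin m'), HasComponents n nt q b b₁ b₂ := by
  obtain ⟨xe1, e1⟩ := (H.total.smooth_left e.fst).exists_mapsTangent b₁
  obtain ⟨xe2, e2⟩ := (H.total.smooth_right e.snd).exists_mapsTangent w
  obtain ⟨xe3, e3⟩ := (H.left.smooth_right q.snd).exists_mapsTangent b₂
  have e4 := hc.map_eq e1 e2
  have e5 : MapsTangent (𝓡 m₁) (𝓡 k) (fun d : Jt.Pullback σ => Jh d.fst) d δ xe3 :=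
    (hd ▸ e3 : MapsTangent (𝓡 nt) (𝓡 k) Jh d.fst b₂ xe3).comp hδ.fst
  rw [he2] at e2
  have e6 := (e2.comp hτ).unique (e5.congr (Eventually.of_forall H.momentum))
  refine H.left.exists_hasComponents (q := q) ?_ e3
  rw [← he1, ← e6, ← e4]
  exact e1

/-- Local lifts from the product of the reduced space with `Sσ`. -/
theorem exists_local_lift (H : IsInductionInStages kt m₁ m' m r Ωσ Ωρ ρ Jt σ τ Ω' J')
    {q₀ : J.Pullback Jh} {d₀ : Jt.Pullback σ} {e₀ : J.Pullback ρ} (hd₀ : d₀.fst = q₀.snd)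
    (he₀ : e₀.1 = (q₀.fst, τ d₀)) :
    ∃ (κ : LeafSpace (k := k) Ω Ωt J Jh → J.Pullback Jh)
      (d : LeafSpace (k := k) Ω Ωt J Jh × Sσ → Jt.Pullback σ)
      (e : LeafSpace (k := k) Ω Ωt J Jh × Sσ → J.Pullback ρ),
      κ (toLeaf (k := k) Ω Ωt J Jh q₀) = q₀ ∧
      d (toLeaf (k := k) Ω Ωt J Jh q₀, d₀.snd) = d₀ ∧
      e (toLeaf (k := k) Ω Ωt J Jh q₀, d₀.snd) = e₀ ∧
      (∀ᶠ s in 𝓝 (toLeaf (k := k) Ω Ωt J Jh q₀), ContMDiffAt (𝓡 r') (𝓡 m') ∞ κ s ∧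
        toLeaf (k := k) Ω Ωt J Jh (κ s) = s) ∧
      (∀ᶠ w in 𝓝 (toLeaf (k := k) Ω Ωt J Jh q₀, d₀.snd),
        ContMDiffAt ((𝓡 r').prod (𝓡 nσ)) (𝓡 m₁) ∞ d w ∧
        ContMDiffAt ((𝓡 r').prod (𝓡 nσ)) (𝓡 m) ∞ e w ∧
        (J' w.1 = σ w.2 → (d w).1 = ((κ w.1).snd, w.2) ∧ (e w).1 = ((κ w.1).fst, τ (d w)))) ∧
      ∀ (u : EuclideanSpace ℝ (Fin r')) (v : EuclideanSpace ℝ (Fin nσ))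
        (b : EuclideanSpace ℝ (Fin m')) b₁ b₂ (δ : EuclideanSpace ℝ (Fin m₁))
        (c : EuclideanSpace ℝ (Fin m)) w,
        MapsTangent (𝓡 r') (𝓡 m') κ (toLeaf (k := k) Ω Ωt J Jh q₀) u b →
        HasComponents n nt q₀ b b₁ b₂ → HasComponents nt nσ d₀ δ b₂ v →
        MapsTangent (𝓡 m₁) (𝓡 nρ) τ d₀ δ w → HasComponents n nρ e₀ c b₁ w →
        MapsTangent ((𝓡 r').prod (𝓡 nσ)) (𝓡 m₁) d
          (toLeaf (k := k) Ω Ωt J Jh q₀, d₀.snd) (u, v) δ ∧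
        MapsTangent ((𝓡 r').prod (𝓡 nσ)) (𝓡 m) e
          (toLeaf (k := k) Ω Ωt J Jh q₀, d₀.snd) (u, v) c := by
  set p := toLeaf (k := k) Ω Ωt J Jh with hp
  obtain ⟨κ, hκ0, hκ⟩ := exists_local_section (I := 𝓡 m') (I' := 𝓡 r') (f := p) (q := q₀)
    (Eventually.of_forall fun x => H.leftReduction.smooth_proj x) (H.leftReduction.submersion q₀)
  obtain ⟨R₁, hR₁, hR₁t⟩ := H.right.exists_smooth_retraction d₀
  obtain ⟨R, hR, hRt⟩ := H.total.exists_smooth_retraction e₀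
  have hd₀' : d₀.1 = (q₀.snd, d₀.snd) := Prod.ext hd₀ rfl
  -- The pairs (y, z) and (x, τ d) lie in the fibre products only if J' s = σ z. The retractions R₁
  -- and R extend the lifts to a full neighbourhood in the product.
  let f₁ : LeafSpace (k := k) Ω Ωt J Jh × Sσ → St × Sσ := fun w => ((κ w.1).snd, w.2)
  let d : LeafSpace (k := k) Ω Ωt J Jh × Sσ → Jt.Pullback σ := fun w => R₁ (f₁ w)
  let f : LeafSpace (k := k) Ω Ωt J Jh × Sσ → S × Sρ := fun w => ((κ w.1).fst, τ (d w))
  let e : LeafSpace (k := k) Ω Ωt J Jh × Sσ → J.Pullback ρ := fun w => R (f w)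
  have hf₁0 : f₁ (p q₀, d₀.snd) = d₀.1 := by
    rw [hd₀']
    change ((κ (p q₀)).snd, d₀.snd) = _
    rw [hκ0]
  have hd0 : d (p q₀, d₀.snd) = d₀ := by
    change R₁ (f₁ (p q₀, d₀.snd)) = d₀
    rw [hf₁0]
    exact hR₁.self_of_nhds.2 d₀.2
  have hf0 : f (p q₀, d₀.snd) = e₀.1 := by
    rw [he₀]
    change ((κ (p q₀)).fst, τ (d (p q₀, d₀.snd))) = _
    rw [hκ0, hd0]
  have he0 : e (p q₀, d₀.snd) = e₀ := by
    change R (f (p q₀, d₀.snd)) = e₀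
    rw [hf0]
    exact hR.self_of_nhds.2 e₀.2
  have hκ' : ∀ᶠ w in 𝓝 (p q₀, d₀.snd), ContMDiffAt (𝓡 r') (𝓡 m') ∞ κ w.1 ∧ p (κ w.1) = w.1 :=
    (continuous_fst.tendsto (p q₀, d₀.snd)).eventually hκ
  have hκs : ∀ᶠ w in 𝓝 (p q₀, d₀.snd), ContMDiffAt ((𝓡 r').prod (𝓡 nσ)) (𝓡 m') ∞
      (fun w : LeafSpace (k := k) Ω Ωt J Jh × Sσ => κ w.1) w := by
    filter_upwards [hκ'] with w hw
    exact hw.1.comp w contMDiffAt_fst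
  have hf₁ : ∀ᶠ w in 𝓝 (p q₀, d₀.snd), ContMDiffAt ((𝓡 r').prod (𝓡 nσ))
      ((𝓡 nt).prod (𝓡 nσ)) ∞ f₁ w := by
    filter_upwards [hκs] with w hw
    exact ((H.left.smooth_snd (κ w.1)).comp w hw).prodMk contMDiffAt_snd
  have hd1 : ∀ᶠ w in 𝓝 (p q₀, d₀.snd), ContMDiffAt ((𝓡 nt).prod (𝓡 nσ)) (𝓡 m₁) ∞ R₁ (f₁ w) ∧
      ∀ h : Jt (f₁ w).1 = σ (f₁ w).2, R₁ (f₁ w) = ⟨f₁ w, h⟩ := by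
    have hR₁' := hR₁
    rw [← hf₁0] at hR₁'
    exact hf₁.self_of_nhds.continuousAt.eventually hR₁'
  have hd : ∀ᶠ w in 𝓝 (p q₀, d₀.snd), ContMDiffAt ((𝓡 r').prod (𝓡 nσ)) (𝓡 m₁) ∞ d w := by
    filter_upwards [hf₁, hd1] with w h1 h2
    exact h2.1.comp w h1
  have hf : ∀ᶠ w in 𝓝 (p q₀, d₀.snd), ContMDiffAt ((𝓡 r').prod (𝓡 nσ))
      ((𝓡 n).prod (𝓡 nρ)) ∞ f w := by
    filter_upwards [hκs, hd] with w hw h2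
    exact ((H.left.smooth_fst (κ w.1)).comp w hw).prodMk
      ((H.smooth (d w)).comp w h2)
  have he1 : ∀ᶠ w in 𝓝 (p q₀, d₀.snd), ContMDiffAt ((𝓡 n).prod (𝓡 nρ)) (𝓡 m) ∞ R (f w) ∧
      ∀ h : J (f w).1 = ρ (f w).2, R (f w) = ⟨f w, h⟩ := by
    have hR' := hR
    rw [← hf0] at hR'
    exact hf.self_of_nhds.continuousAt.eventually hR'
  refine ⟨κ, d, e, hκ0, hd0, he0, hκ, ?_, ?_⟩
  · filter_upwards [hκ', hd, hd1, hf, he1] with w h1 h2 h3 h4 h5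
    refine ⟨h2, h5.1.comp w h4, fun hw => ?_⟩
    have g1 : Jt (f₁ w).1 = σ (f₁ w).2 := by
      exact (H.map_proj (κ w.1)).symm.trans ((congrArg J' h1.2).trans hw)
    have g2 : (d w).1 = f₁ w := congrArg Subtype.val (h3.2 g1)
    have g3 : J (f w).1 = ρ (f w).2 := by
      change J (κ w.1).fst = ρ (τ (d w))
      rw [H.momentum]
      exact (κ w.1).2.trans (congrArg Jh (congrArg Prod.fst g2).symm)
    exact ⟨g2, congrArg Subtype.val (h5.2 g3)⟩
  · intro u v b b₁ b₂ δ c w hb hbc hδ hw hc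
    have hκt : MapsTangent ((𝓡 r').prod (𝓡 nσ)) (𝓡 m')
        (fun w : LeafSpace (k := k) Ω Ωt J Jh × Sσ => κ w.1) (p q₀, d₀.snd) (u, v) b :=
      hb.comp (f := Prod.fst) MapsTangent.fst
    have t1 : MapsTangent ((𝓡 r').prod (𝓡 nσ)) ((𝓡 nt).prod (𝓡 nσ)) f₁ (p q₀, d₀.snd)
        (u, v) (b₂, v) := (hbc.snd.comp_of_eq hκt hκ0).prodMk MapsTangent.snd
    have t2 : MapsTangent ((𝓡 r').prod (𝓡 nσ)) (𝓡 m₁) d (p q₀, d₀.snd) (u, v) δ :=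
      (hR₁t δ _ _ hδ).comp_of_eq t1 hf₁0
    have t3 : MapsTangent ((𝓡 r').prod (𝓡 nσ)) ((𝓡 n).prod (𝓡 nρ)) f (p q₀, d₀.snd)
        (u, v) (b₁, w) := (hbc.fst.comp_of_eq hκt hκ0).prodMk (hw.comp_of_eq t2 hd0)
    exact ⟨t2, (hRt c _ _ hc).comp_of_eq t3 hf0⟩

end IsInductionInStages

end Stages

/-! ### The fibre product of the induced map with `σ` is a manifold -/

section Stages

variable {n nt nσ nρ k kt m₁ m' r' m r : ℕ} {S St Sσ Sρ P Pt : Type*}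
  [TopologicalSpace S] [SmoothManifold n S] [TopologicalSpace St] [SmoothManifold nt St]
  [TopologicalSpace Sσ] [SmoothManifold nσ Sσ] [TopologicalSpace Sρ] [SmoothManifold nρ Sρ]
  [TopologicalSpace P] [SmoothManifold k P] [TopologicalSpace Pt] [SmoothManifold kt Pt]
  {Ω : SymplecticForm n S} {Ωt : SymplecticForm nt St}
  {Ωσ : SymplecticForm nσ Sσ} {Ωρ : SymplecticForm nρ Sρ}
  {J : S → P} {ρ : Sρ → P} {Jt : St → Pt} {Jh : St → P} {σ : Sσ → Pt}
  [SmoothManifold m₁ (Jt.Pullback σ)]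
  [SmoothManifold m' (J.Pullback Jh)] [SmoothManifold r' (LeafSpace (k := k) Ω Ωt J Jh)]
  [SmoothManifold m (J.Pullback ρ)] [SmoothManifold r (LeafSpace (k := k) Ω Ωρ J ρ)]
  {τ : Jt.Pullback σ → Sρ} {Ω' : SymplecticForm r' (LeafSpace (k := k) Ω Ωt J Jh)}
  {J' : LeafSpace (k := k) Ω Ωt J Jh → Pt}

namespace IsInductionInStages

/-- Points over a given point of the fibre product of `J'` and `σ`. -/
theorem exists_points (H : IsInductionInStages kt m₁ m' m r Ωσ Ωρ ρ Jt σ τ Ω' J')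
    {s : LeafSpace (k := k) Ω Ωt J Jh} {z : Sσ} (hsz : J' s = σ z) :
    ∃ (q : J.Pullback Jh) (d : Jt.Pullback σ) (e : J.Pullback ρ),
      toLeaf (k := k) Ω Ωt J Jh q = s ∧ d.fst = q.snd ∧ d.snd = z ∧ e.1 = (q.fst, τ d) := by
  obtain ⟨q, rfl⟩ : ∃ q, toLeaf (k := k) Ω Ωt J Jh q = s := toLeaf_surjective s
  let d : Jt.Pullback σ := ⟨(q.snd, z), (H.map_proj q).symm.trans hsz⟩
  exact ⟨q, d, ⟨(q.fst, τ d), q.2.trans (H.momentum d).symm⟩, rfl, rfl, rfl, rfl⟩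

/-- A smooth retraction onto the fibre product of `J'` and `σ`. -/
theorem exists_localRetraction (H : IsInductionInStages kt m₁ m' m r Ωσ Ωρ ρ Jt σ τ Ω' J')
    {w₀ : LeafSpace (k := k) Ω Ωt J Jh × Sσ} (hw₀ : J' w₀.1 = σ w₀.2) :
    ∃ R : LeafSpace (k := k) Ω Ωt J Jh × Sσ → LeafSpace (k := k) Ω Ωt J Jh × Sσ,
      IsLocalRetraction ((𝓡 r').prod (𝓡 nσ))
        (fun w : LeafSpace (k := k) Ω Ωt J Jh × Sσ => J' w.1 = σ w.2) R w₀ ∧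
      ∀ u v w, MapsTangent (𝓡 r') (𝓡 kt) J' w₀.1 u w → MapsTangent (𝓡 nσ) (𝓡 kt) σ w₀.2 v w →
        MapsTangent ((𝓡 r').prod (𝓡 nσ)) ((𝓡 r').prod (𝓡 nσ)) R w₀ (u, v) (u, v) := by
  obtain ⟨s₀, z₀⟩ := w₀
  obtain ⟨q₀, d₀, e₀, rfl, hdq, rfl, he₀⟩ := H.exists_points hw₀
  obtain ⟨κ, d, e, hκ0, hd0, he0, hκ, hde, htan⟩ := H.exists_local_lift hdq he₀
  set p := toLeaf (k := k) Ω Ωt J Jh with hp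
  obtain ⟨L, hL1, hL2⟩ := exists_submersion_lift (I := 𝓡 m₁) (I' := 𝓡 nρ) (f := τ) (q := d₀)
    (Eventually.of_forall fun x => H.smooth x) (H.submersion d₀)
  obtain ⟨R, hR, hRt⟩ := H.left.exists_smooth_retraction q₀
  have hq₀ : q₀.1 = (q₀.fst, d₀.fst) := Prod.ext rfl hdq.symm
  have hes : e₀.snd = τ d₀ := congrArg Prod.snd he₀
  have hef : e₀.fst = q₀.fst := congrArg Prod.fst he₀
  -- The lifts d and e need not match off the fibre product. L moves d to a point d' with τ d' =
  -- e.snd; then the first components of e and d' form a point c of the fibre product of `J` and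
  -- `Jh`.
  let f₁ : LeafSpace (k := k) Ω Ωt J Jh × Sσ → Sρ × Jt.Pullback σ := fun w => ((e w).snd, d w)
  let d' : LeafSpace (k := k) Ω Ωt J Jh × Sσ → Jt.Pullback σ := fun w => L (f₁ w)
  let f : LeafSpace (k := k) Ω Ωt J Jh × Sσ → S × St := fun w => ((e w).fst, (d' w).fst)
  let c : LeafSpace (k := k) Ω Ωt J Jh × Sσ → J.Pullback Jh := fun w => R (f w)
  have hf₁0 : f₁ (p q₀, d₀.snd) = (τ d₀, d₀) := by
    change ((e (p q₀, d₀.snd)).snd, d (p q₀, d₀.snd)) = _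
    rw [hd0, he0, hes]
  have hd'0 : d' (p q₀, d₀.snd) = d₀ := by
    change L (f₁ (p q₀, d₀.snd)) = d₀
    rw [hf₁0]
    exact hL2.self_of_nhds
  have hf0 : f (p q₀, d₀.snd) = q₀.1 := by
    change ((e (p q₀, d₀.snd)).fst, (d' (p q₀, d₀.snd)).fst) = _
    rw [hd'0, he0, hef, hq₀]
  have hc0 : c (p q₀, d₀.snd) = q₀ := by
    change R (f (p q₀, d₀.snd)) = q₀
    rw [hf0]
    exact hR.self_of_nhds.2 q₀.2
  have hf₁ : ∀ᶠ w in 𝓝 (p q₀, d₀.snd), ContMDiffAt ((𝓡 r').prod (𝓡 nσ))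
      ((𝓡 nρ).prod (𝓡 m₁)) ∞ f₁ w := by
    filter_upwards [hde] with w hw
    exact ((H.total.smooth_snd (e w)).comp w hw.2.1).prodMk hw.1
  have hd1 : ∀ᶠ w in 𝓝 (p q₀, d₀.snd), ContMDiffAt ((𝓡 nρ).prod (𝓡 m₁)) (𝓡 m₁) ∞ L (f₁ w) ∧
      τ (L (f₁ w)) = (f₁ w).1 := by
    have hL1' := hL1
    rw [← hf₁0] at hL1'
    exact hf₁.self_of_nhds.continuousAt.eventually hL1'
  have hd' : ∀ᶠ w in 𝓝 (p q₀, d₀.snd), ContMDiffAt ((𝓡 r').prod (𝓡 nσ)) (𝓡 m₁) ∞ d' w := by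
    filter_upwards [hf₁, hd1] with w h1 h2
    exact h2.1.comp w h1
  have hf : ∀ᶠ w in 𝓝 (p q₀, d₀.snd), ContMDiffAt ((𝓡 r').prod (𝓡 nσ))
      ((𝓡 n).prod (𝓡 nt)) ∞ f w := by
    filter_upwards [hde, hd'] with w hw h2
    exact ((H.total.smooth_fst (e w)).comp w hw.2.1).prodMk ((H.right.smooth_fst (d' w)).comp w h2)
  have hc1 : ∀ᶠ w in 𝓝 (p q₀, d₀.snd), ContMDiffAt ((𝓡 n).prod (𝓡 nt)) (𝓡 m') ∞ R (f w) ∧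
      ∀ h : J (f w).1 = Jh (f w).2, R (f w) = ⟨f w, h⟩ := by
    have hR' := hR
    rw [← hf0] at hR'
    exact hf.self_of_nhds.continuousAt.eventually hR'
  have hL2' : ∀ᶠ w in 𝓝 (p q₀, d₀.snd), L (τ (d w), d w) = d w := by
    have hL2' := hL2
    rw [← hd0] at hL2'
    exact hde.self_of_nhds.1.continuousAt.eventually hL2'
  have hκ' : ∀ᶠ w in 𝓝 (p q₀, d₀.snd), ContMDiffAt (𝓡 r') (𝓡 m') ∞ κ w.1 ∧ p (κ w.1) = w.1 :=
    (continuous_fst.tendsto (p q₀, d₀.snd)).eventually hκ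
  -- J of the first component of e is ρ of its second, which is ρ(τ d') = Jh of the first component
  -- of d'; so R changes nothing here.
  have hcf : ∀ᶠ w in 𝓝 (p q₀, d₀.snd), (c w).1 = f w := by
    filter_upwards [hc1, hd1] with w h1 h2
    refine congrArg Subtype.val (h1.2 ?_)
    change J (e w).fst = Jh (d' w).fst
    have h3 : τ (d' w) = (e w).snd := h2.2
    rw [← H.momentum, h3]
    exact (e w).2
  refine ⟨fun w => (p (c w), (d' w).snd), ⟨?_, ?_, ?_⟩, ?_⟩
  · filter_upwards [hf, hc1, hd'] with w h1 h2 h3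
    exact ((H.leftReduction.smooth_proj (c w)).comp w (h2.1.comp w h1)).prodMk
      ((H.right.smooth_snd (d' w)).comp w h3)
  · filter_upwards [hcf] with w h1
    rw [H.map_proj]
    exact (congrArg (fun y : S × St => Jt y.2) h1).trans (d' w).2
  -- On the fibre product e = (x, τ d) holds already, so d' = d, c = κ s, and the point is fixed.
  · filter_upwards [hcf, hde, hL2', hκ'] with w h1 h2 h3 h4 hw
    obtain ⟨g1, g2⟩ := h2.2.2 hw
    have g5 : (e w).fst = (κ w.1).fst := congrArg Prod.fst g2
    have g6 : (d w).fst = (κ w.1).snd := congrArg Prod.fst g1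
    have g7 : (d w).snd = w.2 := congrArg Prod.snd g1
    have g3 : d' w = d w := by
      have : f₁ w = (τ (d w), d w) := Prod.ext (congrArg Prod.snd g2) rfl
      change L (f₁ w) = d w
      rw [this, h3]
    have g4 : c w = κ w.1 := by
      refine Subtype.ext (h1.trans ?_)
      change ((e w).fst, (d' w).fst) = (κ w.1).1
      rw [g3]
      exact Prod.ext g5 g6
    change (p (c w), (d' w).snd) = w
    rw [g4, g3, h4.2]
    exact Prod.ext rfl g7
  · intro u v w hu hv
    -- The vector (u, v) is followed through the construction: it lifts to (b₁, b₂, v), the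
    -- corrections leave this lift alone, and it projects back to (u, v).
    obtain ⟨b, hb⟩ := hκ.self_of_nhds.1.exists_mapsTangent u
    have hbp : MapsTangent (𝓡 m') (𝓡 r') p q₀ b u := by
      have := hb.of_leftInverse (I' := 𝓡 m') (g := p)
        ((H.leftReduction.smooth_proj _).mdifferentiableAt (by simp)) (hκ.mono fun s hs => hs.2)
      rwa [hκ0] at this
    have hbc := H.left.hasComponents q₀ b
    set b₁ := mfderiv (𝓡 m') (𝓡 n) (Pullback.fst : J.Pullback Jh → S) q₀ b
    set b₂ := mfderiv (𝓡 m') (𝓡 nt) (Pullback.snd : J.Pullback Jh → St) q₀ b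
    obtain ⟨δ, hδ⟩ := H.exists_components_right hdq hbp hbc hu hv
    obtain ⟨w', hw'⟩ := (H.smooth d₀).exists_mapsTangent δ
    obtain ⟨ε, hε⟩ := H.exists_components_total hdq hef hes hbc hδ hw'
    obtain ⟨td, te⟩ := htan u v b b₁ b₂ δ ε w' hb hbc hδ hw' hε
    have t1 : MapsTangent ((𝓡 r').prod (𝓡 nσ)) ((𝓡 nρ).prod (𝓡 m₁)) f₁ (p q₀, d₀.snd) (u, v)
        (w', δ) := (hε.snd.comp_of_eq te he0).prodMk td
    have tL : MapsTangent ((𝓡 nρ).prod (𝓡 m₁)) (𝓡 m₁) L (τ d₀, d₀) (w', δ) δ :=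
      (hw'.prodMk MapsTangent.id).of_leftInverse (I := 𝓡 m₁) (f := fun d => (τ d, d))
        (hL1.self_of_nhds.1.mdifferentiableAt (by simp)) hL2
    have t2 : MapsTangent ((𝓡 r').prod (𝓡 nσ)) (𝓡 m₁) d' (p q₀, d₀.snd) (u, v) δ :=
      tL.comp_of_eq t1 hf₁0
    have t3 : MapsTangent ((𝓡 r').prod (𝓡 nσ)) ((𝓡 n).prod (𝓡 nt)) f (p q₀, d₀.snd) (u, v)
        (b₁, b₂) := (hε.fst.comp_of_eq te he0).prodMk (hδ.fst.comp_of_eq t2 hd'0)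
    have t4 : MapsTangent ((𝓡 r').prod (𝓡 nσ)) (𝓡 m') c (p q₀, d₀.snd) (u, v) b :=
      (hRt b _ _ hbc).comp_of_eq t3 hf0
    exact (hbp.comp_of_eq t4 hc0).prodMk (hδ.snd.comp_of_eq t2 hd'0)

/-- The dimension of the tangent spaces of the fibre product of `J'` and `σ`. -/
theorem finrank_tangent (H : IsInductionInStages kt m₁ m' m r Ωσ Ωρ ρ Jt σ τ Ω' J')
    {w₀ : LeafSpace (k := k) Ω Ωt J Jh × Sσ} (hw₀ : J' w₀.1 = σ w₀.2)
    {K : Submodule ℝ (EuclideanSpace ℝ (Fin r') × EuclideanSpace ℝ (Fin nσ))}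
    (hK : ∀ x, x ∈ K ↔ ∃ w, MapsTangent (𝓡 r') (𝓡 kt) J' w₀.1 x.1 w ∧
      MapsTangent (𝓡 nσ) (𝓡 kt) σ w₀.2 x.2 w) :
    Module.finrank ℝ K + m' + nρ = m + m₁ + r' := by
  obtain ⟨s₀, z₀⟩ := w₀
  obtain ⟨q₀, d₀, e₀, rfl, hdq, rfl, he₀⟩ := H.exists_points hw₀
  have hes : e₀.snd = τ d₀ := congrArg Prod.snd he₀
  have hef : e₀.fst = q₀.fst := congrArg Prod.fst he₀
  let A₁ : EuclideanSpace ℝ (Fin m') →L[ℝ] EuclideanSpace ℝ (Fin n) :=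
    mfderiv (𝓡 m') (𝓡 n) (Pullback.fst : J.Pullback Jh → S) q₀
  let A₂ : EuclideanSpace ℝ (Fin m') →L[ℝ] EuclideanSpace ℝ (Fin nt) :=
    mfderiv (𝓡 m') (𝓡 nt) (Pullback.snd : J.Pullback Jh → St) q₀
  let p : EuclideanSpace ℝ (Fin m') →L[ℝ] EuclideanSpace ℝ (Fin r') :=
    mfderiv (𝓡 m') (𝓡 r') (toLeaf (k := k) Ω Ωt J Jh) q₀
  let B₁ : EuclideanSpace ℝ (Fin m₁) →L[ℝ] EuclideanSpace ℝ (Fin nt) :=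
    mfderiv (𝓡 m₁) (𝓡 nt) (Pullback.fst : Jt.Pullback σ → St) d₀
  let B₂ : EuclideanSpace ℝ (Fin m₁) →L[ℝ] EuclideanSpace ℝ (Fin nσ) :=
    mfderiv (𝓡 m₁) (𝓡 nσ) (Pullback.snd : Jt.Pullback σ → Sσ) d₀
  let t : EuclideanSpace ℝ (Fin m₁) →L[ℝ] EuclideanSpace ℝ (Fin nρ) := mfderiv (𝓡 m₁) (𝓡 nρ) τ d₀
  let C₁ : EuclideanSpace ℝ (Fin m) →L[ℝ] EuclideanSpace ℝ (Fin n) :=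
    mfderiv (𝓡 m) (𝓡 n) (Pullback.fst : J.Pullback ρ → S) e₀
  let C₂ : EuclideanSpace ℝ (Fin m) →L[ℝ] EuclideanSpace ℝ (Fin nρ) :=
    mfderiv (𝓡 m) (𝓡 nρ) (Pullback.snd : J.Pullback ρ → Sρ) e₀
  have hA : ∀ a, HasComponents n nt q₀ a (A₁ a) (A₂ a) := H.left.hasComponents q₀
  have hB : ∀ a, HasComponents nt nσ d₀ a (B₁ a) (B₂ a) := H.right.hasComponents d₀
  have hC : ∀ a, HasComponents n nρ e₀ a (C₁ a) (C₂ a) := H.total.hasComponents e₀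
  have hp : ∀ a, MapsTangent (𝓡 m') (𝓡 r') (toLeaf (k := k) Ω Ωt J Jh) q₀ a (p a) := fun a =>
    (H.leftReduction.smooth_proj q₀).mapsTangent a
  have ht : ∀ a, MapsTangent (𝓡 m₁) (𝓡 nρ) τ d₀ a (t a) := fun a => (H.smooth d₀).mapsTangent a
  -- The common cover is the tangent space of W. It lies over K by the projection to S', and over
  -- the tangent space of the fibre product of `J` and `ρ` by τ.
  have key := finrank_of_common_cover (a₁ := A₁.toLinearMap) (a₂ := A₂.toLinearMap)
    (p := p.toLinearMap) (b₁ := B₁.toLinearMap) (b₂ := B₂.toLinearMap) (t := t.toLinearMap)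
    (c₁ := C₁.toLinearMap) (c₂ := C₂.toLinearMap) (K := K) (H.leftReduction.submersion q₀)
    (H.submersion d₀) ?_ ?_ ?_ ?_ ?_ ?_ ?_ ?_
  · simpa using key
  · intro x
    rw [hK]
    constructor
    · rintro ⟨w, h1, h2⟩
      obtain ⟨b, hb⟩ := H.leftReduction.submersion q₀ x.1
      have hb' : p b = x.1 := hb
      obtain ⟨δ, hδ⟩ := H.exists_components_right hdq (hb' ▸ hp b) (hA b) h1 h2
      exact ⟨b, δ, hδ.fst.map.symm, hb', hδ.snd.map⟩
    · rintro ⟨b, δ, h1, h2, h3⟩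
      obtain ⟨w, hw⟩ := (H.smooth_map (toLeaf (k := k) Ω Ωt J Jh q₀)).exists_mapsTangent x.1
      obtain ⟨w', hw'⟩ := (H.right.smooth_right d₀.snd).exists_mapsTangent x.2
      obtain ⟨w'', hw''⟩ := (H.right.smooth_left d₀.fst).exists_mapsTangent (A₂ b)
      have e1 : w'' = w' := (hB δ).map_eq (by
        have h1' : A₂ b = B₁ δ := h1
        rw [← h1']; exact hw'') (by
        have h3' : B₂ δ = x.2 := h3
        rw [h3']; exact hw')
      have e2 : w = w'' := H.map_eq q₀ (by
        have h2' : p b = x.1 := h2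
        rw [← h2']; exact hp b) (hA b) hw (by rw [← hdq]; exact hw'')
      exact ⟨w, hw, by rw [e2, e1]; exact hw'⟩
  · intro c
    obtain ⟨δ, hδ⟩ := H.submersion d₀ (C₂ c)
    have hδ' : t δ = C₂ c := hδ
    obtain ⟨b, hb⟩ := H.exists_components_left hdq hef hes (hC c) (hB δ) (hδ' ▸ ht δ)
    exact ⟨b, δ, hb.snd.map, hb.fst.map, hδ'⟩
  · intro b δ hbδ
    have hbδ' : A₂ b = B₁ δ := hbδ
    obtain ⟨c, hc⟩ := H.exists_components_total hdq hef hes (hA b) (hbδ' ▸ hB δ) (ht δ)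
    exact ⟨c, hc.fst.map.symm, hc.snd.map.symm⟩
  · exact H.left.immersion q₀
  · exact H.right.immersion d₀
  · exact H.total.immersion e₀
  -- A vector killed by the projection is (X_{f∘J}, -X_{f∘Jh}); its second component is killed by
  -- dJt, so it pairs with 0 in the tangent space of Sσ.
  · intro b hb
    have hb' : p b = 0 := hb
    obtain ⟨f, hf⟩ := H.leftReduction.mapsTangent_zero_iff.1 (hb' ▸ hp b)
    obtain ⟨δ, hδ⟩ := H.right.exists_hasComponents (q := d₀) (H.left_commutes f d₀.fst).neg
      (by rw [neg_zero]; exact MapsTangent.zero ((H.right.smooth_right _).mdifferentiableAt (by simp)))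
    refine ⟨δ, hf.snd.map.trans (Eq.trans ?_ hδ.fst.map.symm), hδ.snd.map⟩
    rw [hdq]
    rfl
  -- Symmetrically, a vector killed by τ is (X_{g∘Jt}, -X_{g∘σ}); its first component is killed by
  -- dJh and pairs with 0 in the tangent space of S.
  · intro δ hδ
    have hδ' : t δ = 0 := hδ
    obtain ⟨g, hg⟩ := (H.vertical_iff d₀ δ).1 (hδ' ▸ ht δ)
    obtain ⟨b, hb⟩ := H.left.exists_hasComponents (q := q₀)
      (MapsTangent.zero ((H.left.smooth_left _).mdifferentiableAt (by simp)))
      (H.right_commutes g q₀.snd)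
    refine ⟨b, hb.snd.map.trans (Eq.trans ?_ hg.fst.map.symm), hb.fst.map⟩
    rw [hdq]

/-- The fibre product of `J'` and `σ` is a manifold. -/
theorem exists_smoothManifold (H : IsInductionInStages kt m₁ m' m r Ωσ Ωρ ρ Jt σ τ Ω' J') :
    ∃ (m'' : ℕ) (_ : SmoothManifold m'' (J'.Pullback σ)), IsSmoothPullback r' nσ kt J' σ m'' := by
  let I := (𝓡 r').prod (𝓡 nσ)
  let D : LeafSpace (k := k) Ω Ωt J Jh × Sσ → Prop := fun w => J' w.1 = σ w.2
  have hret : ∀ w₀, D w₀ → ∃ R, IsLocalRetraction I D R w₀ ∧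
      (∀ u v w, MapsTangent (𝓡 r') (𝓡 kt) J' w₀.1 u w → MapsTangent (𝓡 nσ) (𝓡 kt) σ w₀.2 v w →
        MapsTangent I I R w₀ (u, v) (u, v)) ∧
      Module.finrank ℝ (LinearMap.range (mfderiv I I R w₀).toLinearMap) =
        m + m₁ + r' - m' - nρ := by
    intro w₀ hw₀
    obtain ⟨R, hR, hRt⟩ := H.exists_localRetraction hw₀
    refine ⟨R, hR, hRt, ?_⟩
    have hR0 : R w₀ = w₀ := hR.fixed.self_of_nhds hw₀
    let Rd : EuclideanSpace ℝ (Fin r') × EuclideanSpace ℝ (Fin nσ) →L[ℝ]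
      EuclideanSpace ℝ (Fin r') × EuclideanSpace ℝ (Fin nσ) := mfderiv I I R w₀
    -- The range of the differential of R is the space of all (u, v) with dJ' u = dσ v: it is
    -- contained there because R takes values in the fibre product, and these vectors are fixed. The
    -- identity obtained also shows that the truncated subtraction in the rank is exact.
    have key := H.finrank_tangent hw₀ (K := LinearMap.range Rd.toLinearMap) (fun x => by
      constructor
      · rintro ⟨y, rfl⟩
        have h1 : MapsTangent I I R w₀ y (Rd y) := hR.smooth.self_of_nhds.mapsTangent y
        obtain ⟨w, hw⟩ := (H.smooth_map w₀.1).exists_mapsTangent (Rd y).1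
        obtain ⟨w', hw'⟩ := (H.right.smooth_right w₀.2).exists_mapsTangent (Rd y).2
        have h2 : MapsTangent I (𝓡 kt) (fun w => J' (R w).1) w₀ y w :=
          (hw.comp (f := Prod.fst) MapsTangent.fst).comp_of_eq h1 hR0
        have h3 : MapsTangent I (𝓡 kt) (fun w => σ (R w).2) w₀ y w' :=
          (hw'.comp (f := Prod.snd) MapsTangent.snd).comp_of_eq h1 hR0
        have h4 : w = w' := h2.unique (h3.congr hR.mem)
        subst h4
        exact ⟨w, hw, hw'⟩
      · rintro ⟨w, h1, h2⟩
        exact ⟨x, (hRt x.1 x.2 w h1 h2).map⟩)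
    change Module.finrank ℝ (LinearMap.range Rd.toLinearMap) = _
    omega
  choose! R hR hRt hRd using hret
  obtain ⟨cs, hm, hsm, hinj⟩ := exists_manifold_of_localRetraction (I := I) (D := D)
    (d := m + m₁ + r' - m' - nρ) (fun w hw => ⟨R w, hR w hw, hRd w hw⟩)
  let _ : SmoothManifold (m + m₁ + r' - m' - nρ) (J'.Pullback σ) :=
    { cs, hm, (inferInstance : T2Space (J'.Pullback σ)),
      TopologicalSpace.Subtype.secondCountableTopology {w : LeafSpace (k := k) Ω Ωt J Jh × Sσ | D w} with }
  have hval : ∀ (q : J'.Pullback σ) a, MapsTangent (𝓡 (m + m₁ + r' - m' - nρ)) I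
      (Subtype.val : J'.Pullback σ → _) q a _ := fun q a => (hsm q).mapsTangent a
  have hfst : ∀ (q : J'.Pullback σ) a, MapsTangent _ (𝓡 r') (Pullback.fst : J'.Pullback σ → _) q a _ :=
    fun q a => MapsTangent.fst.comp (hval q a)
  have hsnd : ∀ (q : J'.Pullback σ) a, MapsTangent _ (𝓡 nσ) (Pullback.snd : J'.Pullback σ → _) q a _ :=
    fun q a => MapsTangent.snd.comp (hval q a)
  refine ⟨_, inferInstance, {
    smooth_fst := contMDiff_fst.comp hsm
    smooth_snd := contMDiff_snd.comp hsm
    immersion := fun q a h1 h2 => hinj q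
      ((Prod.ext ((hfst q a).map.symm.trans h1) ((hsnd q a).map.symm.trans h2)).trans
        (map_zero _).symm)
    smooth_left := H.smooth_map
    smooth_right := H.right.smooth_right
    exists_lift := fun q u v huv => ?_ }⟩
  classical
  -- R, seen as a map into the new manifold, is smooth near q; its differential sends (u, v) to the
  -- lift required. The value q where D fails is a dummy.
  let c : LeafSpace (k := k) Ω Ωt J Jh × Sσ → J'.Pullback σ := fun w =>
    if h : D (R q.1 w) then ⟨R q.1 w, h⟩ else q
  have hc : ∀ᶠ w in 𝓝 q.1, (c w).1 = R q.1 w :=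
    (hR _ q.2).mem.mono fun w h => by simp only [c, dif_pos h]
  have hc0 : c q.1 = q :=
    Subtype.ext (hc.self_of_nhds.trans ((hR _ q.2).fixed.self_of_nhds q.2))
  have hcs : ContMDiffAt I (𝓡 (m + m₁ + r' - m' - nρ)) ∞ c q.1 :=
    contMDiffAt_of_comp_immersion hsm hinj ⟨rfl⟩
      ((hR _ q.2).smooth.self_of_nhds.congr_of_eventuallyEq hc)
  obtain ⟨a, ha⟩ := hcs.exists_mapsTangent (u, v)
  have h1 : MapsTangent I I (fun w => (c w).1) q.1 (u, v) _ := (hval q a).comp_of_eq ha hc0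
  have hu := (H.smooth_map q.fst).mapsTangent u
  have hv : MapsTangent (𝓡 nσ) (𝓡 kt) σ q.snd v (mfderiv (𝓡 r') (𝓡 kt) J' q.fst u) :=
    ⟨(H.right.smooth_right _).mdifferentiableAt (by simp), huv.symm⟩
  have h3 := h1.unique ((hRt _ q.2 u v _ hu hv).congr hc)
  exact ⟨a, (hfst q a).map.trans (congrArg Prod.fst h3), (hsnd q a).map.trans (congrArg Prod.snd h3)⟩

end IsInductionInStages

end Stages

/-! ### Lifting tangent vectors to the common cover -/

section Stages

variable {n nt nσ nρ k kt m₁ m' r' m r : ℕ} {S St Sσ Sρ P Pt : Type*}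
  [TopologicalSpace S] [SmoothManifold n S] [TopologicalSpace St] [SmoothManifold nt St]
  [TopologicalSpace Sσ] [SmoothManifold nσ Sσ] [TopologicalSpace Sρ] [SmoothManifold nρ Sρ]
  [TopologicalSpace P] [SmoothManifold k P] [TopologicalSpace Pt] [SmoothManifold kt Pt]
  {Ω : SymplecticForm n S} {Ωt : SymplecticForm nt St}
  {Ωσ : SymplecticForm nσ Sσ} {Ωρ : SymplecticForm nρ Sρ}
  {J : S → P} {ρ : Sρ → P} {Jt : St → Pt} {Jh : St → P} {σ : Sσ → Pt}
  [SmoothManifold m₁ (Jt.Pullback σ)]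
  [SmoothManifold m' (J.Pullback Jh)] [SmoothManifold r' (LeafSpace (k := k) Ω Ωt J Jh)]
  [SmoothManifold m (J.Pullback ρ)] [SmoothManifold r (LeafSpace (k := k) Ω Ωρ J ρ)]
  {τ : Jt.Pullback σ → Sρ} {Ω' : SymplecticForm r' (LeafSpace (k := k) Ω Ωt J Jh)}
  {J' : LeafSpace (k := k) Ω Ωt J Jh → Pt}

theorem HasComponents.of_eq {q : J.Pullback ρ} {a : EuclideanSpace ℝ (Fin m)}
    {u u' : EuclideanSpace ℝ (Fin n)} {v v' : EuclideanSpace ℝ (Fin nρ)}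
    (h : HasComponents n nρ q a u v) (hu : u = u') (hv : v = v') : HasComponents n nρ q a u' v' :=
  hu ▸ hv ▸ h

theorem MapsTangent.of_eq {f : S → Sρ} {x : S} {v : EuclideanSpace ℝ (Fin n)}
    {w w' : EuclideanSpace ℝ (Fin nρ)} (h : MapsTangent (𝓡 n) (𝓡 nρ) f x v w) (hw : w = w') :
    MapsTangent (𝓡 n) (𝓡 nρ) f x v w' :=
  hw ▸ h

/-- Points of the fibre products which lie over each other. -/
structure AreRelated (τ : Jt.Pullback σ → Sρ) (q : J.Pullback Jh) (d : Jt.Pullback σ)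
    (e : J.Pullback ρ) : Prop where
  fst_eq : d.fst = q.snd
  val_eq : e.1 = (q.fst, τ d)

/-- Tangent vectors at related points which lie over each other. -/
structure AreLifts (Ω : SymplecticForm n S) (Ωt : SymplecticForm nt St)
    [SmoothManifold r' (LeafSpace (k := k) Ω Ωt J Jh)] (nσ : ℕ) [SmoothManifold nσ Sσ]
    (nρ : ℕ) [SmoothManifold nρ Sρ] (τ : Jt.Pullback σ → Sρ)
    (q : J.Pullback Jh) (d : Jt.Pullback σ) (e : J.Pullback ρ) (a : EuclideanSpace ℝ (Fin m'))
    (δ : EuclideanSpace ℝ (Fin m₁)) (c : EuclideanSpace ℝ (Fin m))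
    (v₁ : EuclideanSpace ℝ (Fin r')) (b₁ : EuclideanSpace ℝ (Fin n))
    (b₂ : EuclideanSpace ℝ (Fin nt)) (v₂ : EuclideanSpace ℝ (Fin nσ))
    (w : EuclideanSpace ℝ (Fin nρ)) : Prop where
  proj : MapsTangent (𝓡 m') (𝓡 r') (toLeaf (k := k) Ω Ωt J Jh) q a v₁
  left : HasComponents n nt q a b₁ b₂
  right : HasComponents nt nσ d δ b₂ v₂
  map : MapsTangent (𝓡 m₁) (𝓡 nρ) τ d δ w
  total : HasComponents n nρ e c b₁ w

theorem AreLifts.sub {q : J.Pullback Jh} {d : Jt.Pullback σ} {e : J.Pullback ρ}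
    {a a' : EuclideanSpace ℝ (Fin m')} {δ δ' : EuclideanSpace ℝ (Fin m₁)}
    {c c' : EuclideanSpace ℝ (Fin m)} {v₁ v₁' : EuclideanSpace ℝ (Fin r')}
    {b₁ b₁' : EuclideanSpace ℝ (Fin n)} {b₂ b₂' : EuclideanSpace ℝ (Fin nt)}
    {v₂ v₂' : EuclideanSpace ℝ (Fin nσ)} {w w' : EuclideanSpace ℝ (Fin nρ)}
    (h : AreLifts (k := k) Ω Ωt nσ nρ τ q d e a δ c v₁ b₁ b₂ v₂ w)
    (h' : AreLifts (k := k) Ω Ωt nσ nρ τ q d e a' δ' c' v₁' b₁' b₂' v₂' w') :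
    AreLifts (k := k) Ω Ωt nσ nρ τ q d e (a - a') (δ - δ') (c - c') (v₁ - v₁') (b₁ - b₁') (b₂ - b₂')
      (v₂ - v₂') (w - w') :=
  ⟨h.proj.sub h'.proj, h.left.sub h'.left, h.right.sub h'.right, h.map.sub h'.map,
    h.total.sub h'.total⟩

namespace IsInductionInStages

theorem exists_related (H : IsInductionInStages kt m₁ m' m r Ωσ Ωρ ρ Jt σ τ Ω' J')
    (w : J'.Pullback σ) :
    ∃ (q : J.Pullback Jh) (d : Jt.Pullback σ) (e : J.Pullback ρ),
      w.1 = (toLeaf (k := k) Ω Ωt J Jh q, d.snd) ∧ AreRelated τ q d e := by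
  obtain ⟨q, d, e, h1, h2, h3, h4⟩ := H.exists_points w.2
  exact ⟨q, d, e, Prod.ext h1.symm h3.symm, h2, h4⟩

theorem exists_related_of_total (H : IsInductionInStages kt m₁ m' m r Ωσ Ωρ ρ Jt σ τ Ω' J')
    (e : J.Pullback ρ) :
    ∃ (q : J.Pullback Jh) (d : Jt.Pullback σ) (w : J'.Pullback σ),
      w.1 = (toLeaf (k := k) Ω Ωt J Jh q, d.snd) ∧ AreRelated τ q d e := by
  obtain ⟨d, hd⟩ := H.surjective e.snd
  let q : J.Pullback Jh := ⟨(e.fst, d.fst), by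
    change J e.fst = Jh d.fst
    rw [← H.momentum, hd]
    exact e.2⟩
  exact ⟨q, d, ⟨(toLeaf (k := k) Ω Ωt J Jh q, d.snd), (H.map_proj q).trans d.2⟩, rfl, rfl,
    Prod.ext rfl hd.symm⟩

section Lifts

variable {q : J.Pullback Jh} {d : Jt.Pullback σ} {e : J.Pullback ρ}

theorem exists_lifts_of_left (H : IsInductionInStages kt m₁ m' m r Ωσ Ωρ ρ Jt σ τ Ω' J')
    (hr : AreRelated τ q d e) {a : EuclideanSpace ℝ (Fin m')} {v₁ : EuclideanSpace ℝ (Fin r')}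
    {v₂ : EuclideanSpace ℝ (Fin nσ)} {x : EuclideanSpace ℝ (Fin kt)}
    (ha : MapsTangent (𝓡 m') (𝓡 r') (toLeaf (k := k) Ω Ωt J Jh) q a v₁)
    (h1 : MapsTangent (𝓡 r') (𝓡 kt) J' (toLeaf (k := k) Ω Ωt J Jh q) v₁ x)
    (h2 : MapsTangent (𝓡 nσ) (𝓡 kt) σ d.snd v₂ x) :
    ∃ (δ : EuclideanSpace ℝ (Fin m₁)) (c : EuclideanSpace ℝ (Fin m)) (b₁ b₂ w : _),
      AreLifts (k := k) Ω Ωt nσ nρ τ q d e a δ c v₁ b₁ b₂ v₂ w := by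
  have hac := H.left.hasComponents q a
  obtain ⟨δ, hδ⟩ := H.exists_components_right hr.fst_eq ha hac h1 h2
  obtain ⟨w, hw⟩ := (H.smooth d).exists_mapsTangent δ
  obtain ⟨c, hc⟩ := H.exists_components_total hr.fst_eq (congrArg Prod.fst hr.val_eq)
    (congrArg Prod.snd hr.val_eq) hac hδ hw
  exact ⟨δ, c, _, _, w, ha, hac, hδ, hw, hc⟩

theorem exists_lifts_of_total (H : IsInductionInStages kt m₁ m' m r Ωσ Ωρ ρ Jt σ τ Ω' J')
    (hr : AreRelated τ q d e) {δ : EuclideanSpace ℝ (Fin m₁)} {c : EuclideanSpace ℝ (Fin m)}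
    {b₁ : EuclideanSpace ℝ (Fin n)} {b₂ : EuclideanSpace ℝ (Fin nt)}
    {v₂ : EuclideanSpace ℝ (Fin nσ)} {w : EuclideanSpace ℝ (Fin nρ)}
    (hc : HasComponents n nρ e c b₁ w) (hδ : HasComponents nt nσ d δ b₂ v₂)
    (hw : MapsTangent (𝓡 m₁) (𝓡 nρ) τ d δ w) :
    ∃ (a : EuclideanSpace ℝ (Fin m')) (v₁ : EuclideanSpace ℝ (Fin r')),
      AreLifts (k := k) Ω Ωt nσ nρ τ q d e a δ c v₁ b₁ b₂ v₂ w := by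
  obtain ⟨a, ha⟩ := H.exists_components_left hr.fst_eq (congrArg Prod.fst hr.val_eq)
    (congrArg Prod.snd hr.val_eq) hc hδ hw
  obtain ⟨v₁, hv₁⟩ := (H.leftReduction.smooth_proj q).exists_mapsTangent a
  exact ⟨a, v₁, hv₁, ha, hδ, hw, hc⟩

/-- Lifts of the zero vector project to the zero vector. -/
theorem proj_eq_zero_of_lifts (H : IsInductionInStages kt m₁ m' m r Ωσ Ωρ ρ Jt σ τ Ω' J')
    (hr : AreRelated τ q d e) {a : EuclideanSpace ℝ (Fin m')}
    {δ : EuclideanSpace ℝ (Fin m₁)} {c : EuclideanSpace ℝ (Fin m)}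
    {b₁ : EuclideanSpace ℝ (Fin n)} {b₂ : EuclideanSpace ℝ (Fin nt)} {w : EuclideanSpace ℝ (Fin nρ)}
    (h : AreLifts (k := k) Ω Ωt nσ nρ τ q d e a δ c (0 : EuclideanSpace ℝ (Fin r')) b₁ b₂ 0 w) :
    MapsTangent (𝓡 m) (𝓡 r) (toLeaf (k := k) Ω Ωρ J ρ) e c 0 := by
  -- Here (b₁, b₂) = (X_{f∘J}, -X_{f∘Jh}). Then δ = (-X_{f∘Jh}, 0) is sent by τ to -X_{f∘ρ}, and c =
  -- (X_{f∘J}, -X_{f∘ρ}) is vertical.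
  obtain ⟨f, hf⟩ := H.leftReduction.mapsTangent_zero_iff.1 h.proj
  have e1 := h.left.fst.unique hf.fst
  have e2 := h.left.snd.unique hf.snd
  have e3 : q.fst = e.fst := (congrArg Prod.fst hr.val_eq).symm
  have e4 : τ d = e.snd := (congrArg Prod.snd hr.val_eq).symm
  refine H.reduction.mapsTangent_zero_iff.2 ⟨f, ?_⟩
  have h1 : HasComponents nt nσ d (-δ) (Ωt.hamVec (f ∘ Jh) d.fst) 0 := by
    rw [hr.fst_eq]
    exact h.right.neg.of_eq (neg_eq_iff_eq_neg.2 e2) neg_zero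
  have h2 : MapsTangent (𝓡 m₁) (𝓡 nρ) τ d δ (-Ωρ.hamVec (f ∘ ρ) (τ d)) :=
    neg_neg δ ▸ (H.maps_hamVec f d _ h1).neg
  have e5 := h.map.unique h2
  have h3 := h.total
  rw [e1, e5, e3, e4] at h3
  exact h3

/-- A vector with vanishing projection lies over a vector which is Hamiltonian. -/
theorem exists_hamVec_of_lifts (H : IsInductionInStages kt m₁ m' m r Ωσ Ωρ ρ Jt σ τ Ω' J')
    (hr : AreRelated τ q d e) {a : EuclideanSpace ℝ (Fin m')}
    {δ : EuclideanSpace ℝ (Fin m₁)} {c : EuclideanSpace ℝ (Fin m)} {v₁ : EuclideanSpace ℝ (Fin r')}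
    {b₁ : EuclideanSpace ℝ (Fin n)} {b₂ : EuclideanSpace ℝ (Fin nt)}
    {v₂ : EuclideanSpace ℝ (Fin nσ)} {w : EuclideanSpace ℝ (Fin nρ)}
    (h : AreLifts (k := k) Ω Ωt nσ nρ τ q d e a δ c v₁ b₁ b₂ v₂ w)
    (hc : MapsTangent (𝓡 m) (𝓡 r) (toLeaf (k := k) Ω Ωρ J ρ) e c 0) :
    ∃ g : SmoothFn kt Pt, v₁ = Ω'.hamVec (g ∘ J') (toLeaf (k := k) Ω Ωt J Jh q) ∧
      v₂ = -Ωσ.hamVec (g ∘ σ) d.snd := by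
  obtain ⟨f, hf⟩ := H.reduction.mapsTangent_zero_iff.1 hc
  have e3 : e.fst = q.fst := congrArg Prod.fst hr.val_eq
  have e4 : e.snd = τ d := congrArg Prod.snd hr.val_eq
  -- Since c = (X_{f∘J}, -X_{f∘ρ}), another lift over c uses (-X_{f∘Jh}, 0) and projects to 0. The
  -- difference of the lifts is killed by τ and has no S-component, so it is (0, X_{g∘Jt},
  -- -X_{g∘σ}); its projection gives v₁ and v₂.
  obtain ⟨δ₀, hδ₀⟩ := H.right.exists_hasComponents (q := d) (H.left_commutes f d.fst)
    (MapsTangent.zero ((H.right.smooth_right _).mdifferentiableAt (by simp)))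
  have hw := (H.maps_hamVec f d _ hδ₀).neg
  have hδ₁ := hδ₀.neg
  rw [neg_zero] at hδ₁
  rw [e4] at hf
  obtain ⟨a₀, u, ha₀⟩ := H.exists_lifts_of_total hr hf hδ₁ hw
  have hu : u = 0 := by
    refine ha₀.proj.unique (H.leftReduction.mapsTangent_zero_iff.2 ⟨f, ?_⟩)
    have := ha₀.left
    rw [e3, hr.fst_eq] at this
    exact this
  have hs := h.sub ha₀
  have ew := h.total.snd.unique hf.snd
  have eb := h.total.fst.unique hf.fst
  have hτ := hs.map.of_eq (sub_eq_zero.2 ew)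
  obtain ⟨g, hg⟩ := (H.vertical_iff d _).1 hτ
  refine ⟨g, ?_, ?_⟩
  · have h1 := hs.left.of_eq (sub_eq_zero.2 eb) (hs.right.fst.unique hg.fst)
    rw [hr.fst_eq] at h1
    have h2 := hs.proj
    rw [hu, sub_zero] at h2
    exact h2.unique (H.proj_hamVec g q _ h1)
  · have h1 := hs.right.snd
    rw [sub_zero] at h1
    exact h1.unique hg.snd

/-- X_{g∘J'} lifts to (0, X_{g∘Jt}), while (X_{g∘Jt}, -X_{g∘σ}) is killed by τ; both components over
`S` and `Sρ` vanish, whence the 0 in the statement. -/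
theorem exists_lifts_of_hamVec (H : IsInductionInStages kt m₁ m' m r Ωσ Ωρ ρ Jt σ τ Ω' J')
    (hr : AreRelated τ q d e) (g : SmoothFn kt Pt) {x : EuclideanSpace ℝ (Fin kt)}
    (h1 : MapsTangent (𝓡 r') (𝓡 kt) J' (toLeaf (k := k) Ω Ωt J Jh q)
      (Ω'.hamVec (g ∘ J') (toLeaf (k := k) Ω Ωt J Jh q)) x)
    (h2 : MapsTangent (𝓡 nσ) (𝓡 kt) σ d.snd (-Ωσ.hamVec (g ∘ σ) d.snd) x) :
    ∃ (a : EuclideanSpace ℝ (Fin m')) (δ : EuclideanSpace ℝ (Fin m₁)) (b₁ b₂ w : _),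
      AreLifts (k := k) Ω Ωt nσ nρ τ q d e a δ (0 : EuclideanSpace ℝ (Fin m))
        (Ω'.hamVec (g ∘ J') (toLeaf (k := k) Ω Ωt J Jh q)) b₁ b₂
        (-Ωσ.hamVec (g ∘ σ) d.snd) w := by
  obtain ⟨a, ha⟩ := H.left.exists_hasComponents (q := q)
    (MapsTangent.zero ((H.left.smooth_left _).mdifferentiableAt (by simp)))
    (H.right_commutes g q.snd)
  have hp := H.proj_hamVec g q a ha
  obtain ⟨δ, hδ⟩ := H.exists_components_right hr.fst_eq hp ha h1 h2
  have hw : MapsTangent (𝓡 m₁) (𝓡 nρ) τ d δ 0 := (H.vertical_iff d δ).2 ⟨g, by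
    rw [hr.fst_eq]
    exact hδ⟩
  obtain ⟨c, hc⟩ := H.exists_components_total hr.fst_eq (congrArg Prod.fst hr.val_eq)
    (congrArg Prod.snd hr.val_eq) ha hδ hw
  have hc0 : c = 0 := H.total.immersion e c hc.fst.map hc.snd.map
  exact ⟨a, δ, _, _, _, hp, ha, hδ, hw, hc0 ▸ hc⟩

end Lifts

end IsInductionInStages

end Stages

/-! ### The comparison map and its differential -/

section Stages

variable {n nt nσ nρ k kt m₁ m' m'' r' m r : ℕ} {S St Sσ Sρ P Pt : Type*}
  [TopologicalSpace S] [SmoothManifold n S] [TopologicalSpace St] [SmoothManifold nt St]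
  [TopologicalSpace Sσ] [SmoothManifold nσ Sσ] [TopologicalSpace Sρ] [SmoothManifold nρ Sρ]
  [TopologicalSpace P] [SmoothManifold k P] [TopologicalSpace Pt] [SmoothManifold kt Pt]
  {Ω : SymplecticForm n S} {Ωt : SymplecticForm nt St}
  {Ωσ : SymplecticForm nσ Sσ} {Ωρ : SymplecticForm nρ Sρ}
  {J : S → P} {ρ : Sρ → P} {Jt : St → Pt} {Jh : St → P} {σ : Sσ → Pt}
  [SmoothManifold m₁ (Jt.Pullback σ)]
  [SmoothManifold m' (J.Pullback Jh)] [SmoothManifold r' (LeafSpace (k := k) Ω Ωt J Jh)]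
  [SmoothManifold m (J.Pullback ρ)] [SmoothManifold r (LeafSpace (k := k) Ω Ωρ J ρ)]
  {τ : Jt.Pullback σ → Sρ} {Ω' : SymplecticForm r' (LeafSpace (k := k) Ω Ωt J Jh)}
  {J' : LeafSpace (k := k) Ω Ωt J Jh → Pt}

namespace IsInductionInStages

/-- `τ` maps the Hamiltonian curves of `-f ∘ Jh` to those of `-f ∘ ρ`. -/
theorem isMIntegralCurveOn_comp (H : IsInductionInStages kt m₁ m' m r Ωσ Ωρ ρ Jt σ τ Ω' J')
    {f : SmoothFn k P} {s : Set ℝ} (hs : UniqueDiffOn ℝ s) {y : ℝ → St} {z : Sσ}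
    (hy : IsMIntegralCurveOn (I := 𝓡 nt) y (fun y => -Ωt.hamVec (f ∘ Jh) y) s)
    {d : ℝ → Jt.Pullback σ} (hd : ∀ t ∈ s, (d t).1 = (y t, z)) :
    IsMIntegralCurveOn (I := 𝓡 nρ) (τ ∘ d) (fun x => -Ωρ.hamVec (f ∘ ρ) x) s := by
  intro t ht
  have hz : HasMFDerivWithinAt 𝓘(ℝ, ℝ) (𝓡 nσ) (fun _ : ℝ => z) s t
      ((1 : ℝ →L[ℝ] ℝ).smulRight (0 : EuclideanSpace ℝ (Fin nσ))) := by
    have e : (1 : ℝ →L[ℝ] ℝ).smulRight (0 : EuclideanSpace ℝ (Fin nσ)) = 0 :=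
      ContinuousLinearMap.smulRight_zero _
    exact e.symm ▸ hasMFDerivWithinAt_const (I := 𝓘(ℝ, ℝ)) (I' := 𝓡 nσ) z s t
  obtain ⟨a, ha, h1, h2⟩ := H.right.exists_velocity (hs t ht) hd (hy t ht) hz ht
  have hc : (d t).fst = y t := congrArg Prod.fst (hd t ht)
  have h3 : HasComponents nt nσ (d t) a (-Ωt.hamVec (f ∘ Jh) (d t).fst) 0 := by
    refine (H.right.hasComponents (d t) a).of_eq (h1.trans ?_) h2
    rw [hc]
  have h4 : HasComponents nt nσ (d t) (-a) (Ωt.hamVec (f ∘ Jh) (d t).fst) 0 :=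
    h3.neg.of_eq (neg_neg _) neg_zero
  have h5 : MapsTangent (𝓡 m₁) (𝓡 nρ) τ (d t) a (-Ωρ.hamVec (f ∘ ρ) (τ (d t))) :=
    neg_neg a ▸ (H.maps_hamVec f (d t) _ h4).neg
  exact h5.curve ha

/-- Noether's principle: X_{f∘Jh} is tangent to the fibres of `Jt`. It keeps z fixed while y moves
along a leaf. -/
theorem constant_along_left (H : IsInductionInStages kt m₁ m' m r Ωσ Ωρ ρ Jt σ τ Ω' J')
    {f : SmoothFn k P} {s : Set ℝ} (hs : Convex ℝ s) {y : ℝ → St}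
    (hy : IsMIntegralCurveOn (I := 𝓡 nt) y (fun y => -Ωt.hamVec (f ∘ Jh) y) s) {t t' : ℝ}
    (ht : t ∈ s) (ht' : t' ∈ s) : Jt (y t) = Jt (y t') := by
  refine constant_of_hasMFDerivWithinAt_zero (I := 𝓡 kt) (c := Jt ∘ y) hs (fun t ht => ?_) ht ht'
  have h0 := (H.left_commutes f (y t)).neg.curve (hy t ht)
  exact ⟨_, h0, (one_smul ℝ (-0 : EuclideanSpace ℝ (Fin kt))).trans neg_zero⟩

theorem constant_along_right (H : IsInductionInStages kt m₁ m' m r Ωσ Ωρ ρ Jt σ τ Ω' J')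
    {g : SmoothFn kt Pt} {s : Set ℝ} (hs : Convex ℝ s) {y : ℝ → St}
    (hy : IsMIntegralCurveOn (I := 𝓡 nt) y (fun y => Ωt.hamVec (g ∘ Jt) y) s) {t t' : ℝ}
    (ht : t ∈ s) (ht' : t' ∈ s) : Jh (y t) = Jh (y t') := by
  refine constant_of_hasMFDerivWithinAt_zero (I := 𝓡 k) (c := Jh ∘ y) hs (fun t ht => ?_) ht ht'
  have h0 := (H.right_commutes g (y t)).curve (hy t ht)
  exact ⟨_, h0, one_smul ℝ (0 : EuclideanSpace ℝ (Fin k))⟩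

/-- The map `Ψ` sends `([x, y], z)` to `[x, τ (y, z)]`. -/
def IsComparison (τ : Jt.Pullback σ → Sρ) (J' : LeafSpace (k := k) Ω Ωt J Jh → Pt)
    (Ψ : J'.Pullback σ → LeafSpace (k := k) Ω Ωρ J ρ) : Prop :=
  ∀ (w : J'.Pullback σ) (q : J.Pullback Jh) (d : Jt.Pullback σ) (e : J.Pullback ρ),
    w.1 = (toLeaf (k := k) Ω Ωt J Jh q, d.snd) → AreRelated τ q d e →
    Ψ w = toLeaf (k := k) Ω Ωρ J ρ e

/-- With z fixed, a leaf curve (x(t), y(t)) of `J` and `Jh` keeps Jt y(t) = σ z, and (x(t), τ(y(t),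
z)) is a leaf curve of `J` and `ρ` for the same f. So [x, τ(y, z)] depends only on [x, y] and z. -/
theorem exists_comparison (H : IsInductionInStages kt m₁ m' m r Ωσ Ωρ ρ Jt σ τ Ω' J') :
    ∃ Ψ : J'.Pullback σ → LeafSpace (k := k) Ω Ωρ J ρ, IsComparison τ J' Ψ := by
  classical
  choose q₀ d₀ e₀ h1 h2 using H.exists_related
  refine ⟨fun w => toLeaf (k := k) Ω Ωρ J ρ (e₀ w), fun w q d e hw hr => ?_⟩
  let z := d.snd
  let D : (y : St) → Jt y = σ z → Jt.Pullback σ := fun y h => ⟨(y, z), h⟩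
  let E : (q : J.Pullback Jh) → Jt q.snd = σ z → J.Pullback ρ := fun q h =>
    ⟨(q.fst, τ (D q.snd h)), q.2.trans (H.momentum (D q.snd h)).symm⟩
  -- The value is defined only where Jt y = σ z. With `none` elsewhere, g is total and can be fed to
  -- `leaf_induction`; a step preserves both cases.
  let g : J.Pullback Jh → Option (LeafSpace (k := k) Ω Ωρ J ρ) := fun q =>
    if h : Jt q.snd = σ z then some (toLeaf (k := k) Ω Ωρ J ρ (E q h)) else none
  have hg : ∀ a b, LeafStep (k := k) Ω Ωt J Jh a b → g a = g b := by
    rintro a b ⟨f, γ, δ, hγ, hδ, hJ, h1, h2, h3, h4⟩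
    have hc : ∀ t ∈ Icc (0 : ℝ) 1, Jt (δ t) = Jt (δ 0) := fun t ht =>
      H.constant_along_left (convex_Icc 0 1) hδ ht (by simp)
    have hc1 : Jt b.snd = Jt a.snd := by
      rw [← h4, ← h2]
      exact hc 1 (by simp)
    by_cases h : Jt a.snd = σ z
    · have h' : Jt b.snd = σ z := hc1.trans h
      have hz : ∀ t ∈ Icc (0 : ℝ) 1, Jt (δ t) = σ z := fun t ht =>
        (hc t ht).trans ((congrArg Jt h2).trans h)
      let c : ℝ → Jt.Pullback σ := fun t => if h' : Jt (δ t) = σ z then D (δ t) h' else D a.snd h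
      have hcD : ∀ t (ht : t ∈ Icc (0 : ℝ) 1), c t = D (δ t) (hz t ht) := fun t ht =>
        dif_pos (hz t ht)
      have hcv : ∀ t ∈ Icc (0 : ℝ) 1, (c t).1 = (δ t, z) := fun t ht => by rw [hcD t ht]
      have e0 : c 0 = D a.snd h :=
        Subtype.ext ((hcv 0 (by simp)).trans (congrArg (fun y => (y, z)) h2))
      have e1 : c 1 = D b.snd h' :=
        Subtype.ext ((hcv 1 (by simp)).trans (congrArg (fun y => (y, z)) h4))
      simp only [g, dif_pos h, dif_pos h']
      refine congrArg some (Quotient.sound (Relation.EqvGen.rel _ _ ⟨f, γ, τ ∘ c, hγ,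
        H.isMIntegralCurveOn_comp (uniqueDiffOn_Icc_zero_one) hδ hcv, fun t ht => ?_, h1,
        congrArg τ e0, h3, congrArg τ e1⟩))
      refine (hJ t ht).trans (Eq.trans ?_ (H.momentum (c t)).symm)
      exact congrArg Jh (congrArg Prod.fst (hcv t ht)).symm
    · have h' : Jt b.snd ≠ σ z := fun h' => h (hc1.symm.trans h')
      simp only [g, dif_neg h, dif_neg h']
  have hqq : toLeaf (k := k) Ω Ωt J Jh (q₀ w) = toLeaf (k := k) Ω Ωt J Jh q :=
    (congrArg Prod.fst (h1 w)).symm.trans (congrArg Prod.fst hw)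
  have hz : (d₀ w).snd = z := (congrArg Prod.snd (h1 w)).symm.trans (congrArg Prod.snd hw)
  have key : ∀ (q : J.Pullback Jh) (d : Jt.Pullback σ) (e : J.Pullback ρ), AreRelated τ q d e →
      d.snd = z → g q = some (toLeaf (k := k) Ω Ωρ J ρ e) := by
    intro q d e hr hd
    have hJ : Jt q.snd = σ z := by
      rw [← hr.fst_eq, ← hd]
      exact d.2
    have hD : D q.snd hJ = d := Subtype.ext (Prod.ext hr.fst_eq.symm hd.symm)
    have hE : E q hJ = e := Subtype.ext ((congrArg (fun d => (q.fst, τ d)) hD).trans hr.val_eq.symm)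
    simp only [g, dif_pos hJ, hE]
  have h3 := leaf_induction hg hqq
  rw [key _ _ _ (h2 w) hz, key _ _ _ hr rfl] at h3
  exact Option.some.inj h3

variable [SmoothManifold m'' (J'.Pullback σ)]
  {Ψ : J'.Pullback σ → LeafSpace (k := k) Ω Ωρ J ρ}

/-- The comparison map is smooth, and its differential is computed by lifts. -/
theorem comparison_smooth_and_mapsTangent
    (H : IsInductionInStages kt m₁ m' m r Ωσ Ωρ ρ Jt σ τ Ω' J')
    (hD : IsSmoothPullback r' nσ kt J' σ m'') (hΨ : IsComparison τ J' Ψ) {w₀ : J'.Pullback σ}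
    {q : J.Pullback Jh} {d : Jt.Pullback σ} {e : J.Pullback ρ}
    (hw : w₀.1 = (toLeaf (k := k) Ω Ωt J Jh q, d.snd)) (hr : AreRelated τ q d e) :
    ContMDiffAt (𝓡 m'') (𝓡 r) ∞ Ψ w₀ ∧
      ∀ (v : EuclideanSpace ℝ (Fin m'')) (a : EuclideanSpace ℝ (Fin m'))
        (δ : EuclideanSpace ℝ (Fin m₁)) (c : EuclideanSpace ℝ (Fin m))
        (v₁ : EuclideanSpace ℝ (Fin r')) b₁ b₂ v₂ w (x : EuclideanSpace ℝ (Fin r)),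
        HasComponents r' nσ w₀ v v₁ v₂ →
        AreLifts (k := k) Ω Ωt nσ nρ τ q d e a δ c v₁ b₁ b₂ v₂ w →
        MapsTangent (𝓡 m) (𝓡 r) (toLeaf (k := k) Ω Ωρ J ρ) e c x →
        MapsTangent (𝓡 m'') (𝓡 r) Ψ w₀ v x := by
  obtain ⟨κ, dd, ee, hκ0, hd0, he0, hκ, hde, htan⟩ := H.exists_local_lift hr.fst_eq hr.val_eq
  have hde' := hde
  rw [← hw] at hde' he0
  -- On the fibre product the local lifts are related points, so Ψ is locally the projection of the
  -- smooth lift ee.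
  have hloc : Ψ =ᶠ[𝓝 w₀] toLeaf (k := k) Ω Ωρ J ρ ∘ fun w => ee w.1 := by
    have hw1 : w₀.fst = toLeaf (k := k) Ω Ωt J Jh q := congrArg Prod.fst hw
    have hκ' := hκ
    rw [← hw1] at hκ'
    filter_upwards [continuous_subtype_val.continuousAt.eventually hde',
      (hD.smooth_fst w₀).continuousAt.eventually hκ'] with w h1 h2
    obtain ⟨g1, g2⟩ := h1.2.2 w.2
    exact hΨ w (κ w.1.1) (dd w.1) (ee w.1)
      (Prod.ext h2.2.symm (congrArg Prod.snd g1).symm) ⟨congrArg Prod.fst g1, g2⟩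
  have hval : ContMDiffAt (𝓡 m'') ((𝓡 r').prod (𝓡 nσ)) ∞ (Subtype.val : J'.Pullback σ → _) w₀ :=
    hD.smooth_val w₀
  have hs : ContMDiffAt (𝓡 m'') (𝓡 m) ∞ (fun w : J'.Pullback σ => ee w.1) w₀ :=
    hde'.self_of_nhds.2.1.comp w₀ hval
  refine ⟨((H.reduction.smooth_proj _).comp w₀ hs).congr_of_eventuallyEq hloc, ?_⟩
  intro v a δ c v₁ b₁ b₂ v₂ w x hv hl hx
  obtain ⟨b, hb⟩ := hκ.self_of_nhds.1.exists_mapsTangent v₁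
  have hbp : MapsTangent (𝓡 m') (𝓡 r') (toLeaf (k := k) Ω Ωt J Jh) q b v₁ := by
    have := hb.of_leftInverse (I' := 𝓡 m') (g := toLeaf (k := k) Ω Ωt J Jh)
      ((H.leftReduction.smooth_proj _).mdifferentiableAt (by simp)) (hκ.mono fun s hs => hs.2)
    rwa [hκ0] at this
  obtain ⟨y₁, hy₁⟩ := (H.smooth_map (toLeaf (k := k) Ω Ωt J Jh q)).exists_mapsTangent v₁
  obtain ⟨y₂, hy₂⟩ := (H.right.smooth_right d.snd).exists_mapsTangent v₂
  have hy : y₁ = y₂ := hv.map_eq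
    (show MapsTangent _ _ J' w₀.1.1 v₁ y₁ by rw [hw]; exact hy₁)
    (show MapsTangent _ _ σ w₀.1.2 v₂ y₂ by rw [hw]; exact hy₂)
  -- The differential of the local lift provides one lift of (v₁, v₂). Any other one differs from it
  -- by a lift of zero, which has zero projection.
  obtain ⟨δ', c', b₁', b₂', w', hl'⟩ := H.exists_lifts_of_left hr hbp hy₁ (hy ▸ hy₂)
  obtain ⟨-, te⟩ := htan v₁ v₂ b b₁' b₂' δ' c' w' hb hl'.left hl'.right hl'.map hl'.total
  have hsub := hl.sub hl'
  rw [sub_self, sub_self] at hsub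
  have h0 := H.proj_eq_zero_of_lifts hr hsub
  have hx' : MapsTangent (𝓡 m) (𝓡 r) (toLeaf (k := k) Ω Ωρ J ρ) e c' x := by
    have := hx.sub h0
    rwa [sub_sub_cancel, sub_zero] at this
  have he0' := he0
  rw [← hw] at te
  have t1 : MapsTangent (𝓡 m'') (𝓡 m) (fun w : J'.Pullback σ => ee w.1) w₀ v c' :=
    te.comp hv.val
  exact (hx'.comp_of_eq t1 he0').congr hloc

theorem comparison_smooth (H : IsInductionInStages kt m₁ m' m r Ωσ Ωρ ρ Jt σ τ Ω' J')
    (hD : IsSmoothPullback r' nσ kt J' σ m'') (hΨ : IsComparison τ J' Ψ) :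
    ContMDiff (𝓡 m'') (𝓡 r) ∞ Ψ := fun w => by
  obtain ⟨q, d, e, hw, hr⟩ := H.exists_related w
  exact (H.comparison_smooth_and_mapsTangent hD hΨ hw hr).1

/-- The lifts of the tangent vectors of the fibre product of `J'` and `σ`. -/
theorem exists_lifts (H : IsInductionInStages kt m₁ m' m r Ωσ Ωρ ρ Jt σ τ Ω' J')
    (hD : IsSmoothPullback r' nσ kt J' σ m'') (hΨ : IsComparison τ J' Ψ) {w₀ : J'.Pullback σ}
    {q : J.Pullback Jh} {d : Jt.Pullback σ} {e : J.Pullback ρ}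
    (hw : w₀.1 = (toLeaf (k := k) Ω Ωt J Jh q, d.snd)) (hr : AreRelated τ q d e)
    (v : EuclideanSpace ℝ (Fin m'')) :
    ∃ (a : EuclideanSpace ℝ (Fin m')) (δ : EuclideanSpace ℝ (Fin m₁))
      (c : EuclideanSpace ℝ (Fin m)) (v₁ : EuclideanSpace ℝ (Fin r')) (b₁ b₂ v₂ w : _)
      (x : EuclideanSpace ℝ (Fin r)),
      HasComponents r' nσ w₀ v v₁ v₂ ∧
      AreLifts (k := k) Ω Ωt nσ nρ τ q d e a δ c v₁ b₁ b₂ v₂ w ∧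
      MapsTangent (𝓡 m) (𝓡 r) (toLeaf (k := k) Ω Ωρ J ρ) e c x ∧
      MapsTangent (𝓡 m'') (𝓡 r) Ψ w₀ v x := by
  obtain ⟨v₁, hv₁⟩ := (hD.smooth_fst w₀).exists_mapsTangent v
  obtain ⟨v₂, hv₂⟩ := (hD.smooth_snd w₀).exists_mapsTangent v
  obtain ⟨a, ha⟩ := H.leftReduction.submersion q v₁
  have hp : MapsTangent (𝓡 m') (𝓡 r') (toLeaf (k := k) Ω Ωt J Jh) q a v₁ :=
    ⟨(H.leftReduction.smooth_proj q).mdifferentiableAt (by simp), ha⟩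
  obtain ⟨y₁, hy₁⟩ := (H.smooth_map (toLeaf (k := k) Ω Ωt J Jh q)).exists_mapsTangent v₁
  obtain ⟨y₂, hy₂⟩ := (H.right.smooth_right d.snd).exists_mapsTangent v₂
  have hv : HasComponents r' nσ w₀ v v₁ v₂ := ⟨hv₁, hv₂⟩
  have hy : y₁ = y₂ := hv.map_eq
    (show MapsTangent _ _ J' w₀.1.1 v₁ y₁ by rw [hw]; exact hy₁)
    (show MapsTangent _ _ σ w₀.1.2 v₂ y₂ by rw [hw]; exact hy₂)
  obtain ⟨δ, c, b₁, b₂, w, hl⟩ := H.exists_lifts_of_left hr hp hy₁ (hy ▸ hy₂)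
  obtain ⟨x, hx⟩ := (H.reduction.smooth_proj e).exists_mapsTangent c
  exact ⟨a, δ, c, v₁, b₁, b₂, v₂, w, x, hv, hl, hx,
    (H.comparison_smooth_and_mapsTangent hD hΨ hw hr).2 v a δ c v₁ b₁ b₂ v₂ w x hv hl hx⟩

/-- A vector of the reduced space lifts to c, the `Sρ`-component of c lifts along the submersion τ,
and the resulting tangent vector of the common cover projects to the fibre product of `J'` and `σ`.
-/
theorem comparison_submersion (H : IsInductionInStages kt m₁ m' m r Ωσ Ωρ ρ Jt σ τ Ω' J')
    (hD : IsSmoothPullback r' nσ kt J' σ m'') (hΨ : IsComparison τ J' Ψ) (w₀ : J'.Pullback σ) :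
    Surjective (mfderiv (𝓡 m'') (𝓡 r) Ψ w₀) := by
  obtain ⟨q, d, e, hw, hr⟩ := H.exists_related w₀
  rw [hΨ w₀ q d e hw hr]
  intro x
  obtain ⟨c, hc⟩ := H.reduction.submersion e x
  have hx : MapsTangent (𝓡 m) (𝓡 r) (toLeaf (k := k) Ω Ωρ J ρ) e c x :=
    ⟨(H.reduction.smooth_proj e).mdifferentiableAt (by simp), hc⟩
  have hcc := H.total.hasComponents e c
  obtain ⟨y, hy⟩ : ∃ y : EuclideanSpace ℝ (Fin nρ), MapsTangent (𝓡 m) (𝓡 nρ)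
    (Pullback.snd : J.Pullback ρ → Sρ) e c y := ⟨_, hcc.snd⟩
  obtain ⟨δ, hδ⟩ : ∃ δ : EuclideanSpace ℝ (Fin m₁), mfderiv (𝓡 m₁) (𝓡 nρ) τ d δ = y :=
    H.submersion d y
  have hδ' : MapsTangent (𝓡 m₁) (𝓡 nρ) τ d δ y := ⟨(H.smooth d).mdifferentiableAt (by simp), hδ⟩
  obtain ⟨a, v₁, hl⟩ := H.exists_lifts_of_total hr ⟨hcc.fst, hy⟩ (H.right.hasComponents d δ) hδ'
  obtain ⟨v, hv⟩ := hD.exists_hasComponents (q := w₀) (u := v₁)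
    (v := mfderiv (𝓡 m₁) (𝓡 nσ) (Pullback.snd : Jt.Pullback σ → Sσ) d δ)
    (w := mfderiv (𝓡 r') (𝓡 kt) J' w₀.fst v₁) ((H.smooth_map _).mapsTangent _) (by
      obtain ⟨y₁, hy₁⟩ := (H.right.smooth_left d.fst).exists_mapsTangent
        (mfderiv (𝓡 m₁) (𝓡 nt) (Pullback.fst : Jt.Pullback σ → St) d δ)
      obtain ⟨y₂, hy₂⟩ := (H.right.smooth_right d.snd).exists_mapsTangent
        (mfderiv (𝓡 m₁) (𝓡 nσ) (Pullback.snd : Jt.Pullback σ → Sσ) d δ)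
      obtain ⟨y₃, hy₃⟩ := (H.smooth_map (toLeaf (k := k) Ω Ωt J Jh q)).exists_mapsTangent v₁
      have e1 : y₁ = y₂ := hl.right.map_eq hy₁ hy₂
      have e2 : y₃ = y₁ := H.map_eq q hl.proj hl.left hy₃ (by rw [← hr.fst_eq]; exact hy₁)
      have e3 : (mfderiv (𝓡 r') (𝓡 kt) J' w₀.fst v₁ : EuclideanSpace ℝ (Fin kt)) = y₃ := by
        change mfderiv (𝓡 r') (𝓡 kt) J' w₀.1.1 v₁ = _
        rw [hw]
        exact hy₃.map
      rw [e3, e2, e1]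
      change MapsTangent _ _ σ w₀.1.2 _ _
      rw [hw]
      exact hy₂)
  exact ⟨v, ((H.comparison_smooth_and_mapsTangent hD hΨ hw hr).2 v a δ c v₁ _ _ _ y x hv hl hx).map⟩

/-- Both directions are read on the common cover, by `exists_hamVec_of_lifts` and
`exists_lifts_of_hamVec`. One direction makes the comparison map constant on leaves; the equivalence
identifies the vertical vectors of the second reduction. -/
theorem comparison_vertical_iff (H : IsInductionInStages kt m₁ m' m r Ωσ Ωρ ρ Jt σ τ Ω' J')
    (hD : IsSmoothPullback r' nσ kt J' σ m'') (hΨ : IsComparison τ J' Ψ) (w₀ : J'.Pullback σ)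
    (v : EuclideanSpace ℝ (Fin m'')) :
    MapsTangent (𝓡 m'') (𝓡 r) Ψ w₀ v 0 ↔ ∃ g : SmoothFn kt Pt,
      HasComponents r' nσ w₀ v (Ω'.hamVec (g ∘ J') w₀.fst) (-Ωσ.hamVec (g ∘ σ) w₀.snd) := by
  obtain ⟨q, d, e, hw, hr⟩ := H.exists_related w₀
  have hw1 : w₀.fst = toLeaf (k := k) Ω Ωt J Jh q := congrArg Prod.fst hw
  have hw2 : w₀.snd = d.snd := congrArg Prod.snd hw
  constructor
  · intro h0
    obtain ⟨a, δ, c, v₁, b₁, b₂, v₂, w, x, hv, hl, hx, hxΨ⟩ := H.exists_lifts hD hΨ hw hr v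
    obtain ⟨g, h1, h2⟩ := H.exists_hamVec_of_lifts hr hl ((hxΨ.unique h0) ▸ hx)
    refine ⟨g, ?_⟩
    rw [hw1, hw2]
    exact hv.of_eq h1 h2
  · rintro ⟨g, hv⟩
    rw [hw1, hw2] at hv
    obtain ⟨y₁, hy₁⟩ := (H.smooth_map (toLeaf (k := k) Ω Ωt J Jh q)).exists_mapsTangent
      (Ω'.hamVec (g ∘ J') (toLeaf (k := k) Ω Ωt J Jh q))
    obtain ⟨y₂, hy₂⟩ := (H.right.smooth_right d.snd).exists_mapsTangent (-Ωσ.hamVec (g ∘ σ) d.snd)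
    have hy : y₁ = y₂ := hv.map_eq
      (show MapsTangent _ _ J' w₀.1.1 _ y₁ by rw [hw]; exact hy₁)
      (show MapsTangent _ _ σ w₀.1.2 _ y₂ by rw [hw]; exact hy₂)
    obtain ⟨a, δ, b₁, b₂, w, hl⟩ := H.exists_lifts_of_hamVec hr g hy₁ (hy ▸ hy₂)
    exact (H.comparison_smooth_and_mapsTangent hD hΨ hw hr).2 v a δ 0 _ _ _ _ _ 0 hv hl
      (MapsTangent.zero ((H.reduction.smooth_proj e).mdifferentiableAt (by simp)))

/-- The comparison map is constant on the leaves. -/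
theorem comparison_eq_of_leaf_eq (H : IsInductionInStages kt m₁ m' m r Ωσ Ωρ ρ Jt σ τ Ω' J')
    (hD : IsSmoothPullback r' nσ kt J' σ m'') (hΨ : IsComparison τ J' Ψ) {w w' : J'.Pullback σ}
    (h : toLeaf (k := kt) Ω' Ωσ J' σ w = toLeaf (k := kt) Ω' Ωσ J' σ w') : Ψ w = Ψ w' := by
  refine hD.leaf_constant (H.comparison_smooth hD hΨ) (fun g q a h1 h2 => ?_) h
  exact ((H.comparison_vertical_iff hD hΨ q a).2
    ⟨g, ⟨(hD.smooth_fst q).mdifferentiableAt (by simp), h1⟩,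
      ⟨(hD.smooth_snd q).mdifferentiableAt (by simp), h2⟩⟩).map

end IsInductionInStages

end Stages

/-! ### The comparison map separates leaves -/

section Stages

variable {n nt nσ nρ k kt m₁ m' m'' r' m r : ℕ} {S St Sσ Sρ P Pt : Type*}
  [TopologicalSpace S] [SmoothManifold n S] [TopologicalSpace St] [SmoothManifold nt St]
  [TopologicalSpace Sσ] [SmoothManifold nσ Sσ] [TopologicalSpace Sρ] [SmoothManifold nρ Sρ]
  [TopologicalSpace P] [SmoothManifold k P] [TopologicalSpace Pt] [SmoothManifold kt Pt]
  {Ω : SymplecticForm n S} {Ωt : SymplecticForm nt St}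
  {Ωσ : SymplecticForm nσ Sσ} {Ωρ : SymplecticForm nρ Sρ}
  {J : S → P} {ρ : Sρ → P} {Jt : St → Pt} {Jh : St → P} {σ : Sσ → Pt}
  [SmoothManifold m₁ (Jt.Pullback σ)]
  [SmoothManifold m' (J.Pullback Jh)] [SmoothManifold r' (LeafSpace (k := k) Ω Ωt J Jh)]
  [SmoothManifold m (J.Pullback ρ)] [SmoothManifold r (LeafSpace (k := k) Ω Ωρ J ρ)]
  {τ : Jt.Pullback σ → Sρ} {Ω' : SymplecticForm r' (LeafSpace (k := k) Ω Ωt J Jh)}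
  {J' : LeafSpace (k := k) Ω Ωt J Jh → Pt}

namespace IsInductionInStages

variable [SmoothManifold m'' (J'.Pullback σ)]

/-- The leaf of `([x, y], z)` depends only on `x` and `τ (y, z)`. -/
theorem exists_inverse (H : IsInductionInStages kt m₁ m' m r Ωσ Ωρ ρ Jt σ τ Ω' J') :
    ∃ Θ : J.Pullback ρ → LeafSpace (k := kt) Ω' Ωσ J' σ,
      ∀ (w : J'.Pullback σ) (q : J.Pullback Jh) (d : Jt.Pullback σ) (e : J.Pullback ρ),
        w.1 = (toLeaf (k := k) Ω Ωt J Jh q, d.snd) → AreRelated τ q d e →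
        Θ e = toLeaf (k := kt) Ω' Ωσ J' σ w := by
  classical
  choose q₀ d₀ w₀ h1 h2 using H.exists_related_of_total
  refine ⟨fun e => toLeaf (k := kt) Ω' Ωσ J' σ (w₀ e), fun w q d e hw hr => ?_⟩
  let x := e.fst
  let Q : (y : St) → J x = Jh y → J.Pullback Jh := fun y h => ⟨(x, y), h⟩
  let W : (d : Jt.Pullback σ) → J x = Jh d.fst → J'.Pullback σ := fun d h =>
    ⟨(toLeaf (k := k) Ω Ωt J Jh (Q d.fst h), d.snd), (H.map_proj _).trans d.2⟩
  -- Now x is fixed and (y, z) moves in a fibre of τ, that is, in a leaf of the fibre product of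
  -- `Jt` and `σ`. The value is `none` unless J x = Jh y.
  let g : Jt.Pullback σ → Option (LeafSpace (k := kt) Ω' Ωσ J' σ) := fun d =>
    if h : J x = Jh d.fst then some (toLeaf (k := kt) Ω' Ωσ J' σ (W d h)) else none
  -- Along a step Jh is constant, so (x, y(t)) stays in the fibre product of `J` and `Jh`. Its
  -- velocity (0, X_{f∘Jt}) projects to X_{f∘J'}, so ([x, y(t)], z(t)) is a leaf curve of `J'` and
  -- `σ`.
  have hg : ∀ a b, LeafStep (k := kt) Ωt Ωσ Jt σ a b → g a = g b := by
    rintro a b ⟨f, α, β, hα, hβ, hαβ, h1, h2, h3, h4⟩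
    have hc : ∀ t ∈ Icc (0 : ℝ) 1, Jh (α t) = Jh (α 0) := fun t ht =>
      H.constant_along_right (convex_Icc 0 1) hα ht (by simp)
    have hc1 : Jh b.fst = Jh a.fst := by
      rw [← h3, ← h1]
      exact hc 1 (by simp)
    by_cases h : J x = Jh a.fst
    · have h' : J x = Jh b.fst := h.trans hc1.symm
      have hx : ∀ t ∈ Icc (0 : ℝ) 1, J x = Jh (α t) := fun t ht =>
        h.trans ((congrArg Jh h1.symm).trans (hc t ht).symm)
      let c : ℝ → J.Pullback Jh := fun t => if h' : J x = Jh (α t) then Q (α t) h' else Q a.fst h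
      have hcQ : ∀ t (ht : t ∈ Icc (0 : ℝ) 1), c t = Q (α t) (hx t ht) := fun t ht =>
        dif_pos (hx t ht)
      have hcv : ∀ t ∈ Icc (0 : ℝ) 1, (c t).1 = (x, α t) := fun t ht => by rw [hcQ t ht]
      have hcs : ∀ t ∈ Icc (0 : ℝ) 1, (c t).snd = α t := fun t ht => congrArg Prod.snd (hcv t ht)
      have e0 : c 0 = Q a.fst h :=
        Subtype.ext ((hcv 0 (by simp)).trans (congrArg (fun y => (x, y)) h1))
      have e1 : c 1 = Q b.fst h' :=
        Subtype.ext ((hcv 1 (by simp)).trans (congrArg (fun y => (x, y)) h3))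
      simp only [g, dif_pos h, dif_pos h']
      refine congrArg some (Quotient.sound (Relation.EqvGen.rel _ _
        ⟨f, toLeaf (k := k) Ω Ωt J Jh ∘ c, β, fun t ht => ?_, hβ, fun t ht => ?_,
          congrArg _ e0, h2, congrArg _ e1, h4⟩))
      · have hx' : HasMFDerivWithinAt 𝓘(ℝ, ℝ) (𝓡 n) (fun _ : ℝ => x) (Icc 0 1) t
            ((1 : ℝ →L[ℝ] ℝ).smulRight (0 : EuclideanSpace ℝ (Fin n))) := by
          have e : (1 : ℝ →L[ℝ] ℝ).smulRight (0 : EuclideanSpace ℝ (Fin n)) = 0 :=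
            ContinuousLinearMap.smulRight_zero _
          exact e.symm ▸ hasMFDerivWithinAt_const (I := 𝓘(ℝ, ℝ)) (I' := 𝓡 n) x _ t
        obtain ⟨a, ha, g1, g2⟩ :=
          H.left.exists_velocity (uniqueDiffOn_Icc_zero_one t ht) hcv hx' (hα t ht) ht
        have g3 : HasComponents n nt (c t) a 0 (Ωt.hamVec (f ∘ Jt) (c t).snd) := by
          refine (H.left.hasComponents (c t) a).of_eq g1 (g2.trans ?_)
          rw [hcs t ht]
        exact (H.proj_hamVec f (c t) a g3).curve ha
      · refine (H.map_proj (c t)).trans ?_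
        rw [hcs t ht]
        exact hαβ t ht
    · have h' : ¬ J x = Jh b.fst := fun h' => h (h'.trans hc1)
      simp only [g, dif_neg h, dif_neg h']
  have key : ∀ (w : J'.Pullback σ) (q : J.Pullback Jh) (d : Jt.Pullback σ),
      w.1 = (toLeaf (k := k) Ω Ωt J Jh q, d.snd) → AreRelated τ q d e →
      g d = some (toLeaf (k := kt) Ω' Ωσ J' σ w) := by
    intro w q d hw hr
    have hqx : q.fst = x := (congrArg Prod.fst hr.val_eq).symm
    have hJ : J x = Jh d.fst := by
      rw [← hqx, hr.fst_eq]
      exact q.2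
    have hQ : Q d.fst hJ = q := Subtype.ext (Prod.ext hqx.symm hr.fst_eq)
    have hW : W d hJ = w :=
      Subtype.ext ((congrArg (fun q => (toLeaf (k := k) Ω Ωt J Jh q, d.snd)) hQ).trans hw.symm)
    simp only [g, dif_pos hJ, hW]
  have hdd : toLeaf (k := kt) Ωt Ωσ Jt σ (d₀ e) = toLeaf (k := kt) Ωt Ωσ Jt σ d :=
    (H.eq_iff _ _).1 ((congrArg Prod.snd (h2 e).val_eq).symm.trans (congrArg Prod.snd hr.val_eq))
  have h3 := leaf_induction hg hdd
  rw [key _ _ _ (h1 e) (h2 e), key _ _ _ hw hr] at h3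
  exact Option.some.inj h3

/-- The projection to the reduced space is constant along Hamiltonian curves. -/
theorem proj_constant (H : IsInductionInStages kt m₁ m' m r Ωσ Ωρ ρ Jt σ τ Ω' J')
    {f : SmoothFn k P} {s : Set ℝ} (hs : Convex ℝ s) {γ : ℝ → S} {y : ℝ → St}
    (hγ : IsMIntegralCurveOn (I := 𝓡 n) γ (fun x => Ω.hamVec (f ∘ J) x) s)
    (hy : IsMIntegralCurveOn (I := 𝓡 nt) y (fun y => -Ωt.hamVec (f ∘ Jh) y) s)
    (hJ : ∀ t ∈ s, J (γ t) = Jh (y t)) {t₁ t₂ : ℝ} (h₁ : t₁ ∈ s) (h₂ : t₂ ∈ s)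
    {q₁ q₂ : J.Pullback Jh} (hq₁ : q₁.1 = (γ t₁, y t₁)) (hq₂ : q₂.1 = (γ t₂, y t₂)) :
    toLeaf (k := k) Ω Ωt J Jh q₁ = toLeaf (k := k) Ω Ωt J Jh q₂ :=
  H.left.constant_along_curve H.leftReduction.smooth_proj
    (fun q a h1 h2 => (H.leftReduction.vertical_iff q a).2 ⟨f, h1, h2⟩) hs hγ hy hJ h₁ h₂ hq₁ hq₂

/-- The comparison map separates the leaves. -/
theorem leaf_eq_of_comparison_eq (H : IsInductionInStages kt m₁ m' m r Ωσ Ωρ ρ Jt σ τ Ω' J')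
    {Ψ : J'.Pullback σ → LeafSpace (k := k) Ω Ωρ J ρ}
    (hΨ : IsComparison τ J' Ψ) {w w' : J'.Pullback σ} (h : Ψ w = Ψ w') :
    toLeaf (k := kt) Ω' Ωσ J' σ w = toLeaf (k := kt) Ω' Ωσ J' σ w' := by
  classical
  obtain ⟨Θ, hΘ⟩ := H.exists_inverse
  obtain ⟨q, d, e, hw, hr⟩ := H.exists_related w
  obtain ⟨q', d', e', hw', hr'⟩ := H.exists_related w'
  rw [hΨ w q d e hw hr, hΨ w' q' d' e' hw' hr'] at h
  rw [← hΘ w q d e hw hr, ← hΘ w' q' d' e' hw' hr']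
  refine leaf_induction ?_ h
  rintro a b ⟨f, γ, δ, hγ, hδ, hJ, h1, h2, h3, h4⟩
  let c : ℝ → J.Pullback ρ := fun t => if h : J (γ t) = ρ (δ t) then ⟨(γ t, δ t), h⟩ else a
  have hcv : ∀ t ∈ Icc (0 : ℝ) 1, (c t).1 = (γ t, δ t) := fun t ht => by
    simp only [c, dif_pos (hJ t ht)]
  have e0 : c 0 = a := Subtype.ext ((hcv 0 (by simp)).trans (Prod.ext h1 h2))
  have e1 : c 1 = b := Subtype.ext ((hcv 1 (by simp)).trans (Prod.ext h3 h4))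
  rw [← e0, ← e1]
  -- The flows upstairs need not be complete, so a leaf curve is lifted only near each t₀; local
  -- constancy of Θ suffices.
  refine eq_of_locally_constant_Icc (f := fun t => Θ (c t)) fun t₀ ht₀ => ?_
  obtain ⟨d₀, hd₀⟩ := H.surjective (δ t₀)
  have hX : ContMDiff (𝓡 nt) (𝓡 nt).tangent ∞
      (fun y => (⟨y, -Ωt.hamVec (f ∘ Jh) y⟩ : TangentBundle (𝓡 nt) St)) := by
    have h5 := Ωt.contMDiff_hamVec (f.contMDiff.comp H.left.smooth_right).neg
    exact h5.congr fun y => by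
      rw [← Ωt.hamVec_neg]
      rfl
  have hX' : ContMDiff (𝓡 nρ) (𝓡 nρ).tangent ∞
      (fun y => (⟨y, -Ωρ.hamVec (f ∘ ρ) y⟩ : TangentBundle (𝓡 nρ) Sρ)) := by
    have h5 := Ωρ.contMDiff_hamVec (f.contMDiff.comp H.total.smooth_right).neg
    exact h5.congr fun y => by
      rw [← Ωρ.hamVec_neg]
      rfl
  -- From a point d₀ over δ t₀, follow -X_{f∘Jh} with z fixed. By uniqueness of integral curves
  -- τ(y(t), z) = δ t near t₀.
  obtain ⟨y, hy0, hy⟩ := exists_isMIntegralCurveAt_of_contMDiffAt_boundaryless (I := 𝓡 nt) t₀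
    ((hX d₀.fst).of_le (n := ∞) (m := 1) (by simp))
  obtain ⟨ε, hε, hyε⟩ := isMIntegralCurveAt_iff'.1 hy
  have hball : Convex ℝ (Metric.ball t₀ ε) := convex_ball t₀ ε
  have hz : ∀ t ∈ Metric.ball t₀ ε, Jt (y t) = σ d₀.snd := fun t ht =>
    (H.constant_along_left hball hyε ht (Metric.mem_ball_self hε)).trans
      ((congrArg Jt hy0).trans d₀.2)
  let D : ℝ → Jt.Pullback σ := fun t =>
    if h : Jt (y t) = σ d₀.snd then ⟨(y t, d₀.snd), h⟩ else d₀
  have hDv : ∀ t ∈ Metric.ball t₀ ε, (D t).1 = (y t, d₀.snd) := fun t ht => by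
    simp only [D, dif_pos (hz t ht)]
  have hD0 : D t₀ = d₀ :=
    Subtype.ext ((hDv t₀ (Metric.mem_ball_self hε)).trans (Prod.ext hy0 rfl))
  have hτD := H.isMIntegralCurveOn_comp Metric.isOpen_ball.uniqueDiffOn hyε hDv
  have hτD' := hτD.isMIntegralCurveAt (Metric.ball_mem_nhds t₀ hε)
  have hev := isMIntegralCurveOn_Icc_eventuallyEq hX' hδ ht₀ hτD'
    ((congrArg τ hD0).trans hd₀)
  obtain ⟨η, hη, hev'⟩ := Metric.mem_nhdsWithin_iff.1 hev
  set s : Set ℝ := Metric.ball t₀ (min ε η) ∩ Icc 0 1 with hs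
  have hsε : s ⊆ Metric.ball t₀ ε := fun t ht => Metric.ball_subset_ball (min_le_left _ _) ht.1
  have hsI : s ⊆ Icc 0 1 := inter_subset_right
  have hsτ : ∀ t ∈ s, τ (D t) = δ t := fun t ht =>
    hev' ⟨Metric.ball_subset_ball (min_le_right _ _) ht.1, ht.2⟩
  have hsc : Convex ℝ s := (convex_ball _ _).inter (convex_Icc 0 1)
  have hst₀ : t₀ ∈ s := ⟨Metric.mem_ball_self (lt_min hε hη), ht₀⟩
  have hJh : ∀ t ∈ s, J (γ t) = Jh (y t) := fun t ht => by
    have h6 := H.momentum (D t)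
    rw [hsτ t ht] at h6
    exact (hJ t (hsI ht)).trans (h6.trans (congrArg Jh (congrArg Prod.fst (hDv t (hsε ht)))))
  let q₀ : J.Pullback Jh := ⟨(γ t₀, y t₀), hJh t₀ hst₀⟩
  let w₀ : J'.Pullback σ := ⟨(toLeaf (k := k) Ω Ωt J Jh q₀, d₀.snd),
    (H.map_proj q₀).trans (hz t₀ (hsε hst₀))⟩
  -- Along the lifted curve z is fixed, and [γ t, y t] is constant because (γ, y) follows a leaf of
  -- `J` and `Jh`; so all c t lie under the same point w₀.
  have hall : ∀ t ∈ s, Θ (c t) = toLeaf (k := kt) Ω' Ωσ J' σ w₀ := by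
    intro t ht
    refine hΘ w₀ ⟨(γ t, y t), hJh t ht⟩ (D t) (c t) ?_ ⟨congrArg Prod.fst (hDv t (hsε ht)), ?_⟩
    · refine Prod.ext ?_ (congrArg Prod.snd (hDv t (hsε ht))).symm
      exact H.proj_constant hsc (hγ.mono hsI) (hyε.mono hsε) hJh hst₀ ht rfl rfl
    · rw [hcv t (hsI ht), hsτ t ht]
      rfl
  have hmem : s ∈ 𝓝[Icc 0 1] t₀ := by
    rw [hs, inter_comm]
    exact inter_mem_nhdsWithin _ (Metric.ball_mem_nhds t₀ (lt_min hε hη))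
  filter_upwards [hmem] with t ht
  exact (hall t ht).trans (hall t₀ hst₀).symm

theorem comparison_surjective (H : IsInductionInStages kt m₁ m' m r Ωσ Ωρ ρ Jt σ τ Ω' J')
    {Ψ : J'.Pullback σ → LeafSpace (k := k) Ω Ωρ J ρ} (hΨ : IsComparison τ J' Ψ) :
    Surjective Ψ := by
  intro x
  obtain ⟨e, rfl⟩ := toLeaf_surjective x
  obtain ⟨q, d, w, hw, hr⟩ := H.exists_related_of_total e
  exact ⟨w, hΨ w q d e hw hr⟩

end IsInductionInStages

end Stages

/-! ### The diffeomorphism of the reduced spaces and their symplectic forms -/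

section Stages

variable {n nt nσ nρ k kt m₁ m' m'' r'' r' m r : ℕ} {S St Sσ Sρ P Pt : Type*}
  [TopologicalSpace S] [SmoothManifold n S] [TopologicalSpace St] [SmoothManifold nt St]
  [TopologicalSpace Sσ] [SmoothManifold nσ Sσ] [TopologicalSpace Sρ] [SmoothManifold nρ Sρ]
  [TopologicalSpace P] [SmoothManifold k P] [TopologicalSpace Pt] [SmoothManifold kt Pt]
  {Ω : SymplecticForm n S} {Ωt : SymplecticForm nt St}
  {Ωσ : SymplecticForm nσ Sσ} {Ωρ : SymplecticForm nρ Sρ}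
  {J : S → P} {ρ : Sρ → P} {Jt : St → Pt} {Jh : St → P} {σ : Sσ → Pt}
  [SmoothManifold m₁ (Jt.Pullback σ)]
  [SmoothManifold m' (J.Pullback Jh)] [SmoothManifold r' (LeafSpace (k := k) Ω Ωt J Jh)]
  [SmoothManifold m (J.Pullback ρ)] [SmoothManifold r (LeafSpace (k := k) Ω Ωρ J ρ)]
  {τ : Jt.Pullback σ → Sρ} {Ω' : SymplecticForm r' (LeafSpace (k := k) Ω Ωt J Jh)}
  {J' : LeafSpace (k := k) Ω Ωt J Jh → Pt}

theorem SymplecticForm.form_congr (Ω : SymplecticForm n S) {x y : S} (h : x = y)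
    (u v : EuclideanSpace ℝ (Fin n)) : Ω.form x ![u, v] = Ω.form y ![u, v] := by
  subst h
  rfl

theorem PullsBackToProduct.form_eq {N : Type*} [TopologicalSpace N] [SmoothManifold r' N]
    {ΩR : SymplecticForm r' N} {p : J.Pullback ρ → N} (h : PullsBackToProduct Ω Ωρ J ρ m ΩR p)
    {q : J.Pullback ρ} {a b : EuclideanSpace ℝ (Fin m)} {x y : EuclideanSpace ℝ (Fin r')}
    {u u' : EuclideanSpace ℝ (Fin n)} {v v' : EuclideanSpace ℝ (Fin nρ)}
    (hx : MapsTangent (𝓡 m) (𝓡 r') p q a x) (hy : MapsTangent (𝓡 m) (𝓡 r') p q b y)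
    (ha : HasComponents n nρ q a u v) (hb : HasComponents n nρ q b u' v') :
    ΩR.form (p q) ![x, y] = Ω.form q.fst ![u, u'] + Ωρ.form q.snd ![v, v'] := by
  obtain ⟨-, rfl⟩ := hx
  obtain ⟨-, rfl⟩ := hy
  obtain ⟨⟨-, rfl⟩, ⟨-, rfl⟩⟩ := ha
  obtain ⟨⟨-, rfl⟩, ⟨-, rfl⟩⟩ := hb
  exact h q a b

theorem isOpenMap_of_submersion {n m : ℕ} {M N : Type*} [TopologicalSpace M] [SmoothManifold n M]
    [TopologicalSpace N] [SmoothManifold m N] {f : M → N} (hf : ContMDiff (𝓡 n) (𝓡 m) ∞ f)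
    (hs : ∀ x, Surjective (mfderiv (𝓡 n) (𝓡 m) f x)) : IsOpenMap f := by
  refine isOpenMap_iff_nhds_le.2 fun x => ?_
  obtain ⟨κ, h0, hκ⟩ := exists_local_section (I := 𝓡 n) (I' := 𝓡 m)
    (Eventually.of_forall fun x => hf x) (hs x)
  intro U hU
  have h1 : κ ⁻¹' (f ⁻¹' U) ∈ 𝓝 (f x) := by
    refine hκ.self_of_nhds.1.continuousAt ?_
    rw [h0]
    exact hU
  filter_upwards [h1, hκ] with y hy hy'
  rw [← hy'.2]
  exact hy

namespace IsInductionInStages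

/-- The reduction in two stages is diffeomorphic to the reduction in one stage. -/
theorem exists_reduction (H : IsInductionInStages kt m₁ m' m r Ωσ Ωρ ρ Jt σ τ Ω' J') :
    ∃ (m'' : ℕ) (_ : SmoothManifold m'' (J'.Pullback σ))
      (_ : SmoothManifold r (LeafSpace (k := kt) Ω' Ωσ J' σ))
      (Φ : LeafSpace (k := kt) Ω' Ωσ J' σ ≃ₘ⟮𝓡 r, 𝓡 r⟯ LeafSpace (k := k) Ω Ωρ J ρ)
      (Ψ : J'.Pullback σ → LeafSpace (k := k) Ω Ωρ J ρ),
      IsSmoothPullback r' nσ kt J' σ m'' ∧ IsManifoldReduction (k := kt) Ω' Ωσ J' σ m'' r ∧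
      IsComparison τ J' Ψ ∧ ∀ w, Φ (toLeaf (k := kt) Ω' Ωσ J' σ w) = Ψ w := by
  obtain ⟨m'', sm, hD⟩ := H.exists_smoothManifold
  obtain ⟨Ψ, hΨ⟩ := H.exists_comparison
  have hΨs := H.comparison_smooth hD hΨ
  have hΨo : IsOpenMap Ψ := isOpenMap_of_submersion hΨs (H.comparison_submersion hD hΨ)
  -- φ is open because Ψ, a submersion, is open, and bijective because Ψ is onto and separates
  -- leaves. A continuous open bijection is a homeomorphism, so the leaf space receives the smooth
  -- structure of the other one.
  let φ : LeafSpace (k := kt) Ω' Ωσ J' σ → LeafSpace (k := k) Ω Ωρ J ρ :=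
    Quotient.lift Ψ fun a b hab => H.comparison_eq_of_leaf_eq hD hΨ (Quotient.sound hab)
  have hφ : ∀ w, φ (toLeaf (k := kt) Ω' Ωσ J' σ w) = Ψ w := fun w => rfl
  have hφc : Continuous φ := hΨs.continuous.quotient_lift _
  have hφo : IsOpenMap φ := by
    intro U hU
    have h1 : φ '' U = Ψ '' (toLeaf (k := kt) Ω' Ωσ J' σ ⁻¹' U) := by
      ext x
      constructor
      · rintro ⟨y, hy, rfl⟩
        obtain ⟨w, rfl⟩ := toLeaf_surjective y
        exact ⟨w, hy, rfl⟩
      · rintro ⟨w, hw, rfl⟩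
        exact ⟨_, hw, rfl⟩
    rw [h1]
    exact hΨo _ (hU.preimage continuous_quotient_mk')
  have hφb : Bijective φ := by
    constructor
    · intro a b hab
      obtain ⟨w, rfl⟩ := toLeaf_surjective a
      obtain ⟨w', rfl⟩ := toLeaf_surjective b
      exact H.leaf_eq_of_comparison_eq hΨ hab
    · intro x
      obtain ⟨w, rfl⟩ := H.comparison_surjective hΨ x
      exact ⟨toLeaf (k := kt) Ω' Ωσ J' σ w, rfl⟩
  let e := (Equiv.ofBijective φ hφb).toHomeomorphOfContinuousOpen hφc hφo
  obtain ⟨sr, Φ, hΦ⟩ := exists_smoothManifold_of_homeomorph (r := r) e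
  have hΦΨ : ∀ w, Φ (toLeaf (k := kt) Ω' Ωσ J' σ w) = Ψ w := fun w => hΦ _
  -- The projection is Ψ up to a diffeomorphism and inherits smoothness, submersivity and vertical
  -- vectors from it.
  have hp : toLeaf (k := kt) Ω' Ωσ J' σ = Φ.symm ∘ Ψ := by
    funext w
    rw [comp_apply, ← hΦΨ]
    exact (Φ.symm_apply_apply _).symm
  have hps : ContMDiff (𝓡 m'') (𝓡 r) ∞ (toLeaf (k := kt) Ω' Ωσ J' σ) := by
    rw [hp]
    exact Φ.symm.contMDiff.comp hΨs
  have hto : ∀ (w : J'.Pullback σ) (v : EuclideanSpace ℝ (Fin m'')) x y,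
      MapsTangent (𝓡 m'') (𝓡 r) Ψ w v x →
      MapsTangent (𝓡 r) (𝓡 r) Φ.symm (Ψ w) x y →
      MapsTangent (𝓡 m'') (𝓡 r) (toLeaf (k := kt) Ω' Ωσ J' σ) w v y := by
    intro w v x y h1 h2
    rw [hp]
    exact h2.comp h1
  have hfrom : ∀ (w : J'.Pullback σ) (v : EuclideanSpace ℝ (Fin m'')) y x,
      MapsTangent (𝓡 m'') (𝓡 r) (toLeaf (k := kt) Ω' Ωσ J' σ) w v y →
      MapsTangent (𝓡 r) (𝓡 r) Φ (toLeaf (k := kt) Ω' Ωσ J' σ w) y x →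
      MapsTangent (𝓡 m'') (𝓡 r) Ψ w v x := fun w v y x h1 h2 =>
    (h2.comp h1).congr (Eventually.of_forall fun w => (hΦΨ w).symm)
  have hz : ∀ (w : J'.Pullback σ) (v : EuclideanSpace ℝ (Fin m'')),
      mfderiv (𝓡 m'') (𝓡 r) (toLeaf (k := kt) Ω' Ωσ J' σ) w v = 0 ↔
        MapsTangent (𝓡 m'') (𝓡 r) Ψ w v 0 := fun w v =>
    ⟨fun h => hfrom w v 0 0 ⟨(hps w).mdifferentiableAt (by simp), h⟩
        (MapsTangent.zero (Φ.contMDiff.mdifferentiable (by simp) _)),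
      fun h => (hto w v 0 0 h
        (MapsTangent.zero (Φ.symm.contMDiff.mdifferentiable (by simp) _))).map⟩
  refine ⟨m'', sm, sr, Φ, Ψ, hD, ⟨hD.smooth_fst, hD.smooth_snd, hD.immersion, ?_, hps, ?_, ?_⟩,
    hΨ, hΦΨ⟩
  · intro q u v
    refine ⟨?_, hD.exists_lift q u v⟩
    rintro ⟨a, rfl, rfl⟩
    exact (hD.hasComponents q a).map_eq ((hD.smooth_left _).mapsTangent _)
      ((hD.smooth_right _).mapsTangent _)
  · intro w y
    obtain ⟨x, hx⟩ := (Φ.contMDiff (toLeaf (k := kt) Ω' Ωσ J' σ w)).exists_mapsTangent y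
    obtain ⟨v, hv⟩ := H.comparison_submersion hD hΨ w x
    have hv' : MapsTangent (𝓡 m'') (𝓡 r) Ψ w v x := ⟨(hΨs w).mdifferentiableAt (by simp), hv⟩
    have hy := hx.of_leftInverse (I' := 𝓡 r) (g := Φ.symm)
      (Φ.symm.contMDiff.mdifferentiable (by simp) _)
      (Eventually.of_forall fun s => Φ.symm_apply_apply s)
    rw [hΦΨ] at hy
    exact ⟨v, (hto w v x y hv' hy).map⟩
  · intro w v
    refine ((hz w v).trans (H.comparison_vertical_iff hD hΨ w v)).trans ?_
    exact ⟨fun ⟨g, hg⟩ => ⟨g, hg.fst.map, hg.snd.map⟩, fun ⟨g, h1, h2⟩ =>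
      ⟨g, ⟨(hD.smooth_fst w).mdifferentiableAt (by simp), h1⟩,
        ⟨(hD.smooth_snd w).mdifferentiableAt (by simp), h2⟩⟩⟩

/-- The diffeomorphism of the reductions is a symplectomorphism. -/
theorem isSymplectomorphism (H : IsInductionInStages kt m₁ m' m r Ωσ Ωρ ρ Jt σ τ Ω' J')
    [SmoothManifold m'' (J'.Pullback σ)] [SmoothManifold r'' (LeafSpace (k := kt) Ω' Ωσ J' σ)]
    (hD : IsSmoothPullback r' nσ kt J' σ m'')
    (hR : IsManifoldReduction (k := kt) Ω' Ωσ J' σ m'' r'')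
    {Φ : LeafSpace (k := kt) Ω' Ωσ J' σ ≃ₘ⟮𝓡 r'', 𝓡 r⟯ LeafSpace (k := k) Ω Ωρ J ρ}
    {Ψ : J'.Pullback σ → LeafSpace (k := k) Ω Ωρ J ρ} (hΨ : IsComparison τ J' Ψ)
    (hΦ : ∀ w, Φ (toLeaf (k := kt) Ω' Ωσ J' σ w) = Ψ w)
    {Ω'' : SymplecticForm r'' (LeafSpace (k := kt) Ω' Ωσ J' σ)}
    {ΩR : SymplecticForm r (LeafSpace (k := k) Ω Ωρ J ρ)}
    (hT : PullsBackToProduct Ωt Ωσ Jt σ m₁ Ωρ τ)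
    (hΩ' : PullsBackToProduct Ω Ωt J Jh m' Ω' (toLeaf (k := k) Ω Ωt J Jh))
    (hΩR : PullsBackToProduct Ω Ωρ J ρ m ΩR (toLeaf (k := k) Ω Ωρ J ρ))
    (hΩ'' : PullsBackToProduct Ω' Ωσ J' σ m'' Ω'' (toLeaf (k := kt) Ω' Ωσ J' σ)) :
    IsSymplectomorphism Ω'' ΩR Φ := by
  intro s u v
  obtain ⟨w₀, rfl⟩ := toLeaf_surjective s
  obtain ⟨ut, hut⟩ := hR.submersion w₀ u
  obtain ⟨vt, hvt⟩ := hR.submersion w₀ v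
  have hut' : MapsTangent (𝓡 m'') (𝓡 r'') (toLeaf (k := kt) Ω' Ωσ J' σ) w₀ ut u :=
    ⟨(hR.smooth_proj w₀).mdifferentiableAt (by simp), hut⟩
  have hvt' : MapsTangent (𝓡 m'') (𝓡 r'') (toLeaf (k := kt) Ω' Ωσ J' σ) w₀ vt v :=
    ⟨(hR.smooth_proj w₀).mdifferentiableAt (by simp), hvt⟩
  obtain ⟨q, d, e, hw, hr⟩ := H.exists_related w₀
  obtain ⟨a, δ, c, v₁, b₁, b₂, v₂, w, x, hv, hl, hx, hxΨ⟩ := H.exists_lifts hD hΨ hw hr ut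
  obtain ⟨a', δ', c', v₁', b₁', b₂', v₂', w', x', hv', hl', hx', hxΨ'⟩ :=
    H.exists_lifts hD hΨ hw hr vt
  have hwx : ∀ {a : EuclideanSpace ℝ (Fin m'')} {b : EuclideanSpace ℝ (Fin r'')}
      {x : EuclideanSpace ℝ (Fin r)},
      MapsTangent (𝓡 m'') (𝓡 r'') (toLeaf (k := kt) Ω' Ωσ J' σ) w₀ a b →
      MapsTangent (𝓡 m'') (𝓡 r) Ψ w₀ a x →
      (mfderiv (𝓡 r'') (𝓡 r) Φ (toLeaf (k := kt) Ω' Ωσ J' σ w₀) b :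
        EuclideanSpace ℝ (Fin r)) = x := by
    intro a b x h1 h2
    have h3 := ((Φ.contMDiff (toLeaf (k := kt) Ω' Ωσ J' σ w₀)).mapsTangent b).comp h1
    exact (h3.congr (Eventually.of_forall fun w => (hΦ w).symm)).unique h2
  have e1 := hwx hut' hxΨ
  have e2 := hwx hvt' hxΨ'
  have e3 : Φ (toLeaf (k := kt) Ω' Ωσ J' σ w₀) = toLeaf (k := k) Ω Ωρ J ρ e :=
    (hΦ w₀).trans (hΨ w₀ q d e hw hr)
  -- On lifts to the common cover, f1 and f2 expand the form of the target, f3 and f4 that of the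
  -- source; both become Ω + Ωt + Ωσ.
  have f1 := hΩR.form_eq hx hx' hl.total hl'.total
  have f2 := hT.form_eq hl.map hl'.map hl.right hl'.right
  have f3 := hΩ'.form_eq hl.proj hl'.proj hl.left hl'.left
  have f4 := hΩ''.form_eq hut' hvt' hv hv'
  have g1 := Ω.form_congr (congrArg Prod.fst hr.val_eq : e.fst = q.fst) b₁ b₁'
  have g2 := Ωρ.form_congr (congrArg Prod.snd hr.val_eq : e.snd = τ d) w w'
  have g3 := Ωt.form_congr hr.fst_eq b₂ b₂'
  have g4 := Ω'.form_congr (congrArg Prod.fst hw : w₀.fst = toLeaf (k := k) Ω Ωt J Jh q) v₁ v₁'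
  have g5 := Ωσ.form_congr (congrArg Prod.snd hw : w₀.snd = d.snd) v₂ v₂'
  have g6 := ΩR.form_congr e3 x x'
  have lhs : ΩR.form (Φ (toLeaf (k := kt) Ω' Ωσ J' σ w₀))
      ![mfderiv (𝓡 r'') (𝓡 r) Φ (toLeaf (k := kt) Ω' Ωσ J' σ w₀) u,
        mfderiv (𝓡 r'') (𝓡 r) Φ (toLeaf (k := kt) Ω' Ωσ J' σ w₀) v] =
      ΩR.form (Φ (toLeaf (k := kt) Ω' Ωσ J' σ w₀)) ![x, x'] := by
    exact congrArg₂ (fun y y' : EuclideanSpace ℝ (Fin r) =>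
      ΩR.form (Φ (toLeaf (k := kt) Ω' Ωσ J' σ w₀)) ![y, y']) e1 e2
  refine lhs.trans (g6.trans (f1.trans (Eq.trans (congrArg₂ (· + ·) g1 (g2.trans f2)) ?_)))
  refine Eq.trans ?_ (f4.trans (congrArg₂ (· + ·) (g4.trans f3) g5)).symm
  exact (add_assoc _ _ _).symm.trans
    (congrArg₂ (· + ·) (congrArg₂ (· + ·) rfl g3) rfl)

end IsInductionInStages

end Stages

/-! ### Brackets, representations and verification of the data -/

section Stages

variable {n nt nσ nρ k kt m₁ m' m'' r'' r' m r : ℕ} {S St Sσ Sρ P Pt : Type*}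
  [TopologicalSpace S] [SmoothManifold n S] [TopologicalSpace St] [SmoothManifold nt St]
  [TopologicalSpace Sσ] [SmoothManifold nσ Sσ] [TopologicalSpace Sρ] [SmoothManifold nρ Sρ]
  [TopologicalSpace P] [SmoothManifold k P] [TopologicalSpace Pt] [SmoothManifold kt Pt]
  {Ω : SymplecticForm n S} {Ωt : SymplecticForm nt St}
  {Ωσ : SymplecticForm nσ Sσ} {Ωρ : SymplecticForm nρ Sρ}
  {J : S → P} {ρ : Sρ → P} {Jt : St → Pt} {Jh : St → P} {σ : Sσ → Pt}
  [SmoothManifold m₁ (Jt.Pullback σ)]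
  [SmoothManifold m' (J.Pullback Jh)] [SmoothManifold r' (LeafSpace (k := k) Ω Ωt J Jh)]
  [SmoothManifold m (J.Pullback ρ)] [SmoothManifold r (LeafSpace (k := k) Ω Ωρ J ρ)]
  {τ : Jt.Pullback σ → Sρ} {Ω' : SymplecticForm r' (LeafSpace (k := k) Ω Ωt J Jh)}
  {J' : LeafSpace (k := k) Ω Ωt J Jh → Pt}

theorem IsSymplectomorphism.bracket_comp {Φ : S ≃ₘ⟮𝓡 n, 𝓡 nρ⟯ Sρ}
    (hΦ : IsSymplectomorphism Ω Ωρ Φ) {F G : Sρ → ℝ} (hF : ContMDiff (𝓡 nρ) 𝓘(ℝ, ℝ) ∞ F)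
    (hG : ContMDiff (𝓡 nρ) 𝓘(ℝ, ℝ) ∞ G) (x : S) :
    Ω.bracket (F ∘ Φ) (G ∘ Φ) x = Ωρ.bracket F G (Φ x) := by
  have hd : ∀ {F : Sρ → ℝ}, ContMDiff (𝓡 nρ) 𝓘(ℝ, ℝ) ∞ F →
      ∀ v : TangentSpace (𝓡 n) x, mfderiv (𝓡 n) 𝓘(ℝ, ℝ) (F ∘ Φ) x v =
        mfderiv (𝓡 nρ) 𝓘(ℝ, ℝ) F (Φ x) (mfderiv (𝓡 n) (𝓡 nρ) Φ x v) := by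
    intro F hF v
    have h1 := (((hF (Φ x)).mdifferentiableAt (by simp)).hasMFDerivAt.comp x
      ((Φ.contMDiff x).mdifferentiableAt (by simp)).hasMFDerivAt).mfderiv
    exact congrArg (fun l : EuclideanSpace ℝ (Fin n) →L[ℝ] ℝ => l v) h1
  have h1 : mfderiv (𝓡 n) (𝓡 nρ) Φ x (Ω.hamVec (F ∘ Φ) x) = Ωρ.hamVec F (Φ x) := by
    refine Ωρ.eq_hamVec fun w => ?_
    obtain ⟨w, rfl⟩ := (Φ.mfderivToContinuousLinearEquiv (by simp) x).surjective w
    exact (hΦ x w _).trans ((Ω.hamVec_spec _ x w).trans (hd hF w))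
  refine (hd hG _).trans ?_
  rw [h1]
  rfl

/-- X_F is the projection of (X_f, 0), while G comes from the second factor only, so its derivative
along X_F is zero. -/
theorem IsManifoldReduction.bracket_descended_fst_snd
    (h : IsManifoldReduction (k := k) Ω Ωρ J ρ m r)
    {ΩR : SymplecticForm r (LeafSpace (k := k) Ω Ωρ J ρ)}
    (hR : PullsBackToProduct Ω Ωρ J ρ m ΩR (toLeaf (k := k) Ω Ωρ J ρ))
    {F G : LeafSpace (k := k) Ω Ωρ J ρ → ℝ} {f : S → ℝ} {g : Sρ → ℝ}
    (hF : ContMDiff (𝓡 r) 𝓘(ℝ, ℝ) ∞ F) (hf : ContMDiff (𝓡 n) 𝓘(ℝ, ℝ) ∞ f)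
    (hFp : ∀ q, F (toLeaf (k := k) Ω Ωρ J ρ q) = f q.fst)
    (hG : ContMDiff (𝓡 r) 𝓘(ℝ, ℝ) ∞ G) (hg : ContMDiff (𝓡 nρ) 𝓘(ℝ, ℝ) ∞ g)
    (hGp : ∀ q, G (toLeaf (k := k) Ω Ωρ J ρ q) = g q.snd) (q : J.Pullback ρ)
    (hfJ : mfderiv (𝓡 n) (𝓡 k) J q.fst (Ω.hamVec f q.fst) = 0) :
    ΩR.bracket F G (toLeaf (k := k) Ω Ωρ J ρ q) = 0 := by
  have h0 : ContMDiff (𝓡 nρ) 𝓘(ℝ, ℝ) ∞ (fun _ : Sρ => (0 : ℝ)) := contMDiff_const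
  have h0' : ContMDiff (𝓡 n) 𝓘(ℝ, ℝ) ∞ (fun _ : S => (0 : ℝ)) := contMDiff_const
  rw [h.bracket_descended hR hF hf h0 (fun q => by rw [hFp, add_zero]) hG h0' hg
    (fun q => by rw [hGp, zero_add]) q
    (by rw [hfJ, Ωρ.hamVec_zero]; exact (map_zero _).symm)]
  have e1 : Ω.bracket f (fun _ => 0) q.fst = 0 := by
    rw [SymplecticForm.bracket, mfderiv_const]
    rfl
  have e2 : Ωρ.bracket (fun _ => 0) g q.snd = 0 := by
    rw [SymplecticForm.bracket, Ωρ.hamVec_zero]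
    exact map_zero _
  rw [e1, e2, add_zero]

/-- The pull-back of a representation along a diffeomorphism. -/
def representationComp {A : NonUnitalSubalgebra ℝ (SmoothFn n S)}
    {R : Type*} [TopologicalSpace R] [SmoothManifold r R]
    {R' : Type*} [TopologicalSpace R'] [SmoothManifold r' R']
    (φ : A →ₙₐ[ℝ] SmoothFn r R) (Φ : R' ≃ₘ⟮𝓡 r', 𝓡 r⟯ R) : A →ₙₐ[ℝ] SmoothFn r' R' where
  toFun f := ⟨φ f ∘ Φ, (φ f).contMDiff.comp Φ.contMDiff⟩
  map_smul' c f := by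
    ext x
    exact congrArg (fun g : SmoothFn r R => g (Φ x)) (map_smul φ c f)
  map_zero' := by
    ext x
    exact congrArg (fun g : SmoothFn r R => g (Φ x)) (map_zero φ)
  map_add' f g := by
    ext x
    exact congrArg (fun g : SmoothFn r R => g (Φ x)) (map_add φ f g)
  map_mul' f g := by
    ext x
    exact congrArg (fun g : SmoothFn r R => g (Φ x)) (map_mul φ f g)

/-- The data of an induction in stages for which `ρ` is the map induced from `σ`. -/
theorem isInductionInStages {r₁ : ℕ} [SmoothManifold r₁ (LeafSpace (k := kt) Ωt Ωσ Jt σ)]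
    (hJ : ContMDiff (𝓡 n) (𝓡 k) ∞ J) (hρ : ContMDiff (𝓡 nρ) (𝓡 k) ∞ ρ)
    (hJt : ContMDiff (𝓡 nt) (𝓡 kt) ∞ Jt) (hJh : ContMDiff (𝓡 nt) (𝓡 k) ∞ Jh)
    (hσ : ContMDiff (𝓡 nσ) (𝓡 kt) ∞ σ)
    (hcomm : ∀ (f : SmoothFn k P) (g : SmoothFn kt Pt) (y : St),
      Ωt.bracket (f ∘ Jh) (g ∘ Jt) y = 0)
    (h₁ : IsManifoldReduction (k := kt) Ωt Ωσ Jt σ m₁ r₁)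
    (T : LeafSpace (k := kt) Ωt Ωσ Jt σ ≃ₘ⟮𝓡 r₁, 𝓡 nρ⟯ Sρ)
    (hT : PullsBackToProduct Ωt Ωσ Jt σ m₁ Ωρ (fun q => T (toLeaf (k := kt) Ωt Ωσ Jt σ q)))
    (hTρ : ∀ q : Jt.Pullback σ, ρ (T (toLeaf (k := kt) Ωt Ωσ Jt σ q)) = Jh q.fst)
    (h' : IsManifoldReduction (k := k) Ω Ωt J Jh m' r')
    (h : IsManifoldReduction (k := k) Ω Ωρ J ρ m r)
    (hΩ' : PullsBackToProduct Ω Ωt J Jh m' Ω' (toLeaf (k := k) Ω Ωt J Jh))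
    (hJ' : ContMDiff (𝓡 r') (𝓡 kt) ∞ J')
    (hJ'p : ∀ q : J.Pullback Jh, J' (toLeaf (k := k) Ω Ωt J Jh q) = Jt q.snd) :
    IsInductionInStages kt m₁ m' m r Ωσ Ωρ ρ Jt σ
      (fun q => T (toLeaf (k := kt) Ωt Ωσ Jt σ q)) Ω' J' := by
  have hTs : ContMDiff (𝓡 m₁) (𝓡 nρ) ∞ (fun q => T (toLeaf (k := kt) Ωt Ωσ Jt σ q)) :=
    T.contMDiff.comp h₁.smooth_proj
  have hTd : ∀ (d : Jt.Pullback σ) (δ : TangentSpace (𝓡 m₁) d),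
      mfderiv (𝓡 m₁) (𝓡 nρ) (fun q => T (toLeaf (k := kt) Ωt Ωσ Jt σ q)) d δ =
        T.mfderivToContinuousLinearEquiv (by simp) (toLeaf (k := kt) Ωt Ωσ Jt σ d)
          (mfderiv (𝓡 m₁) (𝓡 r₁) (toLeaf (k := kt) Ωt Ωσ Jt σ) d δ) := by
    intro d δ
    have h1 := (((T.contMDiff (toLeaf (k := kt) Ωt Ωσ Jt σ d)).mdifferentiableAt
      (by simp)).hasMFDerivAt.comp d (h₁.hasMFDerivAt_proj d)).mfderiv
    exact congrArg (fun l : EuclideanSpace ℝ (Fin m₁) →L[ℝ] EuclideanSpace ℝ (Fin nρ) => l δ) h1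
  have hTsurj : ∀ d, Surjective
      (mfderiv (𝓡 m₁) (𝓡 nρ) (fun q => T (toLeaf (k := kt) Ωt Ωσ Jt σ q)) d) := by
    intro d x
    obtain ⟨y, rfl⟩ := (T.mfderivToContinuousLinearEquiv (by simp)
      (toLeaf (k := kt) Ωt Ωσ Jt σ d)).surjective x
    obtain ⟨δ, rfl⟩ := h₁.submersion d y
    exact ⟨δ, hTd d δ⟩
  refine ⟨h.smoothPullback hJ hρ, h'.smoothPullback hJ hJh, h₁.smoothPullback hJt hσ, h, h', hJ',
    hJ'p, hTs, hTsurj, T.surjective.comp toLeaf_surjective, hTρ,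
    fun d d' => T.injective.eq_iff, fun d δ => ?_, fun f d δ hδ => ?_, fun f y => ?_,
    fun g y => ?_, fun g q a ha => ?_⟩
  · have h1 : ∀ δ : TangentSpace (𝓡 m₁) d, mfderiv (𝓡 m₁) (𝓡 nρ) (fun q => T (toLeaf (k := kt) Ωt Ωσ Jt σ q)) d δ = 0 ↔
        mfderiv (𝓡 m₁) (𝓡 r₁) (toLeaf (k := kt) Ωt Ωσ Jt σ) d δ = 0 := by
      intro δ
      rw [hTd]
      exact (T.mfderivToContinuousLinearEquiv _ _).map_eq_zero_iff
    refine Iff.trans ⟨fun h0 => ?_, fun h0 => ?_⟩ h₁.mapsTangent_zero_iff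
    · exact ⟨(h₁.smooth_proj d).mdifferentiableAt (by simp), (h1 δ).1 h0.map⟩
    · exact ⟨(hTs d).mdifferentiableAt (by simp), (h1 δ).2 h0.map⟩
  · refine ⟨(hTs d).mdifferentiableAt (by simp), ?_⟩
    -- Since ρ∘τ = Jh∘fst, the function f∘ρ pulls back to f∘Jh on the first factor and 0 on the
    -- second.
    exact h₁.immersed.hamVec_of_comp_eq_add hTs hTsurj hT (F := f ∘ ρ) (f := f ∘ Jh)
      (g := fun _ => 0) (f.contMDiff.comp hρ) (f.contMDiff.comp hJh) contMDiff_const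
      (fun q => by rw [add_zero]; exact congrArg f (hTρ q)) d hδ.fst.map
      (hδ.snd.map.trans (Ωσ.hamVec_zero _).symm)
  · exact ⟨(hJt y).mdifferentiableAt (by simp), Ωt.mfderiv_hamVec_eq_zero hJt fun g => hcomm f g y⟩
  · refine ⟨(hJh y).mdifferentiableAt (by simp), Ωt.mfderiv_hamVec_eq_zero hJh fun f => ?_⟩
    rw [SymplecticForm.bracket_swap, hcomm, neg_zero]
  · refine ⟨(h'.smooth_proj q).mdifferentiableAt (by simp), ?_⟩
    exact h'.hamVec_descended hΩ' (F := g ∘ J') (f := fun _ => 0) (g := g ∘ Jt)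
      (g.contMDiff.comp hJ') contMDiff_const (g.contMDiff.comp hJt)
      (fun q => by rw [zero_add]; exact congrArg g (hJ'p q)) q
      (ha.fst.map.trans (Ω.hamVec_zero _).symm) ha.snd.map

end Stages

end

/-! ### Symplectic induction in stages -/

theorem theorem3
    {n nt nσ nρ k kt m₁ r₁ m' r' m r : ℕ} {S St Sσ Sρ P Pt : Type*}
    [TopologicalSpace S] [SmoothManifold n S] [TopologicalSpace St] [SmoothManifold nt St]
    [TopologicalSpace Sσ] [SmoothManifold nσ Sσ] [TopologicalSpace Sρ] [SmoothManifold nρ Sρ]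
    [TopologicalSpace P] [SmoothManifold k P] [TopologicalSpace Pt] [SmoothManifold kt Pt]
    -- symplectic and Poisson structures
    (Ω : SymplecticForm n S) (Ωt : SymplecticForm nt St)
    (Ωσ : SymplecticForm nσ Sσ) (Ωρ : SymplecticForm nρ Sρ)
    (π : PoissonStructure k P) (πt : PoissonStructure kt Pt)
    -- Poisson maps
    (J : S → P) (hJ : IsPoissonMap Ω π.neg J)
    (ρ : Sρ → P) (hρ : IsPoissonMap Ωρ π ρ)
    (Jt : St → Pt) (hJt : IsPoissonMap Ωt πt.neg Jt)
    (Jh : St → P) (hJh : IsPoissonMap Ωt π Jh)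
    (σ : Sσ → Pt) (hσ : IsPoissonMap Ωσ πt σ)
    (hcomm : ∀ (f : SmoothFn k P) (g : SmoothFn kt Pt) (y : St),
      Ωt.bracket (f ∘ Jh) (g ∘ Jt) y = 0)
    -- `ρ : Sρ → P` is induced from `σ` through `St`, up to a symplectomorphism `T`
    [SmoothManifold m₁ (Jt.Pullback σ)]
    [SmoothManifold r₁ (LeafSpace (k := kt) Ωt Ωσ Jt σ)]
    (h₁ : IsManifoldReduction (k := kt) Ωt Ωσ Jt σ m₁ r₁)
    (T : LeafSpace (k := kt) Ωt Ωσ Jt σ ≃ₘ⟮𝓡 r₁, 𝓡 nρ⟯ Sρ)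
    (hT : PullsBackToProduct Ωt Ωσ Jt σ m₁ Ωρ (fun q => T (toLeaf (k := kt) Ωt Ωσ Jt σ q)))
    (hTρ : ∀ q : Jt.Pullback σ, ρ (T (toLeaf (k := kt) Ωt Ωσ Jt σ q)) = Jh q.fst)
    -- `S'` is a manifold
    [SmoothManifold m' (J.Pullback Jh)]
    [SmoothManifold r' (LeafSpace (k := k) Ω Ωt J Jh)]
    (h' : IsManifoldReduction (k := k) Ω Ωt J Jh m' r')
    -- `S^ρ` is a manifold
    [SmoothManifold m (J.Pullback ρ)]
    [SmoothManifold r (LeafSpace (k := k) Ω Ωρ J ρ)]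
    (h : IsManifoldReduction (k := k) Ω Ωρ J ρ m r)
    -- the Poisson algebra `A`
    (A : NonUnitalSubalgebra ℝ (SmoothFn n S)) (hA : IsPoissonSubalgebra Ω A)
    (hAJ : ∀ f ∈ A, ∀ (g : SmoothFn k P) (x : S), Ω.bracket f (g ∘ J) x = 0) :
    -- (i) the symplectic space `S'`, the map `J'` and the morphism `μ`
    ∃ (Ω' : SymplecticForm r' (LeafSpace (k := k) Ω Ωt J Jh))
      (J' : LeafSpace (k := k) Ω Ωt J Jh → Pt)
      (μ : A →ₙₐ[ℝ] SmoothFn r' (LeafSpace (k := k) Ω Ωt J Jh)),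
      PullsBackToProduct Ω Ωt J Jh m' Ω' (toLeaf (k := k) Ω Ωt J Jh) ∧
      (∀ q : J.Pullback Jh, J' (toLeaf (k := k) Ω Ωt J Jh q) = Jt q.snd) ∧
      IsPoissonMap Ω' πt.neg J' ∧
      (∀ (f : A) (q : J.Pullback Jh), μ f (toLeaf (k := k) Ω Ωt J Jh q) = f.1 q.fst) ∧
      IsPoissonMorphism Ω Ω' μ ∧
      (∀ (f : A) (g : SmoothFn kt Pt) (s : LeafSpace (k := k) Ω Ωt J Jh),
        Ω'.bracket (μ f) (g ∘ J') s = 0) ∧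
      -- (ii) the symplectic spaces `S^ρ` and `(S')^σ` with the induced representations of `A`
      ∃ (ΩR : SymplecticForm r (LeafSpace (k := k) Ω Ωρ J ρ))
        (πρ : A →ₙₐ[ℝ] SmoothFn r (LeafSpace (k := k) Ω Ωρ J ρ))
        (m'' r'' : ℕ) (_ : SmoothManifold m'' (J'.Pullback σ))
        (_ : SmoothManifold r'' (LeafSpace (k := kt) Ω' Ωσ J' σ))
        (Ω'' : SymplecticForm r'' (LeafSpace (k := kt) Ω' Ωσ J' σ))
        (πσ : A →ₙₐ[ℝ] SmoothFn r'' (LeafSpace (k := kt) Ω' Ωσ J' σ))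
        (Φ : LeafSpace (k := kt) Ω' Ωσ J' σ ≃ₘ⟮𝓡 r'', 𝓡 r⟯ LeafSpace (k := k) Ω Ωρ J ρ),
        PullsBackToProduct Ω Ωρ J ρ m ΩR (toLeaf (k := k) Ω Ωρ J ρ) ∧
        (∀ (f : A) (q : J.Pullback ρ), πρ f (toLeaf (k := k) Ω Ωρ J ρ q) = f.1 q.fst) ∧
        IsPoissonMorphism Ω ΩR πρ ∧
        IsManifoldReduction (k := kt) Ω' Ωσ J' σ m'' r'' ∧
        PullsBackToProduct Ω' Ωσ J' σ m'' Ω'' (toLeaf (k := kt) Ω' Ωσ J' σ) ∧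
        (∀ (f : A) (q : J'.Pullback σ), πσ f (toLeaf (k := kt) Ω' Ωσ J' σ q) = μ f q.fst) ∧
        IsPoissonMorphism Ω Ω'' πσ ∧
        IsSymplectomorphism Ω'' ΩR Φ ∧
        (∀ (f : A) (w : LeafSpace (k := kt) Ω' Ωσ J' σ), πσ f w = πρ f (Φ w)) ∧
        -- (iii) the case `A = J₂^* C^∞(P₂)`
        ∀ {k₂ : ℕ} {P₂ : Type*} [TopologicalSpace P₂] [SmoothManifold k₂ P₂]
          (π₂ : PoissonStructure k₂ P₂) (J₂ : S → P₂), IsPoissonMap Ω π₂ J₂ →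
          (∀ f : SmoothFn n S, f ∈ A ↔ ∃ g : SmoothFn k₂ P₂, ∀ x, f x = g (J₂ x)) →
          ∃ (J₂' : LeafSpace (k := k) Ω Ωt J Jh → P₂)
            (Jσ : LeafSpace (k := kt) Ω' Ωσ J' σ → P₂)
            (Jρ : LeafSpace (k := k) Ω Ωρ J ρ → P₂),
            (∀ q : J.Pullback Jh, J₂' (toLeaf (k := k) Ω Ωt J Jh q) = J₂ q.fst) ∧
            IsPoissonMap Ω' π₂ J₂' ∧
            (∀ q : J'.Pullback σ, Jσ (toLeaf (k := kt) Ω' Ωσ J' σ q) = J₂' q.fst) ∧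
            IsPoissonMap Ω'' π₂ Jσ ∧
            (∀ q : J.Pullback ρ, Jρ (toLeaf (k := k) Ω Ωρ J ρ q) = J₂ q.fst) ∧
            IsPoissonMap ΩR π₂ Jρ ∧
            Jσ = Jρ ∘ Φ := by
  obtain ⟨Ω', hΩ'⟩ := h'.exists_reducedForm hJ.1 hJh.1
  obtain ⟨ΩR, hΩR⟩ := h.exists_reducedForm hJ.1 hρ.1
  have hcomm' : ∀ (g : SmoothFn kt Pt) (f : SmoothFn k P) (y : St),
      Ωt.bracket (g ∘ Jt) (f ∘ Jh) y = 0 := fun g f y => by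
    rw [SymplecticForm.bracket_swap, hcomm, neg_zero]
  have hA' : ∀ f ∈ A, ∀ x, mfderiv (𝓡 n) (𝓡 k) J x (Ω.hamVec f x) = 0 := fun f hf x =>
    Ω.mfderiv_hamVec_eq_zero hJ.1 fun g => hAJ f hf g x
  obtain ⟨J', hJ's, hJ'p⟩ := h'.exists_descent_snd hJt.1 fun f y =>
    Ωt.mfderiv_hamVec_eq_zero hJt.1 fun g => hcomm f g y
  obtain ⟨μ, hμ, hμP⟩ := h'.exists_representation hΩ' hJ.1 hAJ
  obtain ⟨πρ, hπρ, hπρP⟩ := h.exists_representation hΩR hJ.1 hAJ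
  have H := isInductionInStages hJ.1 hρ.1 hJt.1 hJh.1 hσ.1 hcomm h₁ T hT hTρ h' h hΩ' hJ's hJ'p
  obtain ⟨m'', sm, sr, Φ, Ψ, hD, hR, hΨ, hΦ⟩ := H.exists_reduction
  obtain ⟨Ω'', hΩ''⟩ := hR.exists_reducedForm hJ's hσ.1
  have hsymp := H.isSymplectomorphism hD hR hΨ hΦ hT hΩ' hΩR hΩ''
  -- Over w there are related points q and e with the same S-component; this identifies the formulas
  -- for the induced objects on both sides.
  have hpoint : ∀ w : J'.Pullback σ, ∃ (q : J.Pullback Jh) (e : J.Pullback ρ),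
      w.fst = toLeaf (k := k) Ω Ωt J Jh q ∧ e.fst = q.fst ∧
      Φ (toLeaf (k := kt) Ω' Ωσ J' σ w) = toLeaf (k := k) Ω Ωρ J ρ e := fun w => by
    obtain ⟨q, d, e, hw, hr⟩ := H.exists_related w
    exact ⟨q, e, congrArg Prod.fst hw, congrArg Prod.fst hr.val_eq,
      (hΦ w).trans (hΨ w q d e hw hr)⟩
  -- The representation on the two-stage space is defined as the pull-back along Φ of the other one,
  -- so the intertwining relation is definitional; its formula on classes remains to be checked.
  refine ⟨Ω', J', μ, hΩ', hJ'p, h'.isPoissonMap_descended_snd hΩ' hJh.1 hJt hJ's hJ'p hcomm',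
    hμ, hμP, fun f g s => ?_, ΩR, πρ, m'', r, sm, sr, Ω'', representationComp πρ Φ, Φ, hΩR, hπρ,
    hπρP, hR, hΩ'', fun f w => ?_, fun f g h hfg y => ?_, hsymp, fun f w => rfl, ?_⟩
  · obtain ⟨q, rfl⟩ := toLeaf_surjective s
    exact h'.bracket_descended_fst_snd hΩ' (μ f).contMDiff f.1.contMDiff (hμ f)
      (g.contMDiff.comp hJ's) (g.contMDiff.comp hJt.1) (fun q => congrArg g (hJ'p q)) q
      (hA' f.1 f.2 q.fst)
  · obtain ⟨q, e, h1, h2, h3⟩ := hpoint w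
    rw [h1, hμ, ← h2, ← hπρ]
    exact congrArg (πρ f) h3
  · exact (hπρP f g h hfg (Φ y)).trans
      (hsymp.bracket_comp (πρ f).contMDiff (πρ g).contMDiff y).symm
  · intro k₂ P₂ _ _ π₂ J₂ hJ₂ hAJ₂
    -- The pull-back g∘J₂ belongs to A, and A commutes with the pull-backs along J.
    have hJ₂J : ∀ (g : SmoothFn k₂ P₂) (f : SmoothFn k P) (x : S),
        Ω.bracket (g ∘ J₂) (f ∘ J) x = 0 := fun g f x =>
      hAJ ⟨g ∘ J₂, g.contMDiff.comp hJ₂.1⟩ ((hAJ₂ _).2 ⟨g, fun _ => rfl⟩) f x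
    have hker : ∀ (f : SmoothFn k P) (x : S),
        mfderiv (𝓡 n) (𝓡 k₂) J₂ x (Ω.hamVec (f ∘ J) x) = 0 := fun f x =>
      Ω.mfderiv_hamVec_eq_zero hJ₂.1 fun g => by
        rw [SymplecticForm.bracket_swap, hJ₂J, neg_zero]
    obtain ⟨J₂', hJ₂', hJ₂'p⟩ := h'.exists_descent_fst hJ₂.1 hker
    obtain ⟨Jρ, hJρ, hJρp⟩ := h.exists_descent_fst hJ₂.1 hker
    have hJρP : IsPoissonMap ΩR π₂ Jρ :=
      h.isPoissonMap_descended_fst hΩR hJ.1 hJ₂ hJρ hJρp hJ₂J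
    refine ⟨J₂', Jρ ∘ Φ, Jρ, hJ₂'p,
      h'.isPoissonMap_descended_fst hΩ' hJ.1 hJ₂ hJ₂' hJ₂'p hJ₂J, fun w => ?_,
      ⟨hJρ.comp Φ.contMDiff, fun f g y => ?_⟩, hJρp, hJρP, rfl⟩
    · obtain ⟨q, e, h1, h2, h3⟩ := hpoint w
      rw [h1, hJ₂'p, ← h2, ← hJρp]
      exact congrArg Jρ h3
    · exact (hsymp.bracket_comp (f.contMDiff.comp hJρ) (g.contMDiff.comp hJρ) y).trans
        (hJρP.2 f g (Φ y))
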